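/- Let $q\in\mathbb{C}$ with $0<|q|<1$ and put $$(a)_\infty=\prod_{k=0}^\infty(1-aq^k),\qquad (a)_l=\prod_{k=0}^{l-1}(1-aq^k)\ (l\in\mathbb{Z}_{\ge0}),\qquad (a,b)_\infty=(a)_\infty(b)_\infty .$$ For $l\in\mathbb{Z}_{\ge0}^M$ write $|l|=l_1+\cdots+l_M$, and for $y\in\mathbb{C}^M$ write $\Delta(y)=\Delta(\{y_i\})=\prod_{1\le i<j\le M}(y_i-y_j)$. Let $A,C,B_1,\dots,B_M,x_1,\dots,x_M\in\mathbb{C}$ with $|x_i|<1$ for all $i$, put $B=B_1\cdots B_M$, and let $$\varphi_D=\varphi_D\left(\begin{matrix}A;\{B_i\}\\ C\end{matrix};\{x_i\}\right)=\sum_{l\in\mathbb{Z}_{\ge0}^M}\frac{(A)_{|l|}}{(C)_{|l|}}\prod_{i=1}^M\frac{(B_i)_{l_i}}{(q)_{l_i}}x_i^{l_i}$$ be the $q$-Appell--Lauricella series. Assume that none of the denominators vanishes; namely, for all three formulas, $x_i\neq0$, $B_i\ne0$, $Cq^n\ne1$, $B_ix_iq^n\neq1$ for all $i$ and all $n\in\mathbb{Z}_{\ge0}$,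 and $B_ix_iq^n\ne B_jx_j$ for all $i\neq j$ and $n\in\mathbb{Z}_{\ge0}$. Then the series $\varphi_D$ converges absolutely, and the following hold, where each multiple series on the left converges absolutely. (1) If moreover $C\ne0$, $Ax_iq^n\ne1$, $AB_ix_iq^n\neq1$ and $AB_ix_i\ne q$ for all $i$ and all $n\in\mathbb{Z}_{\ge0}$, then $$\prod_{i=1}^M\frac{(Ax_i,B_ix_i)_\infty}{(AB_ix_i,x_i)_\infty}\sum_{l\in\mathbb{Z}_{\ge0}^M}q^{\binom{|l|}{2}}\frac{\Delta(\{B_ix_iq^{l_i}\})}{\Delta(\{B_ix_i\})}\frac{(A)_{|l|}}{(C)_{|l|}}\prod_{i=1}^M\left(\frac{1-AB_ix_iq^{|l|+l_i}/q}{1-AB_ix_i/q}\cdot\frac{(AB_ix_i/q)_{|l|}\prod_{j=1}^M(B_ix_i/x_j)_{l_i}\cdot(AB_ix_i/C)_{l_i}(B_iCx_i/B)^{l_i}q^{\binom{l_i}{2}}}{(Ax_i)_{|l|}\prod_{j=1}^M(qB_ix_i/(B_jx_j))_{l_i}\cdot(B_ix_i)_{l_i}}\right)=\varphi_D .$$ (2)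 If moreover $C\neq0$ and $|C/B|<1$, then $$\frac{(C/B)_\infty}{(C)_\infty}\prod_{i=1}^M\frac{(B_ix_i)_\infty}{(x_i)_\infty}\sum_{l\in\mathbb{Z}_{\ge0}^M}\left(\frac CB\right)^{|l|}\frac{\Delta(\{B_ix_iq^{l_i}\})}{\Delta(\{B_ix_i\})}\prod_{i=1}^M\frac{\prod_{j=1}^M(B_ix_i/x_j)_{l_i}\cdot(AB_ix_i/C)_{l_i}}{\prod_{j=1}^M(qB_ix_i/(B_jx_j))_{l_i}\cdot(B_ix_i)_{l_i}}=\varphi_D .$$ (3) If moreover $A\ne0$, then $$\prod_{i=1}^M\frac{(B_ix_i)_\infty}{(x_i)_\infty}\sum_{l\in\mathbb{Z}_{\ge0}^M}\left(-\frac AB\right)^{|l|}\frac{\Delta(\{B_ix_iq^{l_i}\})}{\Delta(\{B_ix_i\})}\frac{(C/A)_{|l|}}{(C)_{|l|}}\prod_{i=1}^M\frac{\prod_{j=1}^M(B_ix_i/x_j)_{l_i}\cdot(B_ix_i)^{l_i}q^{\binom{l_i}{2}}}{\prod_{j=1}^M(qB_ix_i/(B_jx_j))_{l_i}\cdot(B_ix_i)_{l_i}}=\varphi_D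 .$$ -/

import Mathlib

open scoped BigOperators

noncomputable section

namespace QAppell

/-- The infinite `q`-shifted factorial `(a)_∞ = ∏_{i ≥ 0} (1 - a q^i)`. -/
def qInf (q a : ℂ) : ℂ := ∏' i : ℕ, (1 - a * q ^ i)

/-- The `q`-shifted factorial `(a)_l = ∏_{0 ≤ k < l} (1 - a q^k)` for `l ∈ ℕ`. It equals
`(a)_∞ / (a q^l)_∞` whenever the latter makes sense, see `qPoch_eq_div`. -/
def qPoch (q a : ℂ) (l : ℕ) : ℂ := ∏ k ∈ Finset.range l, (1 - a * q ^ k)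

theorem multipliable_qInf {q : ℂ} (hq : ‖q‖ < 1) (a : ℂ) :
    Multipliable fun i : ℕ => 1 - a * q ^ i := by
  have h : Summable fun i : ℕ => ‖-(a * q ^ i)‖ := by
    simp only [norm_neg, norm_mul, norm_pow]
    exact (summable_geometric_of_lt_one (norm_nonneg q) hq).mul_left ‖a‖
  simpa [sub_eq_add_neg] using multipliable_one_add_of_summable h

theorem qPoch_eq_div {q : ℂ} (hq : ‖q‖ < 1) (a : ℂ) (l : ℕ) (h : qInf q (a * q ^ l) ≠ 0) :
    qPoch q a l = qInf q a / qInf q (a * q ^ l) := by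
  rw [eq_div_iff h]
  induction l with
  | zero => simp [qPoch]
  | succ n ih =>
    have step : qInf q (a * q ^ n) = (1 - a * q ^ n) * qInf q (a * q ^ (n + 1)) := by
      have e : (fun i : ℕ => 1 - a * q ^ (n + 1) * q ^ i)
          = fun i : ℕ => 1 - a * q ^ n * q ^ (i + 1) := by
        funext i; ring
      have hm : Multipliable fun i : ℕ => 1 - a * q ^ n * q ^ (i + 1) :=
        e ▸ multipliable_qInf hq (a * q ^ (n + 1))
      unfold qInf
      rw [e, tprod_eq_zero_mul' (f := fun i : ℕ => 1 - a * q ^ n * q ^ i) hm]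
      simp
    by_cases h0 : qInf q (a * q ^ n) = 0
    · have h1 : 1 - a * q ^ n = 0 := by
        rw [step] at h0
        exact (mul_eq_zero.mp h0).resolve_right h
      have hp : qPoch q a (n + 1) = 0 :=
        Finset.prod_eq_zero (Finset.mem_range.mpr (Nat.lt_succ_self n)) h1
      have hi : qInf q a = 0 := by
        refine HasProd.tprod_eq ?_
        refine tendsto_const_nhds.congr' ?_
        filter_upwards [Filter.eventually_ge_atTop ({n} : Finset ℕ)] with s hs
        exact (Finset.prod_eq_zero (Finset.singleton_subset_iff.mp hs) h1).symm
      rw [hp, hi, zero_mul]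
    · rw [← ih h0, step, qPoch, qPoch, Finset.prod_range_succ, mul_assoc]

variable {M : ℕ}

/-- The Vandermonde product `Δ(x) = ∏_{i < j} (x_i - x_j)`. -/
def vand (x : Fin M → ℂ) : ℂ := ∏ i, ∏ j ∈ Finset.Ioi i, (x i - x j)

/-- The length `|l| = l_1 + ⋯ + l_M` of a multi-index. -/
def len (l : Fin M → ℕ) : ℕ := ∑ i, l i

/-- The summand of the `q`-Appell--Lauricella series. -/
def phiDTerm (q A : ℂ) (B : Fin M → ℂ) (C : ℂ) (x : Fin M → ℂ) (l : Fin M → ℕ) : ℂ :=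
  qPoch q A (len l) / qPoch q C (len l) *
    ∏ i, (qPoch q (B i) (l i) / qPoch q q (l i) * x i ^ l i)

/-- The `q`-Appell--Lauricella series `φ_D(A; B_1, …, B_M; C; x_1, …, x_M)`. -/
def phiD (q A : ℂ) (B : Fin M → ℂ) (C : ℂ) (x : Fin M → ℂ) : ℂ :=
  ∑' l : Fin M → ℕ, phiDTerm q A B C x l

/-- The quotient `Δ({B_i x_i q^{l_i}}) / Δ({B_i x_i})`. -/
def vandRatio (q : ℂ) (B x : Fin M → ℂ) (l : Fin M → ℕ) : ℂ :=
  vand (fun i => B i * x i * q ^ l i) / vand (fun i => B i * x i)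

/-- The summand of the first multiple series. -/
def term₁ (q A : ℂ) (B : Fin M → ℂ) (C : ℂ) (x : Fin M → ℂ) (l : Fin M → ℕ) : ℂ :=
  q ^ (len l).choose 2 * vandRatio q B x l * (qPoch q A (len l) / qPoch q C (len l)) *
    ∏ i, ((1 - A * B i * x i * q ^ (len l + l i) / q) / (1 - A * B i * x i / q) *
      ((qPoch q (A * B i * x i / q) (len l) * (∏ j, qPoch q (B i * x i / x j) (l i)) *
          qPoch q (A * B i * x i / C) (l i) * (B i * C * x i / ∏ j, B j) ^ l i *
          q ^ (l i).choose 2) /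
        (qPoch q (A * x i) (len l) * (∏ j, qPoch q (q * B i * x i / (B j * x j)) (l i)) *
          qPoch q (B i * x i) (l i))))

/-- The summand of the second multiple series. -/
def term₂ (q A : ℂ) (B : Fin M → ℂ) (C : ℂ) (x : Fin M → ℂ) (l : Fin M → ℕ) : ℂ :=
  (C / ∏ j, B j) ^ len l * vandRatio q B x l *
    ∏ i, (((∏ j, qPoch q (B i * x i / x j) (l i)) * qPoch q (A * B i * x i / C) (l i)) /
      ((∏ j, qPoch q (q * B i * x i / (B j * x j)) (l i)) * qPoch q (B i * x i) (l i)))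

/-- The summand of the third multiple series. -/
def term₃ (q A : ℂ) (B : Fin M → ℂ) (C : ℂ) (x : Fin M → ℂ) (l : Fin M → ℕ) : ℂ :=
  (-(A / ∏ j, B j)) ^ len l * vandRatio q B x l *
    (qPoch q (C / A) (len l) / qPoch q C (len l)) *
    ∏ i, (((∏ j, qPoch q (B i * x i / x j) (l i)) * (B i * x i) ^ l i * q ^ (l i).choose 2) /
      ((∏ j, qPoch q (q * B i * x i / (B j * x j)) (l i)) * qPoch q (B i * x i) (l i)))

end QAppell

end

open scoped BigOperators

noncomputable section

namespace QAppell

open Finset Function Polynomial Filter Topology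

variable {M : ℕ}

/-! All three multiple series are compared with one single series. Andrews' formula
`phiD_eq_tsum_dualTerm` says that, for |A| < 1, φ_D equals (A)_∞/(C)_∞ ∏ (B_i x_i)_∞/(x_i)_∞ times
∑_k A^k (C/A)_k/(q)_k ∏ (x_i)_k/(B_i x_i)_k: expand (A)_{|l|}/(C)_{|l|} by the q-binomial theorem,
then sum over each l_i by the q-binomial theorem again.

The bridge is the finite identity `multiSum_eq`. For a polynomial P of degree at most M + 1, the
part of degree n of an A_n series with weight P(u)/(1 - u) is a convolution over k + r = n; the
factor in k is built from the values P(q^{-j}) and from ∏ (z_i)_k. The proof is by induction on n.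
Lagrange interpolation splits 1 - q^{n+1} into M pieces, each of which lowers one l_i and replaces
z_i by q z_i (`multiSum_succ`). A second interpolation, with q^{-k} as an additional node, adds the
pieces up again (`sum_partialFraction`), and the one-variable side satisfies the same recursion
(`dualWeight_rec`).

Take z_i = B_i x_i. With P = (a - bX) ∏ (1 - X/x_j) the identity becomes `sum_baseCoeff`. For (a, b)
= (1, A/C) the convolution is a Cauchy product with a q-binomial series, which gives (2); for (a, b)
= (0, -1) the inner sum is a summable ₁φ₁, which gives (3). For (1) one adds a variable z₀ = q/(A
q^N), uses P = X (1 - AX/C) ∏ (1 - X/x_j) in degree N (`tsum_term₁_truncated`), and lets N tend to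
infinity under a dominating series.

These arguments need A small, and nonzero for (1). Once the denominators in A are cleared both sides
are entire in A, so the identity theorem (`eq_of_eq_near_zero`) removes the restriction. -/

/-! ### Finite products: Vandermonde products and q-shifted factorials -/

theorem prod_erase_eq_prod_ite {ι : Type*} [Fintype ι] [DecidableEq ι] (i : ι) (f : ι → ℂ) :
    ∏ j ∈ univ.erase i, f j = ∏ j, if j = i then 1 else f j := by
  rw [← mul_prod_erase univ _ (mem_univ i)]
  rw [if_pos rfl, one_mul]
  exact prod_congr rfl fun j hj => (if_neg (ne_of_mem_erase hj)).symm

theorem prod_prod_ite {ι : Type*} [Fintype ι] [DecidableEq ι] (i : ι) (f g : ι → ℂ) :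
    ∏ a, ∏ b, (if a = i then f b else if b = i then g a else 1)
      = (∏ b, f b) * ∏ a ∈ univ.erase i, g a := by
  rw [← mul_prod_erase univ _ (mem_univ i)]
  congr 1
  · simp
  · refine prod_congr rfl fun a ha => ?_
    simp [ne_of_mem_erase ha]

/-- Each k ≠ i lies in exactly one pair a < b together with i. Writing a product over k ≠ i as a
product over pairs allows a factorwise comparison with a Vandermonde product. -/
theorem prod_Ioi_ite (i : Fin M) (g : Fin M → ℂ) :
    ∏ a, ∏ b ∈ Ioi a, (if a = i then g b else if b = i then g a else 1)
      = ∏ k ∈ univ.erase i, g k := by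
  have h1 : ∀ a, ∏ b ∈ Ioi a, (if a = i then g b else if b = i then g a else 1)
      = (if a = i then ∏ b ∈ Ioi i, g b else 1) * (if a < i then g a else 1) := by
    intro a
    by_cases ha : a = i
    · subst ha; simp
    · simp [ha]
  have h2 : univ.erase i = Ioi i ∪ Iio i := by
    ext k; simp only [mem_erase, mem_univ, mem_union, mem_Ioi, mem_Iio, and_true]
    constructor
    · intro h; exact (lt_or_gt_of_ne h).symm
    · rintro (h | h)
      · exact h.ne'
      · exact h.ne
  have h3 : Disjoint (Ioi i) (Iio i) := by
    rw [disjoint_left]; intro k hk hk'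
    exact absurd (mem_Ioi.1 hk) (not_lt.2 (mem_Iio.1 hk').le)
  rw [h2, prod_union h3]
  simp_rw [h1]
  rw [prod_mul_distrib, prod_ite_eq' univ i, if_pos (mem_univ _)]
  congr 1
  rw [← prod_filter]
  congr 1
  ext k; simp

/-- Only the factors that contain the index i change, and the sign due to the order of a pair is the
same on both sides. The cross-multiplied form needs no distinctness. -/
theorem vand_update (z : Fin M → ℂ) (i : Fin M) (w : ℂ) :
    vand (update z i w) * ∏ k ∈ univ.erase i, (z i - z k)
      = vand z * ∏ k ∈ univ.erase i, (w - z k) := by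
  rw [← prod_Ioi_ite i, ← prod_Ioi_ite i, vand, vand, ← prod_mul_distrib, ← prod_mul_distrib]
  refine prod_congr rfl fun a _ => ?_
  rw [← prod_mul_distrib, ← prod_mul_distrib]
  refine prod_congr rfl fun b hb => ?_
  have hab : a ≠ b := (mem_Ioi.1 hb).ne
  by_cases ha : a = i
  · subst ha
    simp [update_of_ne hab.symm]; ring
  · by_cases hb' : b = i
    · subst hb'
      simp [ha]; ring
    · simp [ha, hb']

theorem vand_ne_zero {z : Fin M → ℂ} (h : ∀ i j, i ≠ j → z i ≠ z j) : vand z ≠ 0 :=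
  prod_ne_zero_iff.2 fun i _ => prod_ne_zero_iff.2 fun j hj =>
    sub_ne_zero.2 (h i j (mem_Ioi.1 hj).ne)

theorem qPoch_zero (q a : ℂ) : qPoch q a 0 = 1 := by simp [qPoch]

theorem qPoch_succ (q a : ℂ) (n : ℕ) : qPoch q a (n + 1) = qPoch q a n * (1 - a * q ^ n) :=
  prod_range_succ _ _

theorem qPoch_succ' (q a : ℂ) (n : ℕ) : qPoch q a (n + 1) = (1 - a) * qPoch q (a * q) n := by
  rw [qPoch, prod_range_succ', mul_comm, qPoch]
  simp only [pow_zero, mul_one, pow_succ']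
  congr 1
  exact prod_congr rfl fun k _ => by ring

theorem qPoch_add (q a : ℂ) (m n : ℕ) :
    qPoch q a (m + n) = qPoch q a m * qPoch q (a * q ^ m) n := by
  rw [qPoch, prod_range_add, qPoch, qPoch]
  congr 1
  exact prod_congr rfl fun k _ => by ring

theorem qPoch_ne_zero {q a : ℂ} {n : ℕ} (h : ∀ m < n, a * q ^ m ≠ 1) : qPoch q a n ≠ 0 :=
  prod_ne_zero_iff.2 fun m hm => sub_ne_zero.2 (h m (mem_range.1 hm)).symm

/-! ### A_n sums of fixed degree and their one-variable dual -/

/-- The `A_n` coefficient `Δ(z q^l) / Δ(z) ∏_{i,j} 1 / (q z_i / z_j)_{l_i}`. -/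
def vandCoeff (q : ℂ) (z : Fin M → ℂ) (l : Fin M → ℕ) : ℂ :=
  vand (fun i => z i * q ^ l i) / vand z * (∏ i, ∏ j, qPoch q (q * z i / z j) (l i))⁻¹

/-- The homogeneous part of degree `n` of an `A_n` series with weight `w`. -/
def multiSum (q : ℂ) (z : Fin M → ℂ) (w : ℂ → ℂ) (n : ℕ) : ℂ :=
  ∑ l ∈ Nat.antidiagonalTuple M n, vandCoeff q z l * ∏ i, ∏ m ∈ range (l i), w (z i * q ^ m)

/-- The partial fraction coefficient attached to the variable `z_i`. -/
def shiftRatio (q : ℂ) (z : Fin M → ℂ) (l : Fin M → ℕ) (i : Fin M) : ℂ :=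
  (1 - q ^ l i) * ∏ k ∈ univ.erase i, ((z i - z k * q ^ l k) / (z i - z k))

/-- Raising l_i by one and replacing z_i by q z_i produce the same points z_a q^{l_a}, so the two
coefficients differ only in their denominators and in Δ(z). The factor `shiftRatio` is what makes
the quotient independent of l. -/
theorem vandCoeff_shift {q : ℂ} (hq0 : q ≠ 0) (hq : ∀ m : ℕ, q ^ (m + 1) ≠ 1) {z : Fin M → ℂ}
    (hz : ∀ i, z i ≠ 0) (i : Fin M) (l : Fin M → ℕ) {n : ℕ} (hl : ∀ k, l k ≤ n)
    (hd : ∀ i j, i ≠ j → ∀ m ≤ n + 1, z i * q ^ m ≠ z j) :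
    shiftRatio q z (update l i (l i + 1)) i * vandCoeff q z (update l i (l i + 1))
      = (∏ k ∈ univ.erase i, (1 - z i / z k))⁻¹ * vandCoeff q (update z i (q * z i)) l := by
  set z' := update z i (q * z i) with hz'
  set l' := update l i (l i + 1) with hl'
  have hne : ∀ a b, a ≠ b → z a ≠ z b := fun a b hab => by simpa using hd a b hab 0 (by omega)
  have hV := vand_update z i (q * z i)
  have hN : (fun a => z' a * q ^ l a) = fun a => z a * q ^ l' a := by
    funext a
    by_cases ha : a = i
    · subst ha; simp [hz', hl']; ring
    · simp [hz', hl', ha]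
  -- The double products of factorials agree outside row i and column i; the correction factors on
  -- both sides are recorded entry by entry, without division.
  have hpair : (∏ a, ∏ b, qPoch q (q * z' a / z' b) (l a)) *
      (∏ a, ∏ b, if a = i then (if b = i then 1 - q ^ (l i + 1) else 1 - q * z i / z b)
        else if b = i then 1 - z a * q ^ l a / z i else 1)
      = (∏ a, ∏ b, qPoch q (q * z a / z b) (l' a)) *
        (∏ a, ∏ b, if a = i then 1 else if b = i then 1 - z a / z i else 1) := by
    simp only [← prod_mul_distrib]
    refine prod_congr rfl fun a _ => prod_congr rfl fun b _ => ?_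
    by_cases ha : a = i
    · subst ha
      by_cases hb : b = a
      · subst hb
        have := hz b
        simp only [hz', hl', update_self, if_true, qPoch_succ]
        rw [mul_div_assoc, div_self (mul_ne_zero hq0 (hz b)), mul_div_assoc, div_self (hz b)]
        ring
      · simp only [hz', hl', update_self, if_true, hb, if_false, update_of_ne hb]
        rw [qPoch_succ']
        rw [show q * (q * z a) / z b = q * z a / z b * q by ring]
        ring
    · by_cases hb : b = i
      · subst hb
        have := hz b
        simp only [hz', hl', update_self, ha, if_true, if_false, update_of_ne ha]
        rw [show q * z a / (q * z b) = z a / z b by field_simp,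
          show 1 - z a * q ^ l a / z b = 1 - z a / z b * q ^ l a by ring, ← qPoch_succ,
          qPoch_succ', mul_comm, show q * z a / z b = z a / z b * q by ring]
      · simp [hz', hl', ha, hb]
  rw [prod_prod_ite i (fun b => if b = i then 1 - q ^ (l i + 1) else 1 - q * z i / z b)
    (fun a => 1 - z a * q ^ l a / z i), prod_prod_ite i (fun _ => 1) (fun a => 1 - z a / z i),
    ← mul_prod_erase univ (fun b => if b = i then 1 - q ^ (l i + 1) else 1 - q * z i / z b)
      (mem_univ i), if_pos rfl, prod_const_one, one_mul,
    prod_congr rfl (g := fun b => 1 - q * z i / z b)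
      (fun b hb => if_neg (ne_of_mem_erase hb))] at hpair
  have hW' : (∏ a, ∏ b, qPoch q (q * z' a / z' b) (l a)) ≠ 0 := by
    refine prod_ne_zero_iff.2 fun a _ => prod_ne_zero_iff.2 fun b _ => qPoch_ne_zero fun m hm => ?_
    have hm' : m < n := lt_of_lt_of_le hm (hl a)
    by_cases hab : a = b
    · subst hab
      have : z' a ≠ 0 := by
        by_cases ha : a = i
        · subst ha; simp [hz', hq0, hz]
        · simp [hz', ha, hz]
      rw [mul_div_assoc, div_self this, mul_one, ← pow_succ']
      exact hq m
    · by_cases ha : a = i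
      · subst ha
        simp only [hz', update_self, update_of_ne (Ne.symm hab)]
        intro h
        refine hd a b hab (m + 2) (by omega) ?_
        have := hz b
        field_simp at h
        rw [← h]; ring
      · by_cases hb : b = i
        · subst hb
          simp only [hz', update_self, update_of_ne ha]
          intro h
          refine hd a b hab m (by omega) ?_
          have := hz b
          field_simp at h
          rw [← h]
        · simp only [hz', update_of_ne ha, update_of_ne hb]
          intro h
          refine hd a b hab (m + 1) (by omega) ?_
          have := hz b
          field_simp at h
          rw [← h]; ring
  have e1 : ∏ k ∈ univ.erase i, (z i - z k) ≠ 0 := prod_ne_zero_iff.2 fun k hk =>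
    sub_ne_zero.2 (hne i k (ne_of_mem_erase hk).symm)
  have e2 : ∏ k ∈ univ.erase i, (q * z i - z k) ≠ 0 := prod_ne_zero_iff.2 fun k hk =>
    sub_ne_zero.2 (by
      have := hd i k (ne_of_mem_erase hk).symm 1 (by omega)
      rwa [pow_one, mul_comm] at this)
  have e3 : ∏ k ∈ univ.erase i, (1 - z k / z i) ≠ 0 := prod_ne_zero_iff.2 fun k hk =>
    sub_ne_zero.2 fun h => hne i k (ne_of_mem_erase hk).symm (by
      have := hz i; field_simp at h; exact h)
  have e4 : ∏ k ∈ univ.erase i, (1 - z k * q ^ l k / z i) ≠ 0 := prod_ne_zero_iff.2 fun k hk =>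
    sub_ne_zero.2 fun h => hd k i (ne_of_mem_erase hk) (l k) ((hl k).trans (by omega)) (by
      have := hz i; field_simp at h; exact h.symm)
  have e5 : ∏ k ∈ univ.erase i, (1 - q * z i / z k) ≠ 0 := prod_ne_zero_iff.2 fun k hk =>
    sub_ne_zero.2 fun h => hd i k (ne_of_mem_erase hk).symm 1 (by omega) (by
      have := hz k; field_simp at h; rw [h]; ring)
  have e6 : (1 : ℂ) - q ^ (l i + 1) ≠ 0 := sub_ne_zero.2 (hq _).symm
  have e7 : ∏ k ∈ univ.erase i, (1 - z i / z k) ≠ 0 := prod_ne_zero_iff.2 fun k hk =>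
    sub_ne_zero.2 fun h => hne i k (ne_of_mem_erase hk).symm (by
      have := hz k; field_simp at h; exact h.symm)
  have hvz := vand_ne_zero hne
  have hvz' : vand z' ≠ 0 := fun h => by
    rw [← hz', h, zero_mul] at hV
    exact mul_ne_zero hvz e2 hV.symm
  have hW : (∏ a, ∏ b, qPoch q (q * z a / z b) (l' a)) ≠ 0 := fun h => by
    rw [h, zero_mul] at hpair
    exact mul_ne_zero hW' (mul_ne_zero (mul_ne_zero e6 e5) e4) hpair
  have hr : shiftRatio q z l' i = (1 - q ^ (l i + 1)) *
      ((∏ k ∈ univ.erase i, (z i - z k * q ^ l k)) / ∏ k ∈ univ.erase i, (z i - z k)) := by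
    rw [shiftRatio, ← prod_div_distrib]
    simp only [hl', update_self]
    congr 1
    exact prod_congr rfl fun k hk => by rw [update_of_ne (ne_of_mem_erase hk)]
  have hk : (∏ k ∈ univ.erase i, (z i - z k * q ^ l k)) * (∏ k ∈ univ.erase i, (1 - z i / z k)) *
      (∏ k ∈ univ.erase i, (q * z i - z k)) * (∏ k ∈ univ.erase i, (1 - z k / z i))
      = (∏ k ∈ univ.erase i, (z i - z k)) * (∏ k ∈ univ.erase i, (z i - z k)) *
      (∏ k ∈ univ.erase i, (1 - q * z i / z k)) * (∏ k ∈ univ.erase i, (1 - z k * q ^ l k / z i)) := by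
    simp only [← prod_mul_distrib]
    refine prod_congr rfl fun k _ => ?_
    have := hz k; have := hz i
    field_simp
    ring
  rw [hr, vandCoeff, vandCoeff, hN]
  rw [← hz'] at hV
  generalize vand (fun a => z a * q ^ l' a) = N at *
  generalize vand z' = V' at *
  generalize vand z = V at *
  generalize (∏ a, ∏ b, qPoch q (q * z a / z b) (l' a)) = W at *
  generalize (∏ a, ∏ b, qPoch q (q * z' a / z' b) (l a)) = W' at *
  generalize (∏ k ∈ univ.erase i, (z i - z k)) = a1 at *
  generalize (∏ k ∈ univ.erase i, (q * z i - z k)) = a2 at *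
  generalize (∏ k ∈ univ.erase i, (1 - z k / z i)) = a3 at *
  generalize (∏ k ∈ univ.erase i, (1 - z k * q ^ l k / z i)) = a4 at *
  generalize (∏ k ∈ univ.erase i, (1 - q * z i / z k)) = a5 at *
  generalize (∏ k ∈ univ.erase i, (1 - z i / z k)) = a7 at *
  generalize (∏ k ∈ univ.erase i, (z i - z k * q ^ l k)) = a8 at *
  generalize (1 : ℂ) - q ^ (l i + 1) = a6 at *
  have hWe : W = W' * (a6 * a5 * a4) / a3 := by field_simp; linear_combination -hpair
  have hVe : V' = V * a2 / a1 := by field_simp; linear_combination hV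
  rw [hWe, hVe]
  field_simp
  linear_combination N * hk

/-- Lagrange interpolation at the M + 1 nodes 0, z_1, …, z_M, read off in the top coefficient. -/
theorem sum_eval_div {z : Fin M → ℂ} (hz : ∀ i, z i ≠ 0) (hne : ∀ i j, i ≠ j → z i ≠ z j)
    {P : ℂ[X]} (hP : P.natDegree ≤ M) :
    ∑ i, P.eval (z i) / (z i * ∏ j ∈ univ.erase i, (z i - z j)) + P.eval 0 / ∏ j, (-z j)
      = P.coeff M := by
  have hinj : Set.InjOn (Fin.cons 0 z : Fin (M + 1) → ℂ) (univ : Finset (Fin (M + 1))) := by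
    intro a _ b _
    refine Fin.cases ?_ (fun a => ?_) a <;> refine Fin.cases ?_ (fun b => ?_) b
    · simp
    · intro h; exact absurd h.symm (by simpa using hz b)
    · intro h; exact absurd h (by simpa using hz a)
    · intro h
      by_contra hab
      exact hne a b (fun e => hab (by rw [e])) (by simpa using h)
  have h := Lagrange.coeff_eq_sum hinj (P := P) (by
    rw [card_univ, Fintype.card_fin]
    exact lt_of_le_of_lt P.degree_le_natDegree (by exact_mod_cast Nat.lt_succ_of_le hP))
  rw [card_univ, Fintype.card_fin, Nat.add_sub_cancel, Fin.sum_univ_succ] at h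
  rw [h, add_comm]
  congr 1
  · rw [prod_erase_eq_prod_ite, Fin.prod_univ_succ]
    simp [Fin.succ_ne_zero]
  · refine sum_congr rfl fun i _ => ?_
    rw [prod_erase_eq_prod_ite, prod_erase_eq_prod_ite, Fin.prod_univ_succ]
    simp [(Fin.succ_ne_zero i).symm]

/-- Apply `sum_eval_div` to the monic polynomial ∏ (X - z_k q^{l_k}): the top coefficient is 1 and
the node 0 contributes q^{|l|}. -/
theorem sum_shiftRatio {q : ℂ} {z : Fin M → ℂ} (hz : ∀ i, z i ≠ 0)
    (hne : ∀ i j, i ≠ j → z i ≠ z j) (l : Fin M → ℕ) :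
    ∑ i, shiftRatio q z l i = 1 - q ^ ∑ i, l i := by
  have hmon := monic_prod_X_sub_C (fun k => z k * q ^ l k) (univ : Finset (Fin M))
  have hdeg := natDegree_finsetProd_X_sub_C_eq_card (univ : Finset (Fin M))
    (fun k => z k * q ^ l k)
  rw [card_univ, Fintype.card_fin] at hdeg
  have h := sum_eval_div hz hne hdeg.le
  have hc : (∏ k, (X - C (z k * q ^ l k)) : ℂ[X]).coeff M = 1 := by
    have := hmon.coeff_natDegree
    rwa [hdeg] at this
  rw [hc] at h
  have h0 : (∏ k, (X - C (z k * q ^ l k)) : ℂ[X]).eval 0 / ∏ j, (-z j) = q ^ ∑ i, l i := by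
    rw [eval_prod, ← prod_div_distrib, ← prod_pow_eq_pow_sum]
    refine prod_congr rfl fun k _ => ?_
    have := hz k
    simp
    field_simp
  rw [h0] at h
  rw [← h, add_sub_cancel_right]
  refine sum_congr rfl fun i _ => ?_
  rw [eval_prod, ← mul_prod_erase univ _ (mem_univ i), shiftRatio, prod_div_distrib]
  have := hz i
  simp only [eval_sub, eval_X, eval_C]
  rw [show z i - z i * q ^ l i = z i * (1 - q ^ l i) by ring]
  rw [mul_assoc, mul_div_mul_left _ _ this, mul_div_assoc]

theorem multiSum_zero (q : ℂ) {z : Fin M → ℂ} (hne : ∀ i j, i ≠ j → z i ≠ z j) (w : ℂ → ℂ) :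
    multiSum q z w 0 = 1 := by
  rw [multiSum, Nat.antidiagonalTuple_zero_right, sum_singleton]
  simp [vandCoeff, qPoch_zero, vand_ne_zero hne]

/-- In degree n + 1 the factor 1 - q^{n+1} is the sum of the `shiftRatio`s. The i-th piece is
reindexed by lowering l_i, and `vandCoeff_shift` turns it into a sum of degree n at shifted
variables. -/
theorem multiSum_succ {q : ℂ} (hq0 : q ≠ 0) (hq : ∀ m : ℕ, q ^ (m + 1) ≠ 1) {z : Fin M → ℂ}
    (hz : ∀ i, z i ≠ 0) (w : ℂ → ℂ) {n : ℕ}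
    (hd : ∀ i j, i ≠ j → ∀ m ≤ n + 1, z i * q ^ m ≠ z j) :
    (1 - q ^ (n + 1)) * multiSum q z w (n + 1)
      = ∑ i, w (z i) * (∏ k ∈ univ.erase i, (1 - z i / z k))⁻¹ *
          multiSum q (update z i (q * z i)) w n := by
  have hne : ∀ a b, a ≠ b → z a ≠ z b := fun a b hab => by simpa using hd a b hab 0 (by omega)
  have h1 : (1 - q ^ (n + 1)) * multiSum q z w (n + 1)
      = ∑ i, ∑ l ∈ Nat.antidiagonalTuple M (n + 1), shiftRatio q z l i *
          (vandCoeff q z l * ∏ i, ∏ m ∈ range (l i), w (z i * q ^ m)) := by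
    rw [sum_comm, multiSum, mul_sum]
    refine sum_congr rfl fun l hl => ?_
    rw [← sum_mul, sum_shiftRatio hz hne, Nat.mem_antidiagonalTuple.1 hl]
  rw [h1]
  refine sum_congr rfl fun i _ => ?_
  rw [multiSum, mul_sum]
  have key : ∀ l ∈ Nat.antidiagonalTuple M n, w (z i) * (∏ k ∈ univ.erase i, (1 - z i / z k))⁻¹ *
      (vandCoeff q (update z i (q * z i)) l *
        ∏ a, ∏ m ∈ range (l a), w (update z i (q * z i) a * q ^ m)) =
      shiftRatio q z (update l i (l i + 1)) i * (vandCoeff q z (update l i (l i + 1)) *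
        ∏ a, ∏ m ∈ range (update l i (l i + 1) a), w (z a * q ^ m)) := by
    intro l hl
    have hln : ∀ k, l k ≤ n := fun k => by
      rw [Nat.mem_antidiagonalTuple] at hl
      rw [← hl]; exact single_le_sum (fun _ _ => Nat.zero_le _) (mem_univ k)
    rw [← mul_assoc (shiftRatio _ _ _ _), vandCoeff_shift hq0 hq hz i l hln hd]
    have : ∏ a, ∏ m ∈ range (update l i (l i + 1) a), w (z a * q ^ m)
        = w (z i) * ∏ a, ∏ m ∈ range (l a), w (update z i (q * z i) a * q ^ m) := by
      rw [← mul_prod_erase univ _ (mem_univ i), ← mul_prod_erase univ (fun a =>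
        ∏ m ∈ range (l a), w (update z i (q * z i) a * q ^ m)) (mem_univ i), ← mul_assoc]
      congr 1
      · simp only [update_self]
        rw [prod_range_succ', mul_comm, pow_zero, mul_one]
        congr 1
        exact prod_congr rfl fun m _ => by rw [pow_succ]; ring_nf
      · refine prod_congr rfl fun a ha => ?_
        rw [update_of_ne (ne_of_mem_erase ha), update_of_ne (ne_of_mem_erase ha)]
    rw [this]
    ring
  have hback : ∀ l : Fin M → ℕ, l i ≠ 0 →
      update (update l i (l i - 1)) i (update l i (l i - 1) i + 1) = l := fun l hli => by
    simp [Nat.sub_add_cancel (Nat.pos_of_ne_zero hli)]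
  have hmem : ∀ l ∈ Nat.antidiagonalTuple M (n + 1), l i ≠ 0 →
      update l i (l i - 1) ∈ Nat.antidiagonalTuple M n := fun l hl hli => by
    rw [Nat.mem_antidiagonalTuple] at hl ⊢
    rw [← add_sum_erase univ l (mem_univ i)] at hl
    rw [sum_update_of_mem (mem_univ i), sdiff_singleton_eq_erase]
    omega
  symm
  -- Indices with l_i = 0 have no preimage, but their terms vanish through the factor 1 - q^{l_i}.
  refine sum_bij_ne_zero (fun l _ _ => update l i (l i + 1)) ?_ ?_ ?_ ?_
  · intro l hl _
    rw [Nat.mem_antidiagonalTuple] at hl ⊢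
    rw [← hl, sum_update_of_mem (mem_univ i), ← add_sum_erase univ l (mem_univ i),
      sdiff_singleton_eq_erase]
    ring
  · intro l _ _ l' _ _ h
    funext k
    have := congrFun h k
    by_cases hk : k = i
    · subst hk; simpa using this
    · simpa [hk] using this
  · intro l hl h0
    have hli : l i ≠ 0 := fun h => h0 (by simp [shiftRatio, h])
    refine ⟨update l i (l i - 1), hmem l hl hli, ?_, hback l hli⟩
    · rw [key _ (hmem l hl hli), hback l hli]
      exact h0
  · exact fun l hl _ => key l hl

/-- The same interpolation with q^{-k} as one more node. The nodes 0 and q^{-k} and the top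
coefficient give the three terms on the right. -/
theorem sum_partialFraction {q : ℂ} (hq0 : q ≠ 0) {z : Fin M → ℂ} (hz : ∀ i, z i ≠ 0)
    (hne : ∀ i j, i ≠ j → z i ≠ z j) {P : ℂ[X]} (hP : P.natDegree ≤ M + 1) (k : ℕ)
    (hk : ∀ i, z i * q ^ k ≠ 1) :
    ∑ i, P.eval (z i) / (1 - z i * q ^ k) * (∏ j ∈ univ.erase i, (1 - z i / z j))⁻¹
      = P.coeff 0 + (-1) ^ M * (∏ i, z i) * P.coeff (M + 1) / q ^ k
        - (-1) ^ M * (∏ i, z i) * (q ^ k) ^ M * P.eval (q ^ k)⁻¹ / ∏ i, (1 - z i * q ^ k) := by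
  have hqk : q ^ k ≠ 0 := pow_ne_zero _ hq0
  have h := sum_eval_div (z := (Fin.cons (q ^ k)⁻¹ z : Fin (M + 1) → ℂ)) (P := P) ?_ ?_ hP
  · rw [Fin.sum_univ_succ, prod_erase_eq_prod_ite, Fin.prod_univ_succ, Fin.prod_univ_succ] at h
    have hN : ∏ j, (-z j) = (-1) ^ M * ∏ j, z j := by
      rw [prod_neg]; simp
    have hN0 : ∏ j, (-z j) ≠ 0 := prod_ne_zero_iff.2 fun j _ => neg_ne_zero.2 (hz j)
    have h1 : ∀ i : Fin M, P.eval ((Fin.cons (q ^ k)⁻¹ z : Fin (M + 1) → ℂ) i.succ) /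
        ((Fin.cons (q ^ k)⁻¹ z : Fin (M + 1) → ℂ) i.succ * ∏ j ∈ univ.erase i.succ,
          ((Fin.cons (q ^ k)⁻¹ z : Fin (M + 1) → ℂ) i.succ -
            (Fin.cons (q ^ k)⁻¹ z : Fin (M + 1) → ℂ) j))
        = P.eval (z i) / (1 - z i * q ^ k) * (∏ j ∈ univ.erase i, (1 - z i / z j))⁻¹ *
          (q ^ k / ∏ j, (-z j)) := by
      intro i
      rw [prod_erase_eq_prod_ite, Fin.prod_univ_succ]
      simp only [Fin.cons_succ, Fin.cons_zero, (Fin.succ_ne_zero i).symm, if_false, Fin.succ_inj]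
      rw [← prod_erase_eq_prod_ite i (fun j => z i - z j)]
      have e : ∏ j ∈ univ.erase i, (z i - z j)
          = (∏ j ∈ univ.erase i, (-z j)) * ∏ j ∈ univ.erase i, (1 - z i / z j) := by
        rw [← prod_mul_distrib]
        refine prod_congr rfl fun j _ => ?_
        have := hz j
        field_simp
        ring
      have e' : ∏ j, (-z j) = (-z i) * ∏ j ∈ univ.erase i, (-z j) :=
        (mul_prod_erase univ (fun j => -z j) (mem_univ i)).symm
      have e2 : ∏ j ∈ univ.erase i, (-z j) ≠ 0 := fun h => hN0 (by rw [e', h, mul_zero])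
      have e3 : ∏ k ∈ univ.erase i, (1 - z i / z k) ≠ 0 := prod_ne_zero_iff.2 fun k hk =>
        sub_ne_zero.2 fun h => hne i k (ne_of_mem_erase hk).symm (by
          have := hz k; field_simp at h; exact h.symm)
      have e4 : 1 - z i * q ^ k ≠ 0 := sub_ne_zero.2 (hk i).symm
      have e5 : z i - (q ^ k)⁻¹ = -(1 - z i * q ^ k) / q ^ k := by field_simp; ring
      rw [e, e', e5]
      have := hz i
      field_simp
    rw [sum_congr rfl fun i _ => h1 i] at h
    simp only [Fin.cons_zero, Fin.cons_succ, Fin.succ_ne_zero, if_false, if_true, one_mul] at h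
    rw [← sum_mul] at h
    have h2 : ∏ j, ((q ^ k)⁻¹ - z j) = (∏ i, (1 - z i * q ^ k)) / (q ^ k) ^ M := by
      rw [show (q ^ k) ^ M = ∏ _i : Fin M, q ^ k by simp, ← prod_div_distrib]
      refine prod_congr rfl fun j _ => ?_
      field_simp
    have h3 : ∏ i, (1 - z i * q ^ k) ≠ 0 :=
      prod_ne_zero_iff.2 fun i _ => sub_ne_zero.2 (hk i).symm
    rw [h2, ← coeff_zero_eq_eval_zero] at h
    rw [← hN, ← h]
    generalize ∑ i, P.eval (z i) / (1 - z i * q ^ k) * (∏ j ∈ univ.erase i, (1 - z i / z j))⁻¹ = S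
    field_simp
    ring
  · intro i
    refine Fin.cases ?_ (fun a => ?_) i
    · simpa using fun h => absurd h hq0
    · simpa using hz a
  · have hkz : ∀ a, (q ^ k)⁻¹ ≠ z a := fun a h => hk a (by rw [← h, inv_mul_cancel₀ hqk])
    intro a b hab
    revert hab
    refine Fin.cases ?_ (fun a => ?_) a <;> refine Fin.cases ?_ (fun b => ?_) b
    · simp
    · intro _; simpa using hkz b
    · intro _; simpa using (hkz a).symm
    · intro h
      simpa using hne a b (fun e => h (by rw [e]))

/-- The one-variable weight on the right of the duality transformation `multiSum_eq`. -/
def dualWeight (q : ℂ) (P : ℂ[X]) (M : ℕ) (Z : ℂ) (k r : ℕ) : ℂ :=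
  (∏ m ∈ range r, (P.coeff 0 - (-1) ^ (M + 1) * P.coeff (M + 1) * Z * q ^ m)) / qPoch q q r *
    (Z ^ k * (∏ j ∈ range k, ((-1) ^ (M + 1) * (q ^ j) ^ (M + 1) * P.eval (q ^ j)⁻¹)) / qPoch q q k)

/-- A q-Pascal rule: 1 - q^{k+r} splits into a part that lowers r and a part that lowers k. With Y k
= ∏ (z_i)_k⁻¹ the bracket on the right is the outcome of `sum_partialFraction` times Y k, so both
sides of the duality obey one recursion. -/
theorem dualWeight_rec {q : ℂ} (hq0 : q ≠ 0) (hq : ∀ m : ℕ, q ^ (m + 1) ≠ 1) (P : ℂ[X]) (M : ℕ)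
    (Z : ℂ) (n : ℕ) (Y : ℕ → ℂ) :
    (1 - q ^ (n + 1)) * ∑ p ∈ HasAntidiagonal.antidiagonal (n + 1), dualWeight q P M Z p.1 p.2 * Y p.1
      = ∑ p ∈ HasAntidiagonal.antidiagonal n, dualWeight q P M (q * Z) p.1 p.2 *
        ((P.coeff 0 + (-1) ^ M * Z * P.coeff (M + 1) / q ^ p.1) * Y p.1
          - (-1) ^ M * Z * (q ^ p.1) ^ M * P.eval (q ^ p.1)⁻¹ * Y (p.1 + 1)) := by
  set p0 := P.coeff 0
  set pt := (-1) ^ (M + 1) * P.coeff (M + 1) with hpt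
  set E : ℂ → ℕ → ℂ := fun Z r => ∏ m ∈ range r, (p0 - pt * Z * q ^ m) with hE
  set Q : ℕ → ℂ := fun j => (-1) ^ (M + 1) * (q ^ j) ^ (M + 1) * P.eval (q ^ j)⁻¹ with hQ
  set R : ℕ → ℂ := fun k => Z ^ k * (∏ j ∈ range k, Q j) with hR
  have hqq : ∀ m, qPoch q q m ≠ 0 := fun m => qPoch_ne_zero fun j _ => by
    rw [← pow_succ']; exact hq j
  have hq1 : ∀ m : ℕ, 1 - q ^ (m + 1) ≠ 0 := fun m => sub_ne_zero.2 (hq m).symm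
  have hqs : ∀ m, qPoch q q (m + 1) = qPoch q q m * (1 - q ^ (m + 1)) := fun m => by
    rw [qPoch_succ, pow_succ']
  have hqk : ∀ k, q ^ k ≠ 0 := fun k => pow_ne_zero _ hq0
  have hE1 : ∀ r, E Z (r + 1) = (p0 - pt * Z) * E (q * Z) r := fun r => by
    simp only [hE]
    rw [prod_range_succ', mul_comm, pow_zero, mul_one]
    congr 1
    exact prod_congr rfl fun m _ => by rw [pow_succ]; ring
  have hE2 : ∀ r, E (q * Z) (r + 1) = E (q * Z) r * (p0 - pt * Z * q ^ (r + 1)) := fun r => by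
    simp only [hE]
    rw [prod_range_succ, pow_succ]
    ring_nf
  -- The truncated `p.2 - 1` is harmless at `p.2 = 0`, where the factor 1 - q^{p.2} vanishes.
  set α : ℕ × ℕ → ℂ := fun p => R p.1 / qPoch q q p.1 * (q ^ p.1 * p0 - pt * Z) *
    E (q * Z) (p.2 - 1) * (1 - q ^ p.2) / qPoch q q p.2 * Y p.1 with hα
  set β : ℕ × ℕ → ℂ := fun p => R p.1 * (1 - q ^ p.1) / qPoch q q p.1 *
    E (q * Z) p.2 / qPoch q q p.2 * Y p.1 with hβ
  have hsplit : ∀ p ∈ HasAntidiagonal.antidiagonal (n + 1),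
      (1 - q ^ (n + 1)) * (dualWeight q P M Z p.1 p.2 * Y p.1) = α p + β p := by
    rintro ⟨k, r⟩ hp
    rw [HasAntidiagonal.mem_antidiagonal] at hp
    simp only at hp
    have key : (1 - q ^ (k + r)) * E Z r
        = (q ^ k * p0 - pt * Z) * (1 - q ^ r) * E (q * Z) (r - 1) + (1 - q ^ k) * E (q * Z) r := by
      rcases r with _ | r
      · simp [hE]
      · rw [Nat.add_sub_cancel, hE1, hE2, pow_add]
        ring
    have hd : dualWeight q P M Z k r = E Z r / qPoch q q r * (R k / qPoch q q k) := rfl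
    rw [← hp, hd]
    simp only [hα, hβ]
    generalize E (q * Z) (r - 1) = e1 at *
    generalize E (q * Z) r = e2 at *
    have := hqq k; have := hqq r
    field_simp
    linear_combination R k * Y k * key
  rw [mul_sum, sum_congr rfl hsplit, sum_add_distrib, Nat.sum_antidiagonal_succ' (f := α),
    Nat.sum_antidiagonal_succ (f := β)]
  have hα0 : α (n + 1, 0) = 0 := by simp [hα]
  have hβ0 : β (0, n + 1) = 0 := by simp [hβ]
  rw [hα0, hβ0, zero_add, zero_add, ← sum_add_distrib]
  refine sum_congr rfl ?_
  rintro ⟨k, r⟩ _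
  have hd : dualWeight q P M (q * Z) k r = E (q * Z) r / qPoch q q r * (q ^ k * R k / qPoch q q k) := by
    simp only [dualWeight, hR, mul_pow, hE, hpt, hQ, p0]
    ring
  have hRs : R (k + 1) = R k * Z * Q k := by
    simp only [hR]
    rw [prod_range_succ, pow_succ]
    ring
  have hpm : (-1 : ℂ) ^ M * P.coeff (M + 1) = -pt := by rw [hpt, pow_succ]; ring
  have hQk : q ^ k * ((-1 : ℂ) ^ M * (q ^ k) ^ M * P.eval (q ^ k)⁻¹) = - Q k := by
    simp only [hQ]; rw [pow_succ, pow_succ]; ring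
  rw [hd]
  simp only [hα, hβ, hqs, hRs, Nat.add_sub_cancel]
  have := hqq k; have := hqq r; have := hq1 k; have := hq1 r; have := hqk k
  rw [show (-1 : ℂ) ^ M * Z * P.coeff (M + 1) = -pt * Z by rw [← hpm]; ring]
  have hQk' : (-1 : ℂ) ^ M * Z * (q ^ k) ^ M * P.eval (q ^ k)⁻¹ = - Z * Q k / q ^ k := by
    rw [eq_div_iff (hqk k)]
    linear_combination Z * hQk
  rw [hQk']
  field_simp
  ring

/-- Duality between an `A_n` sum of homogeneous degree `n` and a one-variable sum. -/
theorem multiSum_eq {q : ℂ} (hq0 : q ≠ 0) (hq : ∀ m : ℕ, q ^ (m + 1) ≠ 1) {P : ℂ[X]}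
    (hP : P.natDegree ≤ M + 1) (n : ℕ) (z : Fin M → ℂ) (hz : ∀ i, z i ≠ 0)
    (h1 : ∀ i, ∀ m < n, z i * q ^ m ≠ 1)
    (hd : ∀ i j, i ≠ j → ∀ m ≤ n, z i * q ^ m ≠ z j) :
    multiSum q z (fun u => P.eval u / (1 - u)) n
      = ∑ p ∈ HasAntidiagonal.antidiagonal n, dualWeight q P M (∏ i, z i) p.1 p.2 *
          (∏ i, qPoch q (z i) p.1)⁻¹ := by
  have hne : ∀ a b, a ≠ b → z a ≠ z b := fun a b hab => by simpa using hd a b hab 0 (by omega)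
  induction n generalizing z with
  | zero => simp [multiSum_zero q hne, dualWeight, qPoch_zero]
  | succ n ih =>
    refine mul_left_cancel₀ (sub_ne_zero.2 (hq n).symm) ?_
    rw [multiSum_succ hq0 hq hz _ hd, dualWeight_rec hq0 hq P M _ n
      (fun k => (∏ i, qPoch q (z i) k)⁻¹)]
    -- Shifting z_i multiplies ∏ z by q and ∏ (z_a)_k by (1 - z_i q^k)/(1 - z_i). The factor 1 - z_i
    -- cancels the pole of the weight, and the new pole at q^{-k} is the extra node of
    -- `sum_partialFraction`.
    have hshift : ∀ i, multiSum q (update z i (q * z i)) (fun u => P.eval u / (1 - u)) n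
        = ∑ p ∈ HasAntidiagonal.antidiagonal n, dualWeight q P M (q * ∏ i, z i) p.1 p.2 *
          ((1 - z i) / (1 - z i * q ^ p.1) * (∏ i, qPoch q (z i) p.1)⁻¹) := by
      intro i
      rw [ih (update z i (q * z i))]
      · refine sum_congr rfl ?_
        rintro ⟨k, r⟩ hp
        rw [HasAntidiagonal.mem_antidiagonal] at hp
        simp only at hp
        have e1 : ∏ a, update z i (q * z i) a = q * ∏ a, z a := by
          rw [prod_update_of_mem (mem_univ i), sdiff_singleton_eq_erase,
            ← mul_prod_erase univ z (mem_univ i), mul_assoc]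
        have e2 : (1 - z i) * ∏ a, qPoch q (update z i (q * z i) a) k
            = (1 - z i * q ^ k) * ∏ a, qPoch q (z a) k := by
          rw [← mul_prod_erase univ _ (mem_univ i),
            ← mul_prod_erase univ (fun a => qPoch q (z a) k) (mem_univ i), update_self,
            prod_congr rfl (g := fun a => qPoch q (z a) k) fun a ha => by
              rw [update_of_ne (ne_of_mem_erase ha)], ← mul_assoc, ← mul_assoc,
            mul_comm q, ← qPoch_succ', qPoch_succ, mul_comm (qPoch q (z i) k)]
        have e3 : 1 - z i ≠ 0 := sub_ne_zero.2 (by simpa using (h1 i 0 (by omega)).symm)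
        have e4 : 1 - z i * q ^ k ≠ 0 := sub_ne_zero.2 (h1 i k (by omega)).symm
        have e5 : ∏ a, qPoch q (z a) k ≠ 0 :=
          prod_ne_zero_iff.2 fun a _ => qPoch_ne_zero fun m hm => h1 a m (by omega)
        have e6 : ∏ a, qPoch q (update z i (q * z i) a) k ≠ 0 := fun h => by
          rw [h, mul_zero] at e2; exact mul_ne_zero e4 e5 e2.symm
        simp only
        rw [e1]
        congr 1
        field_simp
        linear_combination -e2
      · intro a
        by_cases ha : a = i
        · subst ha; simpa using ⟨hq0, hz a⟩
        · simpa [ha] using hz a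
      · intro a m hm
        by_cases ha : a = i
        · subst ha
          have := h1 a (m + 1) (by omega)
          rw [update_self]; intro h; apply this; rw [← h, pow_succ]; ring
        · simpa [ha] using h1 a m (by omega)
      · intro a b hab m hm
        by_cases ha : a = i
        · subst ha
          rw [update_self, update_of_ne hab.symm]
          intro h; apply hd a b hab (m + 1) (by omega); rw [← h, pow_succ]; ring
        · by_cases hb : b = i
          · subst hb
            rw [update_self, update_of_ne hab]
            -- For m = 0 the condition z_a ≠ q z_b is the separation hypothesis for the reversed
            -- pair; otherwise one factor q cancels.
            rcases m with _ | m
            · intro h; apply hd b a hab.symm 1 (by omega); rw [pow_zero, mul_one] at h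
              rw [h]; ring
            · intro h; apply hd a b hab m (by omega)
              refine mul_left_cancel₀ hq0 ?_
              rw [← h, pow_succ]; ring
          · simpa [ha, hb] using hd a b hab m (by omega)
      · intro a b hab
        by_cases ha : a = i
        · subst ha
          rw [update_self, update_of_ne hab.symm]
          intro h; apply hd a b hab 1 (by omega); rw [← h]; ring
        · by_cases hb : b = i
          · subst hb
            rw [update_self, update_of_ne hab]
            intro h; apply hd b a hab.symm 1 (by omega); rw [h]; ring
          · simpa [ha, hb] using hne a b hab
    simp only [hshift, mul_sum]
    rw [sum_comm]
    refine sum_congr rfl ?_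
    rintro ⟨k, r⟩ hp
    rw [HasAntidiagonal.mem_antidiagonal] at hp
    simp only at hp
    have hpf := sum_partialFraction hq0 hz hne hP k (fun i => h1 i k (by omega))
    simp only
    have e7 : ∏ i, qPoch q (z i) (k + 1) = (∏ i, qPoch q (z i) k) * ∏ i, (1 - z i * q ^ k) := by
      rw [← prod_mul_distrib]
      exact prod_congr rfl fun i _ => qPoch_succ _ _ _
    have e8 : ∀ i, P.eval (z i) / (1 - z i) * (∏ j ∈ univ.erase i, (1 - z i / z j))⁻¹ *
        (dualWeight q P M (q * ∏ i, z i) k r *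
          ((1 - z i) / (1 - z i * q ^ k) * (∏ i, qPoch q (z i) k)⁻¹))
        = P.eval (z i) / (1 - z i * q ^ k) * (∏ j ∈ univ.erase i, (1 - z i / z j))⁻¹ *
          (dualWeight q P M (q * ∏ i, z i) k r * (∏ i, qPoch q (z i) k)⁻¹) := by
      intro i
      have e3 : 1 - z i ≠ 0 := sub_ne_zero.2 (by simpa using (h1 i 0 (by omega)).symm)
      field_simp
    rw [sum_congr rfl fun i _ => e8 i, ← sum_mul, hpf, e7, mul_inv]
    ring

/-! ### Limits of q-shifted factorials and uniform bounds -/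

theorem pow_succ_ne_one_of_norm_lt_one {q : ℂ} (hq1 : ‖q‖ < 1) (m : ℕ) : q ^ (m + 1) ≠ 1 := by
  intro h
  have := congrArg norm h
  rw [norm_pow, norm_one] at this
  exact absurd this (pow_lt_one₀ (norm_nonneg _) hq1 (by omega)).ne

theorem qPoch_self_ne_zero {q : ℂ} (hq1 : ‖q‖ < 1) (n : ℕ) : qPoch q q n ≠ 0 :=
  qPoch_ne_zero fun m _ => by rw [← pow_succ']; exact pow_succ_ne_one_of_norm_lt_one hq1 m

theorem tendsto_qPoch {q : ℂ} (hq1 : ‖q‖ < 1) (a : ℂ) :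
    Tendsto (qPoch q a) atTop (𝓝 (qInf q a)) :=
  (multipliable_qInf hq1 a).hasProd.tendsto_prod_nat

theorem qInf_ne_zero {q : ℂ} (hq1 : ‖q‖ < 1) {a : ℂ} (h : ∀ n : ℕ, a * q ^ n ≠ 1) :
    qInf q a ≠ 0 := by
  have := tprod_one_add_ne_zero_of_summable (f := fun n : ℕ => -(a * q ^ n))
    (fun n => by rw [← sub_eq_add_neg]; exact sub_ne_zero.2 (h n).symm) (by
      simp only [norm_neg, norm_mul, norm_pow]
      exact (summable_geometric_of_lt_one (norm_nonneg q) hq1).mul_left ‖a‖)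
  simpa [qInf, sub_eq_add_neg] using this

theorem qInf_eq_mul {q : ℂ} (hq1 : ‖q‖ < 1) (a : ℂ) (n : ℕ) :
    qInf q a = qPoch q a n * qInf q (a * q ^ n) := by
  refine tendsto_nhds_unique ((tendsto_qPoch hq1 a).comp (tendsto_add_atTop_nat n)) ?_
  refine ((tendsto_qPoch hq1 (a * q ^ n)).const_mul (qPoch q a n)).congr fun m => ?_
  rw [Function.comp, add_comm m n, qPoch_add]

/-- Use 1 + t ≤ e^t and a geometric series. The bound is uniform in n and in the disc ‖a‖ ≤ R, as
the majorants used for analyticity in A require. -/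
theorem norm_qPoch_le {q : ℂ} (hq1 : ‖q‖ < 1) {a : ℂ} {R : ℝ} (h : ‖a‖ ≤ R) (n : ℕ) :
    ‖qPoch q a n‖ ≤ Real.exp (R / (1 - ‖q‖)) := by
  have hR : 0 ≤ R := (norm_nonneg a).trans h
  rw [qPoch, norm_prod]
  calc ∏ k ∈ range n, ‖1 - a * q ^ k‖ ≤ ∏ k ∈ range n, Real.exp (R * ‖q‖ ^ k) := by
        refine prod_le_prod (fun _ _ => norm_nonneg _) fun k _ => ?_
        calc ‖1 - a * q ^ k‖ ≤ ‖(1 : ℂ)‖ + ‖a * q ^ k‖ := norm_sub_le _ _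
          _ ≤ 1 + R * ‖q‖ ^ k := by
            rw [norm_one, norm_mul, norm_pow]; gcongr
          _ ≤ _ := by rw [add_comm]; exact Real.add_one_le_exp _
    _ = Real.exp (R * ∑ k ∈ range n, ‖q‖ ^ k) := by rw [← Real.exp_sum, mul_sum]
    _ ≤ _ := by
        rw [div_eq_mul_inv, ← tsum_geometric_of_lt_one (norm_nonneg q) hq1]
        gcongr
        exact (summable_geometric_of_lt_one (norm_nonneg q) hq1).sum_le_tsum _
          fun _ _ => by positivity

theorem norm_qInf_le {q : ℂ} (hq1 : ‖q‖ < 1) {a : ℂ} {R : ℝ} (h : ‖a‖ ≤ R) :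
    ‖qInf q a‖ ≤ Real.exp (R / (1 - ‖q‖)) :=
  le_of_tendsto (tendsto_qPoch hq1 a).norm (Eventually.of_forall (norm_qPoch_le hq1 h))

/-- The reciprocals converge, since the limit (a)_∞ is nonzero, and a convergent sequence is
bounded. -/
theorem exists_norm_inv_qPoch_le {q : ℂ} (hq1 : ‖q‖ < 1) {a : ℂ} (h : ∀ n : ℕ, a * q ^ n ≠ 1) :
    ∃ K : ℝ, ∀ n, ‖(qPoch q a n)⁻¹‖ ≤ K := by
  obtain ⟨K, hK⟩ := (Metric.isBounded_range_of_tendsto _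
    ((tendsto_qPoch hq1 a).inv₀ (qInf_ne_zero hq1 h))).exists_norm_le
  exact ⟨K, fun n => hK _ ⟨n, rfl⟩⟩

theorem self_mul_pow_ne_one {q : ℂ} (hq1 : ‖q‖ < 1) (n : ℕ) : q * q ^ n ≠ 1 := by
  rw [← pow_succ']; exact pow_succ_ne_one_of_norm_lt_one hq1 n

/-! ### Homogeneous factorials and the q-binomial theorem -/

/-- The homogeneous `q`-shifted factorial `∏_{j < k} (a - b q^j) = a^k (b / a)_k`. -/
def homPoch (q a b : ℂ) (k : ℕ) : ℂ := ∏ j ∈ range k, (a - b * q ^ j)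

theorem homPoch_zero (q a b : ℂ) : homPoch q a b 0 = 1 := prod_range_zero _

theorem homPoch_succ (q a b : ℂ) (k : ℕ) :
    homPoch q a b (k + 1) = homPoch q a b k * (a - b * q ^ k) := prod_range_succ _ _

theorem homPoch_add (q a b : ℂ) (k m : ℕ) :
    homPoch q a b (k + m) = homPoch q a b k * homPoch q a (b * q ^ k) m := by
  rw [homPoch, prod_range_add]
  congr 1
  exact prod_congr rfl fun j _ => by rw [pow_add]; ring

theorem homPoch_mul (q c a b : ℂ) (k : ℕ) :
    homPoch q (c * a) (c * b) k = c ^ k * homPoch q a b k := by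
  rw [homPoch, homPoch, ← card_range k, ← prod_const, card_range, ← prod_mul_distrib]
  exact prod_congr rfl fun j _ => by ring

theorem homPoch_mul_right (q x b : ℂ) (k : ℕ) : homPoch q x (b * x) k = qPoch q b k * x ^ k := by
  rw [show homPoch q x (b * x) k = homPoch q (x * 1) (x * b) k by ring_nf, homPoch_mul, mul_comm]
  rfl

theorem homPoch_eq_pow_mul {a : ℂ} (ha : a ≠ 0) (q b : ℂ) (k : ℕ) :
    homPoch q a b k = a ^ k * qPoch q (b / a) k := by
  rw [show homPoch q a b k = homPoch q a (b / a * a) k by rw [div_mul_cancel₀ b ha],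
    homPoch_mul_right, mul_comm]

theorem norm_homPoch_le {q : ℂ} (hq1 : ‖q‖ < 1) {a b : ℂ} {R : ℝ} (h : ‖a‖ ≤ R) (k : ℕ) :
    ‖homPoch q a b k‖ ≤ (R + ‖b‖) ^ k := by
  rw [homPoch, norm_prod, ← card_range k, ← prod_const, card_range]
  refine prod_le_prod (fun _ _ => norm_nonneg _) fun j _ => ?_
  calc ‖a - b * q ^ j‖ ≤ ‖a‖ + ‖b * q ^ j‖ := norm_sub_le _ _
    _ ≤ R + ‖b‖ := by
      rw [norm_mul, norm_pow]
      gcongr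
      exact mul_le_of_le_one_right (norm_nonneg _) (pow_le_one₀ (norm_nonneg _) hq1.le)

theorem summable_homPoch_div {q : ℂ} (hq1 : ‖q‖ < 1) {a : ℂ} (ha : ‖a‖ < 1) (b : ℂ) :
    Summable fun k => ‖homPoch q a b k / qPoch q q k‖ := by
  obtain ⟨r, hr, hr1⟩ := exists_between ha
  have hq : Tendsto (fun k : ℕ => q ^ k) atTop (𝓝 0) := tendsto_pow_atTop_nhds_zero_of_norm_lt_one hq1
  have hlim : Tendsto (fun k : ℕ => ‖(a - b * q ^ k) / (1 - q * q ^ k)‖) atTop (𝓝 ‖a‖) := by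
    have := (((hq.const_mul b).const_sub a).div ((hq.const_mul q).const_sub 1) (by simp)).norm
    simpa using this
  refine summable_of_ratio_norm_eventually_le hr1 ?_
  filter_upwards [hlim.eventually (gt_mem_nhds hr)] with k hk
  rw [norm_norm, norm_norm, homPoch_succ, qPoch_succ, mul_div_mul_comm, norm_mul, mul_comm]
  gcongr

/-- The `q`-binomial theorem in homogeneous form. -/
theorem tsum_homPoch_div {q : ℂ} (hq1 : ‖q‖ < 1) {a : ℂ} (ha : ‖a‖ < 1) (b : ℂ) :
    ∑' k, homPoch q a b k / qPoch q q k = qInf q b / qInf q a := by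
  have hs := summable_homPoch_div hq1 ha b
  set c : ℕ → ℂ := fun k => homPoch q a b k / qPoch q q k with hc
  -- An auxiliary variable t gives the q-difference equation (1 - at) f(t) = (1 - bt) f(qt).
  -- Iterating from t = 1 and using f(q^n) → f(0) = 1 evaluates f(1).
  set f : ℂ → ℂ := fun t => ∑' k, c k * t ^ k with hf
  have hst : ∀ t : ℂ, ‖t‖ ≤ 1 → Summable fun k => c k * t ^ k := fun t ht =>
    hs.of_norm_bounded fun k => by
      rw [norm_mul, norm_pow]
      exact mul_le_of_le_one_right (norm_nonneg _) (pow_le_one₀ (norm_nonneg _) ht)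
  have hrec : ∀ k, c (k + 1) * (1 - q ^ (k + 1)) = c k * (a - b * q ^ k) := fun k => by
    have h1 := qPoch_self_ne_zero hq1 k
    have h2 : 1 - q ^ (k + 1) ≠ 0 := sub_ne_zero.2 (pow_succ_ne_one_of_norm_lt_one hq1 k).symm
    simp only [hc]
    rw [homPoch_succ, qPoch_succ, ← pow_succ']
    field_simp
  have hfun : ∀ t : ℂ, ‖t‖ ≤ 1 → (1 - a * t) * f t = (1 - b * t) * f (t * q) := fun t ht => by
    have htq : ‖t * q‖ ≤ 1 := by
      rw [norm_mul]; exact mul_le_one₀ ht (norm_nonneg _) hq1.le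
    have e1 : f t - f (t * q) = ∑' k, c k * (1 - q ^ k) * t ^ k := by
      rw [hf, ← (hst t ht).tsum_sub (hst _ htq)]
      exact tsum_congr fun k => by rw [mul_pow]; ring
    have e2 : ∑' k, c k * (1 - q ^ k) * t ^ k = ∑' k, t * (a * (c k * t ^ k) - b * (c k * (t * q) ^ k)) := by
      rw [Summable.tsum_eq_zero_add]
      · simp only [pow_zero, sub_self, mul_zero, zero_mul, zero_add]
        refine tsum_congr fun k => ?_
        rw [hrec, mul_pow, pow_succ]; ring
      · refine ((hst t ht).sub (hst _ htq)).congr fun k => ?_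
        rw [mul_pow]; ring
    rw [tsum_mul_left, ((hst t ht).mul_left a).tsum_sub ((hst _ htq).mul_left b), tsum_mul_left,
      tsum_mul_left] at e2
    linear_combination e1 + e2
  have hiter : ∀ n, qPoch q a n * f 1 = qPoch q b n * f (q ^ n) := by
    intro n
    induction n with
    | zero => simp [qPoch_zero]
    | succ n ih =>
      have := hfun (q ^ n) (by rw [norm_pow]; exact pow_le_one₀ (norm_nonneg _) hq1.le)
      rw [← pow_succ] at this
      rw [qPoch_succ, qPoch_succ]
      linear_combination (1 - a * q ^ n) * ih + qPoch q b n * this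
  have hlim : Tendsto (fun n : ℕ => f (q ^ n)) atTop (𝓝 1) := by
    have h0 : ∑' k, c k * (0 : ℂ) ^ k = 1 := by
      rw [tsum_eq_single 0]
      · simp [hc, homPoch_zero, qPoch_zero]
      · intro k hk; simp [hk]
    rw [← h0]
    refine tendsto_tsum_of_dominated_convergence hs ?_ (Eventually.of_forall fun n k => ?_)
    · intro k
      exact ((tendsto_pow_atTop_nhds_zero_of_norm_lt_one hq1).pow k).const_mul _
    · rw [norm_mul, norm_pow, norm_pow]
      exact mul_le_of_le_one_right (norm_nonneg _)
        (pow_le_one₀ (by positivity) (pow_le_one₀ (norm_nonneg _) hq1.le))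
  have h1 := tendsto_nhds_unique (((tendsto_qPoch hq1 a).mul_const (f 1)).congr hiter)
    ((tendsto_qPoch hq1 b).mul hlim)
  have ha0 : qInf q a ≠ 0 := qInf_ne_zero hq1 fun n h => by
    have := congrArg norm h
    rw [norm_mul, norm_pow, norm_one] at this
    have h2 : ‖q‖ ^ n ≤ 1 := pow_le_one₀ (norm_nonneg _) hq1.le
    nlinarith [norm_nonneg a, pow_nonneg (norm_nonneg q) n]
  rw [eq_div_iff ha0]
  have : f 1 = ∑' k, c k := by simp [hf]
  rw [← this]
  linear_combination h1

/-! ### Summation of the ₁φ₁ series -/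

theorem summable_pow_mul_pow_choose {r : ℝ} (hr0 : 0 ≤ r) (hr : r < 1) (ρ : ℝ) :
    Summable fun m : ℕ => ρ ^ m * r ^ m.choose 2 := by
  have hlim : Tendsto (fun m : ℕ => |ρ| * r ^ m) atTop (𝓝 0) := by
    simpa using (tendsto_pow_atTop_nhds_zero_of_lt_one hr0 hr).const_mul |ρ|
  refine summable_of_ratio_norm_eventually_le (r := 1 / 2) (by norm_num) ?_
  filter_upwards [hlim.eventually (gt_mem_nhds (by norm_num : (0 : ℝ) < 1 / 2))] with m hm
  have : (m + 1).choose 2 = m.choose 2 + m := by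
    rw [Nat.choose_succ_succ' m 1, Nat.choose_one_right, add_comm]
  rw [this, pow_succ, pow_add]
  have e : ‖ρ ^ m * ρ * (r ^ m.choose 2 * r ^ m)‖ = |ρ| * r ^ m * ‖ρ ^ m * r ^ m.choose 2‖ := by
    rw [norm_mul, norm_mul, norm_mul, norm_mul, Real.norm_eq_abs ρ,
      Real.norm_of_nonneg (pow_nonneg hr0 m)]
    ring
  rw [e]
  exact mul_le_mul_of_nonneg_right hm.le (norm_nonneg _)

/-- The summand of the `₁φ₁` series in homogeneous form. -/
def oneOneTerm (q a d : ℂ) (m : ℕ) : ℂ :=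
  (-1) ^ m * q ^ m.choose 2 * homPoch q a d m / (qPoch q q m * qPoch q d m)

/-- The majorant must serve all shifts d q^N at once: it is used for the limit N → ∞ in
`tsum_oneOneTerm` and for the double series in the third formula. -/
theorem exists_summable_oneOneTerm {q : ℂ} (hq1 : ‖q‖ < 1) {d : ℂ} (hd : ∀ n : ℕ, d * q ^ n ≠ 1)
    (a : ℂ) : ∃ u : ℕ → ℝ, Summable u ∧ ∀ N m a' d', ‖a'‖ ≤ ‖a‖ → ‖d'‖ ≤ ‖d‖ →
      ‖(-1) ^ m * q ^ m.choose 2 * homPoch q a' d' m /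
        (qPoch q q m * qPoch q (d * q ^ N) m)‖ ≤ u m := by
  obtain ⟨K₁, hK₁⟩ := exists_norm_inv_qPoch_le hq1 (self_mul_pow_ne_one hq1)
  obtain ⟨K₂, hK₂⟩ := exists_norm_inv_qPoch_le hq1 hd
  refine ⟨fun m => (‖a‖ + ‖d‖) ^ m * ‖q‖ ^ m.choose 2 * (K₁ * (Real.exp (‖d‖ / (1 - ‖q‖)) * K₂)),
    (summable_pow_mul_pow_choose (norm_nonneg q) hq1 _).mul_right _, fun N m a' d' ha' hd' => ?_⟩
  -- Uniformity in N: the shifted reciprocal is (d)_N/(d)_{N+m}, a product of two bounded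
  -- quantities.
  have h1 : (qPoch q (d * q ^ N) m)⁻¹ = qPoch q d N * (qPoch q d (N + m))⁻¹ := by
    have h0 : qPoch q d N ≠ 0 := qPoch_ne_zero fun j _ => hd j
    rw [qPoch_add, mul_inv, mul_inv_cancel_left₀ h0]
  have hK₁0 : 0 ≤ K₁ := (norm_nonneg _).trans (hK₁ 0)
  have h2 : ‖homPoch q a' d' m‖ ≤ (‖a‖ + ‖d‖) ^ m := (norm_homPoch_le hq1 ha' m).trans (by gcongr)
  rw [div_eq_mul_inv, mul_inv, h1, norm_mul, norm_mul, norm_mul, norm_mul, norm_mul, norm_pow,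
    norm_pow, norm_neg, norm_one, one_pow, one_mul, mul_comm (‖q‖ ^ _)]
  exact mul_le_mul (mul_le_mul_of_nonneg_right h2 (by positivity))
    (mul_le_mul (hK₁ m) (mul_le_mul (norm_qPoch_le hq1 le_rfl N) (hK₂ _) (norm_nonneg _)
      (Real.exp_nonneg _)) (by positivity) hK₁0) (by positivity) (by positivity)

theorem summable_oneOneTerm {q : ℂ} (hq1 : ‖q‖ < 1) {d : ℂ} (hd : ∀ n : ℕ, d * q ^ n ≠ 1)
    (a : ℂ) : Summable (oneOneTerm q a d) := by
  obtain ⟨u, hu, hb⟩ := exists_summable_oneOneTerm hq1 hd a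
  refine hu.of_norm_bounded fun m => ?_
  simpa [oneOneTerm] using hb 0 m a d le_rfl le_rfl

/-- The sum F satisfies (1 - d) F(a, d) = (1 - a) F(qa, qd). Iterating pushes both parameters to 0,
where F = 1. -/
theorem tsum_oneOneTerm {q : ℂ} (hq1 : ‖q‖ < 1) {d : ℂ} (hd : ∀ n : ℕ, d * q ^ n ≠ 1)
    (a : ℂ) : ∑' m, oneOneTerm q a d m = qInf q a / qInf q d := by
  have hstep : ∀ a d : ℂ, (∀ n : ℕ, d * q ^ n ≠ 1) →
      (1 - d) * ∑' m, oneOneTerm q a d m = (1 - a) * ∑' m, oneOneTerm q (q * a) (q * d) m := by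
    intro a d hd
    have hd' : ∀ n : ℕ, q * d * q ^ n ≠ 1 := fun n => by
      have := hd (n + 1); rw [pow_succ] at this; convert this using 1; ring
    have hs := summable_oneOneTerm hq1 hd a
    have hs' := summable_oneOneTerm hq1 hd' (q * a)
    have hrel : ∀ m, oneOneTerm q (q * a) (q * d) m * (1 - d * q ^ m)
        = q ^ m * oneOneTerm q a d m * (1 - d) := fun m => by
      have h1 : (1 - d) * qPoch q (q * d) m = qPoch q d m * (1 - d * q ^ m) := by
        rw [mul_comm q d, ← qPoch_succ', qPoch_succ]
      have h2 : qPoch q d m ≠ 0 := qPoch_ne_zero fun j _ => hd j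
      have h3 : qPoch q (q * d) m ≠ 0 := qPoch_ne_zero fun j _ => hd' j
      have h4 := qPoch_self_ne_zero hq1 m
      rw [oneOneTerm, oneOneTerm, homPoch_mul]
      have h5 : (qPoch q (q * d) m)⁻¹ * (1 - d * q ^ m) = (1 - d) * (qPoch q d m)⁻¹ := by
        field_simp
        linear_combination -h1
      rw [div_eq_mul_inv, div_eq_mul_inv, mul_inv, mul_inv]
      linear_combination (-1) ^ m * q ^ m.choose 2 * (q ^ m * homPoch q a d m) * (qPoch q q m)⁻¹ * h5
    have hsucc : ∀ m, oneOneTerm q a d (m + 1) * (1 - q ^ (m + 1)) * (1 - d * q ^ m)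
        = -q ^ m * oneOneTerm q a d m * (a - d * q ^ m) := fun m => by
      have h1 := qPoch_self_ne_zero hq1 m
      have h2 : qPoch q d m ≠ 0 := qPoch_ne_zero fun j _ => hd j
      have h3 : 1 - q ^ (m + 1) ≠ 0 := sub_ne_zero.2 (pow_succ_ne_one_of_norm_lt_one hq1 m).symm
      have h4 : 1 - d * q ^ m ≠ 0 := sub_ne_zero.2 (hd m).symm
      have : (m + 1).choose 2 = m.choose 2 + m := by
        rw [Nat.choose_succ_succ' m 1, Nat.choose_one_right, add_comm]
      rw [oneOneTerm, oneOneTerm, homPoch_succ, qPoch_succ, qPoch_succ, ← pow_succ', this, pow_add,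
        pow_succ (-1 : ℂ)]
      field_simp
      ring
    -- The contiguous relation holds termwise up to a telescoping difference, whose boundary term at
    -- m = 0 carries 1 - q^0 = 0.
    have htel : ∀ m, (1 - d) * oneOneTerm q a d m - (1 - a) * oneOneTerm q (q * a) (q * d) m
        = (1 - d) * (oneOneTerm q a d m * (1 - q ^ m) - oneOneTerm q a d (m + 1) * (1 - q ^ (m + 1))) := by
      intro m
      have h4 : 1 - d * q ^ m ≠ 0 := sub_ne_zero.2 (hd m).symm
      refine mul_right_cancel₀ h4 ?_
      linear_combination (a - 1) * hrel m + (1 - d) * hsucc m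
    have hsq : Summable fun m => oneOneTerm q a d m * (1 - q ^ m) := by
      refine (hs.norm.mul_right 2).of_norm_bounded fun m => ?_
      rw [norm_mul]
      gcongr
      refine (norm_sub_le _ _).trans ?_
      rw [norm_one, norm_pow]
      linarith [pow_le_one₀ (n := m) (norm_nonneg q) hq1.le]
    have h0 : ∑' m, (oneOneTerm q a d m * (1 - q ^ m) - oneOneTerm q a d (m + 1) * (1 - q ^ (m + 1))) = 0 := by
      rw [hsq.tsum_sub ((summable_nat_add_iff 1).2 hsq), hsq.tsum_eq_zero_add]
      simp
    have := congrArg (fun x => (1 - d) * x) h0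
    simp only [mul_zero] at this
    rw [← tsum_mul_left, ← tsum_congr htel, (hs.mul_left _).tsum_sub (hs'.mul_left _),
      tsum_mul_left, tsum_mul_left] at this
    exact sub_eq_zero.1 this
  have hdN : ∀ N n : ℕ, d * q ^ N * q ^ n ≠ 1 := fun N n => by
    rw [mul_assoc, ← pow_add]; exact hd _
  have hiter : ∀ N, qPoch q d N * ∑' m, oneOneTerm q a d m
      = qPoch q a N * ∑' m, oneOneTerm q (a * q ^ N) (d * q ^ N) m := by
    intro N
    induction N with
    | zero => simp [qPoch_zero]
    | succ N ih =>
      have := hstep (a * q ^ N) (d * q ^ N) (hdN N)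
      rw [show q * (a * q ^ N) = a * q ^ (N + 1) by rw [pow_succ]; ring,
        show q * (d * q ^ N) = d * q ^ (N + 1) by rw [pow_succ]; ring] at this
      rw [qPoch_succ, qPoch_succ]
      linear_combination (1 - d * q ^ N) * ih + qPoch q a N * this
  have hlim : Tendsto (fun N : ℕ => ∑' m, oneOneTerm q (a * q ^ N) (d * q ^ N) m) atTop (𝓝 1) := by
    obtain ⟨u, hu, hb⟩ := exists_summable_oneOneTerm hq1 hd a
    have h0 : ∑' m : ℕ, (if m = 0 then (1 : ℂ) else 0) = 1 := tsum_ite_eq 0 _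
    have heq : ∀ N m, oneOneTerm q (a * q ^ N) (d * q ^ N) m = (q ^ N) ^ m *
        ((-1) ^ m * q ^ m.choose 2 * homPoch q a d m /
          (qPoch q q m * qPoch q (d * q ^ N) m)) := fun N m => by
      rw [oneOneTerm, mul_comm a, show homPoch q (q ^ N * a) (d * q ^ N) m
        = (q ^ N) ^ m * homPoch q a d m by rw [mul_comm d, homPoch_mul]]
      ring
    have hle : ∀ N m, ‖oneOneTerm q (a * q ^ N) (d * q ^ N) m‖ ≤ (‖q‖ ^ N) ^ m * u m := fun N m => by
      rw [heq, norm_mul, norm_pow, norm_pow]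
      exact mul_le_mul_of_nonneg_left (hb N m a d le_rfl le_rfl) (by positivity)
    have hu0 : ∀ m, 0 ≤ u m := fun m => (norm_nonneg _).trans (hb 0 m a d le_rfl le_rfl)
    rw [← h0]
    refine tendsto_tsum_of_dominated_convergence hu (fun m => ?_)
      (Eventually.of_forall fun N m => ?_)
    · rcases m with _ | m
      · simp [oneOneTerm, homPoch_zero, qPoch_zero]
      · rw [if_neg (Nat.succ_ne_zero m)]
        refine squeeze_zero_norm (fun N => hle N (m + 1)) ?_
        have := ((tendsto_pow_atTop_nhds_zero_of_lt_one (norm_nonneg q) hq1).pow (m + 1)).mul_const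
          (u (m + 1))
        simpa using this
    · exact (hle N m).trans (mul_le_of_le_one_left (hu0 m)
        (pow_le_one₀ (by positivity) (pow_le_one₀ (norm_nonneg _) hq1.le)))
  have h1 := tendsto_nhds_unique
    (((tendsto_qPoch hq1 d).mul_const (∑' m, oneOneTerm q a d m)).congr hiter)
    ((tendsto_qPoch hq1 a).mul hlim)
  rw [eq_div_iff (qInf_ne_zero hq1 hd)]
  linear_combination h1

/-! ### Products of series and Andrews' formula -/

/-- Induction on M, splitting off the first coordinate. Besides evaluating ∑ ∏, it supplies the
dominating series over multi-indices. -/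
theorem summable_and_tsum_pi_prod {𝕜 : Type*} [NormedField 𝕜] [CompleteSpace 𝕜] :
    ∀ (M : ℕ) (f : Fin M → ℕ → 𝕜), (∀ i, Summable fun n => ‖f i n‖) →
      (Summable fun l : Fin M → ℕ => ‖∏ i, f i (l i)‖) ∧
        ∑' l : Fin M → ℕ, ∏ i, f i (l i) = ∏ i, ∑' n, f i n
  | 0, f, _ => by
    constructor
    · exact (hasSum_fintype _).summable
    · rw [tsum_fintype]; simp
  | M + 1, f, hf => by
    obtain ⟨h1, h2⟩ := summable_and_tsum_pi_prod M (fun i => f i.succ) fun i => hf i.succ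
    have e : ∀ p : ℕ × (Fin M → ℕ), ∏ i, f i (Fin.consEquiv (fun _ => ℕ) p i)
        = f 0 p.1 * ∏ i : Fin M, f i.succ (p.2 i) := fun p => by
      rw [Fin.prod_univ_succ]; simp [Fin.consEquiv]
    constructor
    · rw [← (Fin.consEquiv (fun _ => ℕ)).summable_iff]
      refine ((hf 0).mul_norm h1).congr fun p => ?_
      rw [Function.comp, e]
    · rw [← (Fin.consEquiv (fun _ => ℕ)).tsum_eq, tsum_congr e, Fin.prod_univ_succ, ← h2,
        tsum_mul_tsum_of_summable_norm (hf 0) h1]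

theorem qInf_ne_zero_of_norm_lt_one {q a : ℂ} (hq1 : ‖q‖ < 1) (ha : ‖a‖ < 1) : qInf q a ≠ 0 :=
  qInf_ne_zero hq1 fun n h => by
    have := congrArg norm h
    rw [norm_mul, norm_pow, norm_one] at this
    have h2 : ‖q‖ ^ n ≤ 1 := pow_le_one₀ (norm_nonneg _) hq1.le
    nlinarith [norm_nonneg a, pow_nonneg (norm_nonneg q) n]

theorem norm_mul_pow_lt_one {q a : ℂ} (hq1 : ‖q‖ < 1) (ha : ‖a‖ < 1) (n : ℕ) :
    ‖a * q ^ n‖ < 1 := by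
  rw [norm_mul, norm_pow]
  exact (mul_le_of_le_one_right (norm_nonneg _) (pow_le_one₀ (norm_nonneg _) hq1.le)).trans_lt ha

/-- The part of the summand of `φ_D` that does not involve `A` and `C`. -/
def phiWeight (q : ℂ) (B x : Fin M → ℂ) (l : Fin M → ℕ) : ℂ :=
  ∏ i, (qPoch q (B i) (l i) / qPoch q q (l i) * x i ^ l i)

theorem summable_phiWeight {q : ℂ} (hq1 : ‖q‖ < 1) (B : Fin M → ℂ) {x : Fin M → ℂ}
    (hx : ∀ i, ‖x i‖ < 1) : (Summable fun l => ‖phiWeight q B x l‖) ∧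
      ∑' l, phiWeight q B x l = ∏ i, qInf q (B i * x i) / qInf q (x i) := by
  have e : ∀ i n, qPoch q (B i) n / qPoch q q n * x i ^ n
      = homPoch q (x i) (B i * x i) n / qPoch q q n := fun i n => by
    rw [homPoch_mul_right]; ring
  have := summable_and_tsum_pi_prod M (fun i n => qPoch q (B i) n / qPoch q q n * x i ^ n)
    fun i => by simpa only [e] using summable_homPoch_div hq1 (hx i) (B i * x i)
  refine ⟨this.1, this.2.trans (prod_congr rfl fun i _ => ?_)⟩
  rw [tsum_congr (e i), tsum_homPoch_div hq1 (hx i)]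

/-- One majorant for the whole disc ‖A‖ ≤ R, so that φ_D is entire in A. -/
theorem exists_summable_phiDTerm {q : ℂ} (hq1 : ‖q‖ < 1) (B : Fin M → ℂ) {x : Fin M → ℂ}
    (hx : ∀ i, ‖x i‖ < 1) {C : ℂ} (hC : ∀ n : ℕ, C * q ^ n ≠ 1) (R : ℝ) :
    ∃ u : (Fin M → ℕ) → ℝ, Summable u ∧
      ∀ A : ℂ, ‖A‖ ≤ R → ∀ l, ‖phiDTerm q A B C x l‖ ≤ u l := by
  obtain ⟨K, hK⟩ := exists_norm_inv_qPoch_le hq1 hC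
  refine ⟨fun l => Real.exp (R / (1 - ‖q‖)) * K * ‖phiWeight q B x l‖,
    (summable_phiWeight hq1 B hx).1.mul_left _, fun A hA l => ?_⟩
  rw [phiDTerm, ← phiWeight, norm_mul, div_eq_mul_inv, norm_mul]
  exact mul_le_mul_of_nonneg_right (mul_le_mul (norm_qPoch_le hq1 hA _) (hK _) (norm_nonneg _)
    (Real.exp_nonneg _)) (norm_nonneg _)

/-- The product `∏_i (x_i)_k / (B_i x_i)_k`. -/
def dualRatio (q : ℂ) (B x : Fin M → ℂ) (k : ℕ) : ℂ :=
  ∏ i, qPoch q (x i) k / qPoch q (B i * x i) k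

theorem exists_norm_dualRatio_le {q : ℂ} (hq1 : ‖q‖ < 1) {B x : Fin M → ℂ}
    (hBx : ∀ i, ∀ n : ℕ, B i * x i * q ^ n ≠ 1) : ∃ K : ℝ, ∀ k, ‖dualRatio q B x k‖ ≤ K := by
  choose K hK using fun i => exists_norm_inv_qPoch_le hq1 (hBx i)
  refine ⟨∏ i, (Real.exp (‖x i‖ / (1 - ‖q‖)) * K i), fun k => ?_⟩
  rw [dualRatio, norm_prod]
  refine prod_le_prod (fun _ _ => norm_nonneg _) fun i _ => ?_
  rw [div_eq_mul_inv, norm_mul]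
  exact mul_le_mul (norm_qPoch_le hq1 le_rfl k) (hK i k) (norm_nonneg _) (Real.exp_nonneg _)

/-- The summand of the one-variable series in Andrews' formula for `φ_D`. -/
def dualTerm (q A : ℂ) (B : Fin M → ℂ) (C : ℂ) (x : Fin M → ℂ) (k : ℕ) : ℂ :=
  homPoch q A C k / qPoch q q k * dualRatio q B x k

theorem summable_dualTerm {q : ℂ} (hq1 : ‖q‖ < 1) {A : ℂ} (hA : ‖A‖ < 1) {B x : Fin M → ℂ}
    (hBx : ∀ i, ∀ n : ℕ, B i * x i * q ^ n ≠ 1) (C : ℂ) :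
    Summable fun k => ‖dualTerm q A B C x k‖ := by
  obtain ⟨K, hK⟩ := exists_norm_dualRatio_le hq1 hBx
  refine ((summable_homPoch_div hq1 hA C).mul_right K).of_norm_bounded fun k => ?_
  rw [norm_norm, dualTerm, norm_mul]
  exact mul_le_mul_of_nonneg_left (hK k) (norm_nonneg _)

/-- The left side is (A)_∞/(C)_∞ times (C q^n)_∞/(A q^n)_∞, to which the q-binomial theorem applies.
In the result n enters only through (q^k)^n, which for n = |l| factors over the coordinates of l. -/
theorem qPoch_div_eq_tsum {q : ℂ} (hq1 : ‖q‖ < 1) {A : ℂ} (hA : ‖A‖ < 1) {C : ℂ}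
    (hC : ∀ n : ℕ, C * q ^ n ≠ 1) (n : ℕ) :
    qPoch q A n / qPoch q C n
      = qInf q A / qInf q C * ∑' k, homPoch q A C k / qPoch q q k * (q ^ n) ^ k := by
  have h := tsum_homPoch_div hq1 (norm_mul_pow_lt_one hq1 hA n) (C * q ^ n)
  have e : ∀ k, homPoch q (A * q ^ n) (C * q ^ n) k / qPoch q q k
      = homPoch q A C k / qPoch q q k * (q ^ n) ^ k := fun k => by
    rw [mul_comm A, mul_comm C, homPoch_mul]; ring
  rw [tsum_congr e] at h
  have h1 := qInf_ne_zero_of_norm_lt_one hq1 (norm_mul_pow_lt_one hq1 hA n)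
  have h2 : qInf q (C * q ^ n) ≠ 0 := qInf_ne_zero hq1 fun m => by
    rw [mul_assoc, ← pow_add]; exact hC _
  have h3 : qPoch q C n ≠ 0 := qPoch_ne_zero fun m _ => hC m
  rw [h, qInf_eq_mul hq1 A n, qInf_eq_mul hq1 C n]
  generalize qInf q (C * q ^ n) = c at *
  generalize qInf q (A * q ^ n) = a at *
  field_simp

/-- Andrews' formula: `φ_D` as a one-variable basic hypergeometric series. -/
theorem phiD_eq_tsum_dualTerm {q : ℂ} (hq1 : ‖q‖ < 1) {A : ℂ} (hA : ‖A‖ < 1) {B x : Fin M → ℂ}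
    (hx : ∀ i, ‖x i‖ < 1) (hBx : ∀ i, ∀ n : ℕ, B i * x i * q ^ n ≠ 1) {C : ℂ}
    (hC : ∀ n : ℕ, C * q ^ n ≠ 1) :
    phiD q A B C x = qInf q A / qInf q C * (∏ i, qInf q (B i * x i) / qInf q (x i)) *
      ∑' k, dualTerm q A B C x k := by
  have e1 : ∀ l, phiDTerm q A B C x l = qInf q A / qInf q C *
      ∑' k, homPoch q A C k / qPoch q q k * phiWeight q B (fun i => x i * q ^ k) l := fun l => by
    rw [phiDTerm, qPoch_div_eq_tsum hq1 hA hC, mul_assoc, ← tsum_mul_right]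
    congr 1
    refine tsum_congr fun k => ?_
    rw [mul_assoc]
    congr 1
    rw [phiWeight, len, ← prod_pow_eq_pow_sum, ← prod_pow, ← prod_mul_distrib]
    refine prod_congr rfl fun i _ => ?_
    rw [mul_pow, ← pow_mul, ← pow_mul, mul_comm k]
    ring
  -- Replacing x_i by x_i q^k only decreases the moduli, so a product of two convergent series
  -- dominates and the sums may be interchanged.
  have hs : Summable (uncurry fun l k =>
      homPoch q A C k / qPoch q q k * phiWeight q B (fun i => x i * q ^ k) l) := by
    refine ((summable_phiWeight hq1 B hx).1.mul_of_nonneg (summable_homPoch_div hq1 hA C)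
      (fun _ => norm_nonneg _) (fun _ => norm_nonneg _)).of_norm_bounded ?_
    rintro ⟨l, k⟩
    simp only [uncurry]
    rw [norm_mul, mul_comm]
    refine mul_le_mul_of_nonneg_right ?_ (norm_nonneg _)
    rw [phiWeight, phiWeight, norm_prod, norm_prod]
    refine prod_le_prod (fun _ _ => norm_nonneg _) fun i _ => ?_
    rw [norm_mul, norm_mul, norm_pow, norm_pow]
    gcongr
    rw [norm_mul, norm_pow]
    exact mul_le_of_le_one_right (norm_nonneg _) (pow_le_one₀ (norm_nonneg _) hq1.le)
  have hcomm : ∑' l, ∑' k, homPoch q A C k / qPoch q q k * phiWeight q B (fun i => x i * q ^ k) l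
      = ∑' k, ∑' l, homPoch q A C k / qPoch q q k * phiWeight q B (fun i => x i * q ^ k) l :=
    (Summable.tsum_comm hs).symm
  have hk : ∀ k, (∏ i, qInf q (B i * x i) / qInf q (x i)) * dualTerm q A B C x k
      = ∑' l, homPoch q A C k / qPoch q q k * phiWeight q B (fun i => x i * q ^ k) l := by
    intro k
    rw [tsum_mul_left, (summable_phiWeight hq1 B (x := fun i => x i * q ^ k)
      fun i => norm_mul_pow_lt_one hq1 (hx i) k).2,
      dualTerm, mul_left_comm, dualRatio, ← prod_mul_distrib]
    congr 1
    refine prod_congr rfl fun i _ => ?_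
    have h1 := qInf_ne_zero_of_norm_lt_one hq1 (norm_mul_pow_lt_one hq1 (hx i) k)
    have h2 : qPoch q (B i * x i) k ≠ 0 := qPoch_ne_zero fun m _ => hBx i m
    have h3 : qPoch q (x i) k ≠ 0 := fun h => by
      have := qInf_eq_mul hq1 (x i) k
      rw [h, zero_mul] at this
      exact qInf_ne_zero_of_norm_lt_one hq1 (hx i) this
    rw [qInf_eq_mul hq1 (B i * x i) k, qInf_eq_mul hq1 (x i) k, mul_assoc (B i)]
    field_simp
  rw [phiD, tsum_congr e1, tsum_mul_left, hcomm, mul_assoc, ← tsum_congr hk, tsum_mul_left]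

/-! ### The duality specialised to z_i = B_i x_i -/

/-- The factor of the multiple series that is common to all of them. -/
def baseCoeff (q : ℂ) (B x : Fin M → ℂ) (l : Fin M → ℕ) : ℂ :=
  vandRatio q B x l * ∏ i, ((∏ j, qPoch q (B i * x i / x j) (l i)) /
    ((∏ j, qPoch q (q * B i * x i / (B j * x j)) (l i)) * qPoch q (B i * x i) (l i)))

theorem baseCoeff_eq (q : ℂ) (B x : Fin M → ℂ) (l : Fin M → ℕ) :
    baseCoeff q B x l = vandCoeff q (fun i => B i * x i) l *
      ∏ i, ((∏ j, qPoch q (B i * x i / x j) (l i)) / qPoch q (B i * x i) (l i)) := by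
  rw [baseCoeff, vandCoeff, vandRatio, mul_assoc, ← prod_inv_distrib, ← prod_mul_distrib]
  congr 1
  refine prod_congr rfl fun i _ => ?_
  simp only [mul_assoc]
  rw [div_mul_eq_div_div_swap, div_eq_mul_inv _ (∏ j, _), mul_comm]

/-- The Vandermonde quotient is bounded because |q^{l_i}| ≤ 1, and all factorials and their
reciprocals are bounded. Convergence of each multiple series therefore depends only on its remaining
factors. -/
theorem exists_norm_baseCoeff_le {q : ℂ} (hq1 : ‖q‖ < 1) {B x : Fin M → ℂ}
    (hx0 : ∀ i, x i ≠ 0) (hB0 : ∀ i, B i ≠ 0)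
    (hBx : ∀ i, ∀ n : ℕ, B i * x i * q ^ n ≠ 1)
    (hsep : ∀ i j, i ≠ j → ∀ n : ℕ, B i * x i * q ^ n ≠ B j * x j) :
    ∃ K : ℝ, ∀ l, ‖baseCoeff q B x l‖ ≤ K := by
  choose K₁ hK₁ using fun i => exists_norm_inv_qPoch_le hq1 (hBx i)
  have h2 : ∀ i j, ∃ K : ℝ, ∀ n, ‖(qPoch q (q * B i * x i / (B j * x j)) n)⁻¹‖ ≤ K := fun i j =>
    exists_norm_inv_qPoch_le hq1 fun n => by
      have hz : B j * x j ≠ 0 := mul_ne_zero (hB0 j) (hx0 j)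
      by_cases hij : i = j
      · subst hij
        rw [mul_assoc, mul_div_assoc, div_self hz, mul_one]
        exact self_mul_pow_ne_one hq1 n
      · intro h
        refine hsep i j hij (n + 1) ?_
        have h3 : q * B i * x i / (B j * x j) * q ^ n * (B j * x j) = 1 * (B j * x j) := by rw [h]
        have h4 : q * B i * x i / (B j * x j) * (B j * x j) = q * B i * x i := div_mul_cancel₀ _ hz
        rw [pow_succ]
        linear_combination h3 - q ^ n * h4
  choose K₂ hK₂ using h2
  refine ⟨(∏ i : Fin M, ∏ j ∈ Ioi i, (‖B i * x i‖ + ‖B j * x j‖)) / ‖vand (fun i => B i * x i)‖ *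
    ∏ i, ((∏ j, Real.exp (‖B i * x i / x j‖ / (1 - ‖q‖))) * ((∏ j, K₂ i j) * K₁ i)), fun l => ?_⟩
  rw [baseCoeff, vandRatio, norm_mul, norm_div, norm_prod]
  refine mul_le_mul ?_ ?_ (by positivity) (by positivity)
  · gcongr
    rw [vand, norm_prod]
    refine prod_le_prod (fun _ _ => norm_nonneg _) fun i _ => ?_
    rw [norm_prod]
    refine prod_le_prod (fun _ _ => norm_nonneg _) fun j _ => ?_
    have hle : ∀ a n, ‖a * q ^ n‖ ≤ ‖a‖ := fun a n => by
      rw [norm_mul, norm_pow]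
      exact mul_le_of_le_one_right (norm_nonneg _) (pow_le_one₀ (norm_nonneg _) hq1.le)
    exact (norm_sub_le _ _).trans (add_le_add (hle _ _) (hle _ _))
  · refine prod_le_prod (fun _ _ => norm_nonneg _) fun i _ => ?_
    rw [div_eq_mul_inv, mul_inv, norm_mul, norm_mul, ← prod_inv_distrib, norm_prod, norm_prod]
    have h3 : 0 ≤ ∏ j, K₂ i j := prod_nonneg fun j _ => (norm_nonneg _).trans (hK₂ i j 0)
    exact mul_le_mul
      (prod_le_prod (fun _ _ => norm_nonneg _) fun j _ => norm_qPoch_le hq1 le_rfl _)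
      (mul_le_mul (prod_le_prod (fun _ _ => norm_nonneg _) fun j _ => hK₂ i j _) (hK₁ i _)
        (norm_nonneg _) h3) (by positivity) (prod_nonneg fun _ _ => Real.exp_nonneg _)

/-- The polynomial `∏_j (1 - X / x_j)`. -/
def basePoly (x : Fin M → ℂ) : ℂ[X] := ∏ j, (1 - C (x j)⁻¹ * X)

theorem natDegree_one_sub_C_mul_X_le (c : ℂ) : (1 - C c * X : ℂ[X]).natDegree ≤ 1 := by
  compute_degree

theorem natDegree_basePoly_le (x : Fin M → ℂ) : (basePoly x).natDegree ≤ M := by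
  refine (natDegree_prod_le _ _).trans ((sum_le_sum fun j _ =>
    natDegree_one_sub_C_mul_X_le _).trans ?_)
  simp

theorem coeff_basePoly (x : Fin M → ℂ) : (basePoly x).coeff M = (-1) ^ M * ∏ j, (x j)⁻¹ := by
  have := coeff_prod_of_natDegree_le (univ : Finset (Fin M)) (fun j => 1 - C (x j)⁻¹ * X) 1
    fun j _ => natDegree_one_sub_C_mul_X_le _
  rw [card_univ, Fintype.card_fin, mul_one] at this
  rw [basePoly, this]
  simp [coeff_one, prod_neg]

theorem eval_basePoly (x : Fin M → ℂ) (u : ℂ) : (basePoly x).eval u = ∏ j, (1 - u / x j) := by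
  rw [basePoly, eval_prod]
  refine prod_congr rfl fun j _ => ?_
  simp; ring

/-- At t = q^j this is how the values P(q^{-j}) produce the factors (x_i)_k of Andrews' series. -/
theorem basePoly_reverse {x : Fin M → ℂ} (hx0 : ∀ i, x i ≠ 0) {t : ℂ} (ht : t ≠ 0) :
    (-1) ^ M * t ^ M * (basePoly x).eval t⁻¹ = (∏ i, (1 - x i * t)) * ∏ i, (x i)⁻¹ := by
  rw [eval_basePoly, show (-1 : ℂ) ^ M * t ^ M = ∏ _i : Fin M, (-t) by rw [← mul_pow]; simp,
    ← prod_mul_distrib, ← prod_mul_distrib]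
  refine prod_congr rfl fun i _ => ?_
  have := hx0 i
  field_simp
  ring

theorem prod_range_basePoly (q : ℂ) (x : Fin M → ℂ) (z : ℂ) (n : ℕ) :
    ∏ m ∈ range n, (basePoly x).eval (z * q ^ m) = ∏ j, qPoch q (z / x j) n := by
  simp only [eval_basePoly, qPoch]
  rw [Finset.prod_comm]
  refine prod_congr rfl fun j _ => prod_congr rfl fun m _ => by ring

/-- This is `multiSum_eq` for P = (a - bX) ∏ (1 - X/x_j). P(0) = a and the top coefficient give the
factor in r, the values P(q^{-j}) give the factor in k. Keeping a and b free covers the second and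
third formulas together. -/
theorem sum_baseCoeff {q : ℂ} (hq0 : q ≠ 0) (hq1 : ‖q‖ < 1) {B x : Fin M → ℂ}
    (hx0 : ∀ i, x i ≠ 0) (hB0 : ∀ i, B i ≠ 0)
    (hBx : ∀ i, ∀ n : ℕ, B i * x i * q ^ n ≠ 1)
    (hsep : ∀ i j, i ≠ j → ∀ n : ℕ, B i * x i * q ^ n ≠ B j * x j) (a b : ℂ) (n : ℕ) :
    ∑ l ∈ Nat.antidiagonalTuple M n, baseCoeff q B x l *
        ∏ i, homPoch q a (b * (B i * x i)) (l i)
      = ∑ p ∈ HasAntidiagonal.antidiagonal n, homPoch q a (b * ∏ i, B i) p.2 / qPoch q q p.2 *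
          ((∏ i, B i) ^ p.1 * homPoch q b a p.1 / qPoch q q p.1 * dualRatio q B x p.1) := by
  set P : ℂ[X] := basePoly x * (C a - C b * X) with hP
  have hlin : (C a - C b * X).natDegree ≤ 1 := by compute_degree
  have hdeg : P.natDegree ≤ M + 1 := natDegree_mul_le.trans
    (add_le_add (natDegree_basePoly_le x) hlin)
  have h := multiSum_eq hq0 (pow_succ_ne_one_of_norm_lt_one hq1) hdeg n (fun i => B i * x i)
    (fun i => mul_ne_zero (hB0 i) (hx0 i)) (fun i m _ => hBx i m) (fun i j hij m _ => hsep i j hij m)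
  have hp0 : P.coeff 0 = a := by
    rw [coeff_zero_eq_eval_zero, hP, eval_mul, eval_basePoly]; simp
  have hpt : (-1) ^ (M + 1) * P.coeff (M + 1) = b * ∏ i, (x i)⁻¹ := by
    rw [hP, coeff_mul_add_eq_of_natDegree_le (natDegree_basePoly_le x) hlin, coeff_basePoly]
    have : (-1 : ℂ) ^ M * (-1) ^ M = 1 := by rw [← mul_pow]; simp
    have hc : (C a - C b * X).coeff 1 = -b := by simp [coeff_C]
    rw [hc, pow_succ]
    linear_combination (b * ∏ i, (x i)⁻¹) * this
  have hxx : (∏ i, x i) * ∏ i, (x i)⁻¹ = 1 := by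
    rw [← prod_mul_distrib]; exact prod_eq_one fun i _ => mul_inv_cancel₀ (hx0 i)
  rw [multiSum] at h
  refine Eq.trans (sum_congr rfl fun l _ => ?_) (h.trans (sum_congr rfl fun p _ => ?_))
  · rw [baseCoeff_eq, mul_assoc, ← prod_mul_distrib]
    congr 1
    refine prod_congr rfl fun i _ => ?_
    rw [prod_div_distrib, hP]
    simp only [eval_mul]
    rw [prod_mul_distrib, prod_range_basePoly, homPoch, qPoch.eq_def q (B i * x i), div_mul_eq_mul_div]
    congr 2
    refine prod_congr rfl fun m _ => ?_
    simp; ring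
  · rw [dualWeight, hp0, hpt, dualRatio, prod_div_distrib, mul_assoc]
    congr 1
    · congr 1
      refine prod_congr rfl fun m _ => ?_
      rw [prod_mul_distrib]
      linear_combination (-b * (∏ i, B i) * q ^ m) * hxx
    · have hQ : ∏ j ∈ range p.1, ((-1) ^ (M + 1) * (q ^ j) ^ (M + 1) * P.eval (q ^ j)⁻¹)
          = (∏ i, qPoch q (x i) p.1) * (∏ i, (x i)⁻¹) ^ p.1 * homPoch q b a p.1 := by
        simp only [qPoch]
        rw [Finset.prod_comm, homPoch, ← card_range p.1, ← prod_const, card_range, ← prod_mul_distrib,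
          ← prod_mul_distrib]
        refine prod_congr rfl fun j _ => ?_
        have hqj : q ^ j ≠ 0 := pow_ne_zero _ hq0
        have := basePoly_reverse hx0 hqj
        rw [← this, hP]
        simp only [eval_mul, eval_sub, eval_C, eval_X]
        rw [pow_succ, pow_succ]
        field_simp
        ring
      have hpow : (∏ i, x i) ^ p.1 * (∏ i, (x i)⁻¹) ^ p.1 = 1 := by rw [← mul_pow, hxx, one_pow]
      rw [hQ, prod_mul_distrib, mul_pow]
      linear_combination ((∏ i, B i) ^ p.1 * (∏ i, qPoch q (x i) p.1) * homPoch q b a p.1 /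
        qPoch q q p.1 * (∏ i, qPoch q (B i * x i) p.1)⁻¹) * hpow

/-! ### Rearrangement by degree and analytic continuation -/

theorem tsum_eq_tsum_sum_antidiagonalTuple {f : (Fin M → ℕ) → ℂ} (hf : Summable f) :
    ∑' l, f l = ∑' n, ∑ l ∈ Nat.antidiagonalTuple M n, f l := by
  rw [← (Nat.sigmaAntidiagonalTupleEquivTuple M).tsum_eq f, Summable.tsum_sigma]
  · exact tsum_congr fun n => Finset.tsum_subtype (Nat.antidiagonalTuple M n) f
  · exact (Nat.sigmaAntidiagonalTupleEquivTuple M).summable_iff.2 hf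

theorem tsum_prod_eq_tsum_sum_antidiagonal {f : ℕ × ℕ → ℂ} (hf : Summable f) :
    ∑' n, ∑ p ∈ HasAntidiagonal.antidiagonal n, f p = ∑' k, ∑' r, f (k, r) := by
  rw [← hf.tsum_prod, ← HasAntidiagonal.sigmaAntidiagonalEquivProd.tsum_eq f, Summable.tsum_sigma]
  · exact (tsum_congr fun n => Finset.tsum_subtype (HasAntidiagonal.antidiagonal n) f).symm
  · exact HasAntidiagonal.sigmaAntidiagonalEquivProd.summable_iff.2 hf

theorem differentiable_tsum_of_locally_bounded {ι : Type*} {f : ℂ → ι → ℂ}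
    (hf : ∀ i, Differentiable ℂ fun a => f a i)
    (hb : ∀ R : ℝ, ∃ u : ι → ℝ, Summable u ∧ ∀ a : ℂ, ‖a‖ ≤ R → ∀ i, ‖f a i‖ ≤ u i) :
    Differentiable ℂ fun a => ∑' i, f a i := by
  intro a
  obtain ⟨u, hu, h⟩ := hb (‖a‖ + 1)
  have := Complex.differentiableOn_tsum_of_summable_norm (F := fun i a => f a i) hu
    (fun i => (hf i).differentiableOn) (Metric.isOpen_ball (x := (0 : ℂ)) (ε := ‖a‖ + 1))
    fun i w hw => h w (mem_ball_zero_iff.1 hw).le i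
  exact this.differentiableAt (Metric.isOpen_ball.mem_nhds (by simp))

/-- The identity theorem with agreement only on a punctured disc, since the proof of the first
formula divides by A. -/
theorem eq_of_eq_near_zero {F G : ℂ → ℂ} (hF : Differentiable ℂ F) (hG : Differentiable ℂ G)
    {ε : ℝ} (hε : 0 < ε) (h : ∀ a, a ≠ 0 → ‖a‖ < ε → F a = G a) : F = G := by
  refine AnalyticOnNhd.eq_of_frequently_eq (z₀ := 0) (fun z _ => hF.analyticAt z)
    (fun z _ => hG.analyticAt z) (Eventually.frequently ?_)
  filter_upwards [self_mem_nhdsWithin, nhdsWithin_le_nhds (Metric.ball_mem_nhds (0 : ℂ) hε)]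
    with a ha hb
  exact h a ha (mem_ball_zero_iff.1 hb)

theorem differentiable_qPoch (q c : ℂ) (n : ℕ) : Differentiable ℂ fun a => qPoch q (a * c) n := by
  unfold qPoch; fun_prop

theorem differentiable_phiD {q : ℂ} (hq1 : ‖q‖ < 1) (B : Fin M → ℂ) {x : Fin M → ℂ}
    (hx : ∀ i, ‖x i‖ < 1) {C : ℂ} (hC : ∀ n : ℕ, C * q ^ n ≠ 1) :
    Differentiable ℂ fun A => phiD q A B C x := by
  refine differentiable_tsum_of_locally_bounded (fun l => ?_) (exists_summable_phiDTerm hq1 B hx hC)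
  unfold phiDTerm
  have := differentiable_qPoch q 1 (len l)
  simp only [mul_one] at this
  fun_prop

/-! ### The second formula -/

theorem term₂_eq (q A : ℂ) (B : Fin M → ℂ) (C : ℂ) (x : Fin M → ℂ) (l : Fin M → ℕ) :
    term₂ q A B C x l = (C / ∏ j, B j) ^ len l * (baseCoeff q B x l *
      ∏ i, homPoch q 1 (A / C * (B i * x i)) (l i)) := by
  rw [term₂, baseCoeff, mul_assoc, mul_assoc, ← prod_mul_distrib]
  congr 2
  refine prod_congr rfl fun i _ => ?_
  rw [show homPoch q 1 (A / C * (B i * x i)) (l i) = qPoch q (A * B i * x i / C) (l i) by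
    rw [show A / C * (B i * x i) = A * B i * x i / C by ring]; rfl]
  ring

/-- All other factors are bounded uniformly for ‖A‖ ≤ R, so the geometric factor (C/B)^{|l|} gives
convergence. -/
theorem exists_summable_term₂ {q : ℂ} (hq1 : ‖q‖ < 1) {B x : Fin M → ℂ}
    (hx0 : ∀ i, x i ≠ 0) (hB0 : ∀ i, B i ≠ 0)
    (hBx : ∀ i, ∀ n : ℕ, B i * x i * q ^ n ≠ 1)
    (hsep : ∀ i j, i ≠ j → ∀ n : ℕ, B i * x i * q ^ n ≠ B j * x j) {C : ℂ}
    (hCB : ‖C / ∏ j, B j‖ < 1) (R : ℝ) :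
    ∃ u : (Fin M → ℕ) → ℝ, Summable u ∧ ∀ A : ℂ, ‖A‖ ≤ R → ∀ l, ‖term₂ q A B C x l‖ ≤ u l := by
  obtain ⟨K, hK⟩ := exists_norm_baseCoeff_le hq1 hx0 hB0 hBx hsep
  have hs := (summable_and_tsum_pi_prod M (fun _ n => (C / ∏ j, B j) ^ n) fun i => by
    simpa only [norm_pow] using summable_geometric_of_lt_one (norm_nonneg _) hCB).1
  refine ⟨fun l => ‖∏ i, (C / ∏ j, B j) ^ l i‖ * (K *
    ∏ i, Real.exp (R / ‖C‖ * ‖B i * x i‖ / (1 - ‖q‖))), hs.mul_right _, fun A hA l => ?_⟩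
  rw [term₂_eq, norm_mul, norm_mul, len, ← prod_pow_eq_pow_sum, norm_prod (s := univ)
    (f := fun i => homPoch q 1 (A / C * (B i * x i)) (l i))]
  refine mul_le_mul_of_nonneg_left (mul_le_mul (hK l) (prod_le_prod (fun _ _ => norm_nonneg _)
    fun i _ => ?_) (prod_nonneg fun _ _ => norm_nonneg _) ((norm_nonneg _).trans (hK l)))
    (norm_nonneg _)
  refine norm_qPoch_le hq1 ?_ _
  rw [norm_mul, norm_div]
  gcongr

/-- By `sum_baseCoeff` with (a, b) = (1, A/C), the part of degree n is the n-th Cauchy product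
coefficient of Andrews' series and the q-binomial series for (A)_∞/(C/B)_∞. -/
theorem tsum_term₂_of_norm_lt_one {q : ℂ} (hq0 : q ≠ 0) (hq1 : ‖q‖ < 1) {A C : ℂ} (hA : ‖A‖ < 1)
    {B x : Fin M → ℂ} (hx0 : ∀ i, x i ≠ 0) (hB0 : ∀ i, B i ≠ 0)
    (hBx : ∀ i, ∀ n : ℕ, B i * x i * q ^ n ≠ 1)
    (hsep : ∀ i j, i ≠ j → ∀ n : ℕ, B i * x i * q ^ n ≠ B j * x j)
    (hC0 : C ≠ 0) (hCB : ‖C / ∏ j, B j‖ < 1) :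
    ∑' l, term₂ q A B C x l
      = qInf q A / qInf q (C / ∏ j, B j) * ∑' k, dualTerm q A B C x k := by
  obtain ⟨u, hu, hb⟩ := exists_summable_term₂ hq1 hx0 hB0 hBx hsep hCB ‖A‖
  have hs : Summable (term₂ q A B C x) := hu.of_norm_bounded fun l => hb A le_rfl l
  have hB : ∏ j, B j ≠ 0 := prod_ne_zero_iff.2 fun j _ => hB0 j
  rw [tsum_eq_tsum_sum_antidiagonalTuple hs, ← tsum_homPoch_div hq1 hCB A, mul_comm,
    tsum_mul_tsum_eq_tsum_sum_antidiagonal_of_summable_norm (summable_dualTerm hq1 hA hBx C)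
      (summable_homPoch_div hq1 hCB A)]
  refine tsum_congr fun n => ?_
  have e : ∀ l ∈ Nat.antidiagonalTuple M n, term₂ q A B C x l = (C / ∏ j, B j) ^ n *
      (baseCoeff q B x l * ∏ i, homPoch q 1 (A / C * (B i * x i)) (l i)) := fun l hl => by
    rw [term₂_eq, len, Nat.mem_antidiagonalTuple.1 hl]
  rw [sum_congr rfl e, ← mul_sum, sum_baseCoeff hq0 hq1 hx0 hB0 hBx hsep, mul_sum]
  refine sum_congr rfl fun p hp => ?_
  have h1 : homPoch q A C p.1 = C ^ p.1 * homPoch q (A / C) 1 p.1 := by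
    rw [← homPoch_mul, mul_div_cancel₀ _ hC0, mul_one]
  have h2 : homPoch q (C / ∏ j, B j) A p.2
      = (C / ∏ j, B j) ^ p.2 * homPoch q 1 (A / C * ∏ j, B j) p.2 := by
    rw [← homPoch_mul, mul_one]
    congr 1
    field_simp
  rw [← HasAntidiagonal.mem_antidiagonal.1 hp, dualTerm, h1, h2, pow_add]
  have h3 : (C / ∏ j, B j) ^ p.1 * (∏ j, B j) ^ p.1 = C ^ p.1 := by
    rw [← mul_pow, div_mul_cancel₀ _ hB]
  rw [← h3]
  ring

theorem second_transformation {q : ℂ} (hq0 : q ≠ 0) (hq1 : ‖q‖ < 1) (A : ℂ) {C : ℂ}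
    {B x : Fin M → ℂ} (hx : ∀ i, ‖x i‖ < 1) (hx0 : ∀ i, x i ≠ 0) (hB0 : ∀ i, B i ≠ 0)
    (hC : ∀ n : ℕ, C * q ^ n ≠ 1) (hBx : ∀ i, ∀ n : ℕ, B i * x i * q ^ n ≠ 1)
    (hsep : ∀ i j, i ≠ j → ∀ n : ℕ, B i * x i * q ^ n ≠ B j * x j)
    (hC0 : C ≠ 0) (hCB : ‖C / ∏ j, B j‖ < 1) :
    qInf q (C / ∏ j, B j) / qInf q C * (∏ i, qInf q (B i * x i) / qInf q (x i)) *
      (∑' l, term₂ q A B C x l) = phiD q A B C x := by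
  have hF : Differentiable ℂ fun A => ∑' l, term₂ q A B C x l := by
    refine differentiable_tsum_of_locally_bounded (fun l => ?_)
      (exists_summable_term₂ hq1 hx0 hB0 hBx hsep hCB)
    simp only [term₂_eq, homPoch]
    fun_prop
  refine congrFun (eq_of_eq_near_zero (hF.const_mul (qInf q (C / ∏ j, B j) / qInf q C *
    ∏ i, qInf q (B i * x i) / qInf q (x i))) (differentiable_phiD hq1 B hx hC) one_pos
    fun A _ hA => ?_) A
  rw [phiD_eq_tsum_dualTerm hq1 hA hx hBx hC,
    tsum_term₂_of_norm_lt_one hq0 hq1 hA hx0 hB0 hBx hsep hC0 hCB]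
  have h1 := qInf_ne_zero_of_norm_lt_one hq1 hCB
  field_simp

/-! ### The third formula -/

/-- The summand of the third multiple series, with the factor `A^n (C / A)_n` in polynomial form. -/
def polyTerm₃ (q A : ℂ) (B : Fin M → ℂ) (C : ℂ) (x : Fin M → ℂ) (l : Fin M → ℕ) : ℂ :=
  (-(∏ j, B j)⁻¹) ^ len l * (homPoch q A C (len l) / qPoch q C (len l)) *
    (baseCoeff q B x l * ∏ i, homPoch q 0 (-1 * (B i * x i)) (l i))

theorem homPoch_zero_left (q b : ℂ) (n : ℕ) :
    homPoch q 0 b n = (-b) ^ n * q ^ n.choose 2 := by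
  induction n with
  | zero => simp [homPoch_zero]
  | succ n ih =>
    have : (n + 1).choose 2 = n.choose 2 + n := by
      rw [Nat.choose_succ_succ' n 1, Nat.choose_one_right, add_comm]
    rw [homPoch_succ, ih, this, pow_succ, pow_add]
    ring

theorem term₃_eq {A : ℂ} (hA : A ≠ 0) (q : ℂ) (B : Fin M → ℂ) (C : ℂ) (x : Fin M → ℂ)
    (l : Fin M → ℕ) : term₃ q A B C x l = polyTerm₃ q A B C x l := by
  rw [term₃, polyTerm₃, homPoch_eq_pow_mul hA, baseCoeff, mul_assoc (vandRatio q B x l),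
    ← prod_mul_distrib]
  have e : ∀ i, ((∏ j, qPoch q (B i * x i / x j) (l i)) /
      ((∏ j, qPoch q (q * B i * x i / (B j * x j)) (l i)) * qPoch q (B i * x i) (l i))) *
        homPoch q 0 (-1 * (B i * x i)) (l i)
      = ((∏ j, qPoch q (B i * x i / x j) (l i)) * (B i * x i) ^ l i * q ^ (l i).choose 2) /
      ((∏ j, qPoch q (q * B i * x i / (B j * x j)) (l i)) * qPoch q (B i * x i) (l i)) := fun i => by
    rw [homPoch_zero_left]; ring
  rw [prod_congr rfl fun i _ => e i, show -(A / ∏ j, B j) = A * -(∏ j, B j)⁻¹ by ring, mul_pow]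
  ring

/-- The factors q^{l_i(l_i-1)/2} beat every power in each coordinate. The homogeneous form of A^n
(C/A)_n keeps the bound valid at A = 0. -/
theorem exists_summable_polyTerm₃ {q : ℂ} (hq1 : ‖q‖ < 1) {B x : Fin M → ℂ}
    (hx0 : ∀ i, x i ≠ 0) (hB0 : ∀ i, B i ≠ 0)
    (hBx : ∀ i, ∀ n : ℕ, B i * x i * q ^ n ≠ 1)
    (hsep : ∀ i j, i ≠ j → ∀ n : ℕ, B i * x i * q ^ n ≠ B j * x j) {C : ℂ}
    (hC : ∀ n : ℕ, C * q ^ n ≠ 1) (R : ℝ) :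
    ∃ u : (Fin M → ℕ) → ℝ, Summable u ∧
      ∀ A : ℂ, ‖A‖ ≤ R → ∀ l, ‖polyTerm₃ q A B C x l‖ ≤ u l := by
  obtain ⟨K, hK⟩ := exists_norm_baseCoeff_le hq1 hx0 hB0 hBx hsep
  obtain ⟨K', hK'⟩ := exists_norm_inv_qPoch_le hq1 hC
  have hK'0 : 0 ≤ K' := (norm_nonneg _).trans (hK' 0)
  set ρ : ℝ := ‖(∏ j, B j)⁻¹‖ * (R + ‖C‖) with hρ
  have hs := (summable_and_tsum_pi_prod M
    (fun i n => (ρ * ‖B i * x i‖) ^ n * ‖q‖ ^ n.choose 2) fun i =>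
      (summable_pow_mul_pow_choose (norm_nonneg q) hq1 _).norm).1
  refine ⟨fun l => K' * K * ‖∏ i, ((ρ * ‖B i * x i‖) ^ l i * ‖q‖ ^ (l i).choose 2)‖,
    hs.mul_left _, fun A hA l => ?_⟩
  have hR : 0 ≤ R := (norm_nonneg A).trans hA
  have h1 : ‖∏ i, ((ρ * ‖B i * x i‖) ^ l i * ‖q‖ ^ (l i).choose 2)‖
      = ρ ^ len l * ‖∏ i, homPoch q 0 (-1 * (B i * x i)) (l i)‖ := by
    rw [norm_prod, norm_prod, len, ← prod_pow_eq_pow_sum, ← prod_mul_distrib]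
    refine prod_congr rfl fun i _ => ?_
    rw [homPoch_zero_left, mul_pow, mul_assoc, norm_mul, Real.norm_of_nonneg (by positivity)]
    simp
  beta_reduce
  rw [h1, polyTerm₃, norm_mul, norm_mul, norm_mul, div_eq_mul_inv, norm_mul, norm_pow, norm_neg]
  have h2 : ‖(∏ j, B j)⁻¹‖ ^ len l * ‖homPoch q A C (len l)‖ ≤ ρ ^ len l := by
    rw [hρ, mul_pow]
    exact mul_le_mul_of_nonneg_left (norm_homPoch_le hq1 hA _) (by positivity)
  calc _ = ‖(∏ j, B j)⁻¹‖ ^ len l * ‖homPoch q A C (len l)‖ *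
        (‖(qPoch q C (len l))⁻¹‖ * (‖baseCoeff q B x l‖ *
          ‖∏ i, homPoch q 0 (-1 * (B i * x i)) (l i)‖)) := by ring
    _ ≤ ρ ^ len l * (K' * (K * ‖∏ i, homPoch q 0 (-1 * (B i * x i)) (l i)‖)) :=
      mul_le_mul h2 (mul_le_mul (hK' _) (mul_le_mul_of_nonneg_right (hK l) (norm_nonneg _))
        (by positivity) hK'0) (by positivity) (by positivity)
    _ = _ := by ring

/-- By `sum_baseCoeff` with (a, b) = (0, -1), splitting A^n (C/A)_n and (C)_n at n = k + r leaves,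
for fixed k, a ₁φ₁ in r with parameters A and C q^k. It sums to (A)_∞/(C q^k)_∞, and (C)_k completes
the denominator to (C)_∞. -/
theorem tsum_polyTerm₃_of_norm_lt_one {q : ℂ} (hq0 : q ≠ 0) (hq1 : ‖q‖ < 1) {A C : ℂ}
    (hA : ‖A‖ < 1) {B x : Fin M → ℂ} (hx0 : ∀ i, x i ≠ 0) (hB0 : ∀ i, B i ≠ 0)
    (hC : ∀ n : ℕ, C * q ^ n ≠ 1) (hBx : ∀ i, ∀ n : ℕ, B i * x i * q ^ n ≠ 1)
    (hsep : ∀ i j, i ≠ j → ∀ n : ℕ, B i * x i * q ^ n ≠ B j * x j) :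
    ∑' l, polyTerm₃ q A B C x l = qInf q A / qInf q C * ∑' k, dualTerm q A B C x k := by
  obtain ⟨u, hu, hb⟩ := exists_summable_polyTerm₃ hq1 hx0 hB0 hBx hsep hC ‖A‖
  have hs : Summable (polyTerm₃ q A B C x) := hu.of_norm_bounded fun l => hb A le_rfl l
  have hB : ∏ j, B j ≠ 0 := prod_ne_zero_iff.2 fun j _ => hB0 j
  have hCk : ∀ k n : ℕ, C * q ^ k * q ^ n ≠ 1 := fun k n => by
    rw [mul_assoc, ← pow_add]; exact hC _
  set f : ℕ × ℕ → ℂ := fun p => dualTerm q A B C x p.1 / qPoch q C p.1 *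
    oneOneTerm q A (C * q ^ p.1) p.2 with hf
  have hfs : Summable f := by
    obtain ⟨K', hK'⟩ := exists_norm_inv_qPoch_le hq1 hC
    obtain ⟨v, hv, hvb⟩ := exists_summable_oneOneTerm hq1 hC A
    have hv0 : ∀ m, 0 ≤ v m := fun m => (norm_nonneg _).trans (hvb 0 m A C le_rfl le_rfl)
    refine (((summable_dualTerm hq1 hA hBx C).mul_right K').mul_of_nonneg hv (fun k =>
      mul_nonneg (norm_nonneg _) ((norm_nonneg _).trans (hK' 0))) hv0).of_norm_bounded ?_
    rintro ⟨k, r⟩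
    simp only [hf]
    rw [norm_mul, div_eq_mul_inv, norm_mul]
    have h1 : ‖oneOneTerm q A (C * q ^ k) r‖ ≤ v r := by
      refine hvb k r A (C * q ^ k) le_rfl ?_
      rw [norm_mul, norm_pow]
      exact mul_le_of_le_one_right (norm_nonneg _) (pow_le_one₀ (norm_nonneg _) hq1.le)
    exact mul_le_mul (mul_le_mul_of_nonneg_left (hK' k) (norm_nonneg _)) h1 (norm_nonneg _)
      (mul_nonneg (norm_nonneg _) ((norm_nonneg _).trans (hK' 0)))
  have hn : ∀ n, ∑ l ∈ Nat.antidiagonalTuple M n, polyTerm₃ q A B C x l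
      = ∑ p ∈ HasAntidiagonal.antidiagonal n, f p := fun n => by
    have e : ∀ l ∈ Nat.antidiagonalTuple M n, polyTerm₃ q A B C x l =
        (-(∏ j, B j)⁻¹) ^ n * (homPoch q A C n / qPoch q C n) *
          (baseCoeff q B x l * ∏ i, homPoch q 0 (-1 * (B i * x i)) (l i)) := fun l hl => by
      rw [polyTerm₃, len, Nat.mem_antidiagonalTuple.1 hl]
    rw [sum_congr rfl e, ← mul_sum, sum_baseCoeff hq0 hq1 hx0 hB0 hBx hsep, mul_sum]
    refine sum_congr rfl ?_
    rintro ⟨k, r⟩ hp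
    rw [← HasAntidiagonal.mem_antidiagonal.1 hp]
    simp only [hf]
    have h1 : homPoch q (-1) 0 k = (-1) ^ k := by simp [homPoch]
    have h2 : (-(∏ j, B j)⁻¹) ^ (k + r) * (-(-1 * ∏ j, B j)) ^ r * (∏ j, B j) ^ k * (-1) ^ k
        = (-1) ^ r := by
      have h3 : -(∏ j, B j)⁻¹ * (∏ j, B j) = -1 := by rw [neg_mul, inv_mul_cancel₀ hB]
      have h4 : (-(∏ j, B j)⁻¹ * ∏ j, B j) ^ (k + r) = (-1) ^ k * (-1) ^ r := by rw [h3, pow_add]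
      have h5 : (-1 : ℂ) ^ k * (-1) ^ k = 1 := by rw [← mul_pow]; simp
      rw [mul_pow, pow_add (∏ j, B j)] at h4
      rw [show -(-1 * ∏ j, B j) = ∏ j, B j by ring]
      linear_combination (-1) ^ k * h4 + (-1) ^ r * h5
    rw [homPoch_zero_left, h1, oneOneTerm, dualTerm, homPoch_add, qPoch_add, ← h2]
    ring
  rw [tsum_eq_tsum_sum_antidiagonalTuple hs, tsum_congr hn, tsum_prod_eq_tsum_sum_antidiagonal hfs,
    ← tsum_mul_left]
  refine tsum_congr fun k => ?_
  simp only [hf]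
  rw [tsum_mul_left, tsum_oneOneTerm hq1 (hCk k), qInf_eq_mul hq1 C k]
  ring

theorem third_transformation {q : ℂ} (hq0 : q ≠ 0) (hq1 : ‖q‖ < 1) (A : ℂ) {C : ℂ}
    {B x : Fin M → ℂ} (hx : ∀ i, ‖x i‖ < 1) (hx0 : ∀ i, x i ≠ 0) (hB0 : ∀ i, B i ≠ 0)
    (hC : ∀ n : ℕ, C * q ^ n ≠ 1) (hBx : ∀ i, ∀ n : ℕ, B i * x i * q ^ n ≠ 1)
    (hsep : ∀ i j, i ≠ j → ∀ n : ℕ, B i * x i * q ^ n ≠ B j * x j) :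
    (∏ i, qInf q (B i * x i) / qInf q (x i)) * (∑' l, polyTerm₃ q A B C x l)
      = phiD q A B C x := by
  have hF : Differentiable ℂ fun A => ∑' l, polyTerm₃ q A B C x l := by
    refine differentiable_tsum_of_locally_bounded (fun l => ?_)
      (exists_summable_polyTerm₃ hq1 hx0 hB0 hBx hsep hC)
    simp only [polyTerm₃, homPoch]
    fun_prop
  refine congrFun (eq_of_eq_near_zero (hF.const_mul (∏ i, qInf q (B i * x i) / qInf q (x i)))
    (differentiable_phiD hq1 B hx hC) one_pos fun A _ hA => ?_) A
  rw [phiD_eq_tsum_dualTerm hq1 hA hx hBx hC,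
    tsum_polyTerm₃_of_norm_lt_one hq0 hq1 hA hx0 hB0 hC hBx hsep]
  ring

/-! ### The first formula: the identity in finite degree N -/

theorem vand_cons (w : ℂ) (y : Fin M → ℂ) :
    vand (Fin.cons w y : Fin (M + 1) → ℂ) = (∏ j, (w - y j)) * vand y := by
  rw [vand, Fin.prod_univ_succ, Fin.prod_Ioi_zero]
  simp [vand]

theorem vandCoeff_cons {z₀ : ℂ} (hz₀ : z₀ ≠ 0) (q : ℂ) (z : Fin M → ℂ) (r : ℕ) (l : Fin M → ℕ) :
    vandCoeff q (Fin.cons z₀ z : Fin (M + 1) → ℂ) (Fin.cons r l) = vandCoeff q z l *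
      ((qPoch q q r)⁻¹ * ∏ i, ((z₀ * q ^ r - z i * q ^ l i) / (z₀ - z i) *
        (qPoch q (q * z₀ / z i) r * qPoch q (q * z i / z₀) (l i))⁻¹)) := by
  have h1 : (fun i => (Fin.cons z₀ z : Fin (M + 1) → ℂ) i * q ^ (Fin.cons r l : Fin (M + 1) → ℕ) i)
      = Fin.cons (z₀ * q ^ r) fun i => z i * q ^ l i := by
    funext i
    refine Fin.cases ?_ (fun j => ?_) i <;> simp
  rw [vandCoeff, vandCoeff, h1, vand_cons, vand_cons, Fin.prod_univ_succ, Fin.prod_univ_succ]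
  simp only [Fin.cons_zero, Fin.cons_succ, Fin.prod_univ_succ, prod_mul_distrib, prod_div_distrib,
    prod_inv_distrib, mul_inv]
  rw [mul_div_assoc q, div_self hz₀, mul_one, mul_div_mul_comm]
  ring

/-- Reading the product backwards removes the negative power of q from the argument. The extra
variable z₀ = q/(A q^N) creates several factorials of this shape. -/
theorem qPoch_reverse {q c : ℂ} (hq0 : q ≠ 0) (hc : c ≠ 0) (n r : ℕ) :
    qPoch q (q * c / q ^ (n + r)) r * q ^ (n + r).choose 2
      = (-c) ^ r * q ^ n.choose 2 * qPoch q (q ^ n / c) r := by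
  induction r with
  | zero => simp [qPoch_zero]
  | succ r ih =>
    have h1 : (n + (r + 1)).choose 2 = (n + r).choose 2 + (n + r) := by
      rw [← add_assoc, Nat.choose_succ_succ' (n + r) 1, Nat.choose_one_right, add_comm]
    have h2 : q * c / q ^ (n + (r + 1)) * q = q * c / q ^ (n + r) := by
      rw [← add_assoc, pow_succ]; field_simp
    have h3 : (1 - q * c / q ^ (n + (r + 1))) * q ^ (n + r) = -c * (1 - q ^ n / c * q ^ r) := by
      rw [← add_assoc, pow_succ, pow_add]; field_simp; ring
    rw [qPoch_succ', h2, h1, qPoch_succ, pow_add q ((n + r).choose 2), pow_succ (-c)]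
    linear_combination (1 - q * c / q ^ (n + (r + 1))) * q ^ (n + r) * ih +
      (-c) ^ r * q ^ n.choose 2 * qPoch q (q ^ n / c) r * h3

/-- The weight polynomial `X (1 - b X) ∏_j (1 - X / x_j)`. -/
def wellPoly (x : Fin M → ℂ) (b : ℂ) : ℂ[X] := basePoly x * (X * (1 - C b * X))

theorem natDegree_X_mul_le (b : ℂ) : (X * (1 - C b * X) : ℂ[X]).natDegree ≤ 2 := by
  compute_degree

theorem natDegree_wellPoly_le (x : Fin M → ℂ) (b : ℂ) : (wellPoly x b).natDegree ≤ M + 1 + 1 :=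
  natDegree_mul_le.trans
    (add_le_add (natDegree_basePoly_le x) (natDegree_X_mul_le b) : _ ≤ M + 2)

theorem coeff_wellPoly (x : Fin M → ℂ) (b : ℂ) :
    (-1) ^ (M + 1 + 1) * (wellPoly x b).coeff (M + 1 + 1) = -(b * ∏ i, (x i)⁻¹) := by
  have hc : (X * (1 - C b * X) : ℂ[X]).coeff 2 = -b := by
    rw [coeff_X_mul]; simp [coeff_one]
  rw [wellPoly, show M + 1 + 1 = M + 2 from rfl,
    coeff_mul_add_eq_of_natDegree_le (natDegree_basePoly_le x) (natDegree_X_mul_le b),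
    coeff_basePoly, hc, pow_add]
  have : (-1 : ℂ) ^ M * (-1) ^ M = 1 := by rw [← mul_pow]; simp
  linear_combination (-b * ∏ i, (x i)⁻¹) * this

theorem prod_range_wellPoly (q : ℂ) (x : Fin M → ℂ) (b z : ℂ) (n : ℕ) :
    ∏ m ∈ range n, ((wellPoly x b).eval (z * q ^ m) / (1 - z * q ^ m))
      = (∏ j, qPoch q (z / x j) n) * (z ^ n * q ^ n.choose 2) * qPoch q (b * z) n / qPoch q z n := by
  have h := homPoch_zero_left q (-z) n
  rw [neg_neg] at h
  rw [prod_div_distrib, ← h, ← prod_range_basePoly, homPoch, qPoch, qPoch, ← prod_mul_distrib,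
    ← prod_mul_distrib]
  congr 1
  refine prod_congr rfl fun m _ => ?_
  simp only [wellPoly, eval_mul, eval_sub, eval_one, eval_C, eval_X]
  ring

/-- Since P(0) = 0, the factor in r collapses to a pure power times q^{r(r-1)/2}. Reversing (z₀)_k
against (A)_{k+r} leaves (A)_r, so what remains is a convolution with (A)_r/(q)_r. -/
theorem dualWeight_wellPoly {q : ℂ} (hq0 : q ≠ 0) (hq1 : ‖q‖ < 1) {A C : ℂ} (hA0 : A ≠ 0)
    (hA : ‖A‖ < 1) (hC0 : C ≠ 0) {B x : Fin M → ℂ} (hx0 : ∀ i, x i ≠ 0) (k r : ℕ) {z₀ : ℂ}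
    (hz₀ : z₀ = q / (A * q ^ (k + r))) :
    qPoch q A (k + r) * (dualWeight q (wellPoly x (A / C)) (M + 1) (z₀ * ∏ i, B i * x i) k r *
        (qPoch q z₀ k * ∏ i, qPoch q (B i * x i) k)⁻¹)
      = (z₀ * (A / C) * ∏ i, B i) ^ (k + r) * q ^ (k + r).choose 2 *
        (dualTerm q A B C x k * (qPoch q A r / qPoch q q r)) := by
  have hp0 : (wellPoly x (A / C)).coeff 0 = 0 := by
    rw [coeff_zero_eq_eval_zero, wellPoly, eval_mul]; simp
  have hxx : (∏ i, x i) * ∏ i, (x i)⁻¹ = 1 := by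
    rw [← prod_mul_distrib]; exact prod_eq_one fun i _ => mul_inv_cancel₀ (hx0 i)
  have hAne : ∀ m n : ℕ, A * q ^ m * q ^ n ≠ 1 := fun m n h => by
    have := norm_mul_pow_lt_one hq1 (norm_mul_pow_lt_one hq1 hA m) n
    rw [h, norm_one] at this
    exact lt_irrefl _ this
  have hE : ∏ m ∈ range r, (0 - -(A / C * ∏ i, (x i)⁻¹) * (z₀ * ∏ i, B i * x i) * q ^ m)
      = (z₀ * (A / C) * ∏ i, B i) ^ r * q ^ r.choose 2 := by
    have := homPoch_zero_left q (-(z₀ * (A / C) * ∏ i, B i)) r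
    rw [neg_neg] at this
    rw [← this, homPoch]
    refine prod_congr rfl fun m _ => ?_
    rw [prod_mul_distrib]
    linear_combination (A / C * z₀ * (∏ i, B i) * q ^ m) * hxx
  have hQ : ∏ j ∈ range k, ((-1) ^ (M + 1 + 1) * (q ^ j) ^ (M + 1 + 1) *
        (wellPoly x (A / C)).eval (q ^ j)⁻¹)
      = (∏ i, qPoch q (x i) k) * (∏ i, (x i)⁻¹) ^ k * homPoch q (-(A / C)) (-1) k := by
    simp only [qPoch]
    rw [Finset.prod_comm, homPoch, ← card_range k, ← prod_const, card_range, ← prod_mul_distrib,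
      ← prod_mul_distrib]
    refine prod_congr rfl fun j _ => ?_
    have hqj : q ^ j ≠ 0 := pow_ne_zero _ hq0
    rw [← basePoly_reverse hx0 hqj, wellPoly]
    simp only [eval_mul, eval_sub, eval_C, eval_X, eval_one]
    rw [pow_succ, pow_succ, pow_succ (q ^ j), pow_succ (q ^ j)]
    field_simp
    ring
  have hpow : (∏ i, x i) ^ k * (∏ i, (x i)⁻¹) ^ k = 1 := by rw [← mul_pow, hxx, one_pow]
  have hh : homPoch q A C k = (-C) ^ k * homPoch q (-(A / C)) (-1) k := by
    rw [← homPoch_mul]; congr 1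
    · field_simp
    · ring
  have hrev := qPoch_reverse hq0 (inv_ne_zero hA0) r k
  rw [add_comm r k, show q * A⁻¹ / q ^ (k + r) = z₀ by rw [hz₀]; field_simp, div_inv_eq_mul,
    mul_comm (q ^ r) A] at hrev
  have hAr : qPoch q (A * q ^ r) k ≠ 0 := qPoch_ne_zero fun m _ => hAne r m
  have hRN : q ^ (k + r).choose 2 ≠ 0 := pow_ne_zero _ hq0
  have hRr : q ^ r.choose 2 ≠ 0 := pow_ne_zero _ hq0
  have hAk : (-A⁻¹) ^ k ≠ 0 := pow_ne_zero _ (neg_ne_zero.2 (inv_ne_zero hA0))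
  have hinv : qPoch q (A * q ^ r) k * (qPoch q z₀ k)⁻¹ * q ^ r.choose 2
      = (-A) ^ k * q ^ (k + r).choose 2 := by
    have hz0k : qPoch q z₀ k ≠ 0 := fun h => by
      rw [h, zero_mul] at hrev
      exact mul_ne_zero (mul_ne_zero hAk hRr) hAr hrev.symm
    have hAA : (-A) ^ k * (-A⁻¹) ^ k = 1 := by
      rw [← mul_pow, neg_mul_neg, mul_inv_cancel₀ hA0, one_pow]
    field_simp
    linear_combination (-(-A) ^ k) * hrev - (q ^ r.choose 2 * qPoch q (A * q ^ r) k) * hAA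
  have hCC : (-A) ^ k = (-C) ^ k * (A / C) ^ k := by
    rw [← mul_pow]; congr 1; field_simp
  rw [dualWeight, hp0, coeff_wellPoly, hE, hQ, dualTerm, dualRatio, prod_div_distrib, hh,
    add_comm k r, qPoch_add, prod_mul_distrib, mul_inv]
  rw [add_comm k r, hCC] at hinv
  simp only [mul_pow, pow_add]
  linear_combination ((qPoch q A r * (z₀ ^ r * (A / C) ^ r * (∏ i, B i) ^ r) / qPoch q q r *
    z₀ ^ k * (∏ i, B i) ^ k * (∏ i, qPoch q (x i) k) * homPoch q (-(A / C)) (-1) k / qPoch q q k *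
    (∏ i, qPoch q (B i * x i) k)⁻¹)) * (q ^ r.choose 2 * qPoch q (A * q ^ r) k * (qPoch q z₀ k)⁻¹ *
    hpow + hinv)

theorem term₁_eq (q A : ℂ) (B : Fin M → ℂ) (C : ℂ) (x : Fin M → ℂ) (l : Fin M → ℕ) :
    term₁ q A B C x l = q ^ (len l).choose 2 * (qPoch q A (len l) / qPoch q C (len l)) *
      (baseCoeff q B x l *
        ((∏ i, ((1 - A * (B i * x i) * q ^ (len l + l i) / q) / (1 - A * (B i * x i) / q) *
          (qPoch q (A * (B i * x i) / q) (len l) / qPoch q (A * x i) (len l)))) *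
        ∏ i, (qPoch q (A / C * (B i * x i)) (l i) *
          ((B i * x i * (C / ∏ j, B j)) ^ l i * q ^ (l i).choose 2)))) := by
  rw [term₁, baseCoeff, mul_assoc (vandRatio q B x l), ← prod_mul_distrib, ← prod_mul_distrib,
    mul_right_comm (q ^ _), mul_assoc _ (vandRatio q B x l)]
  congr 2
  refine prod_congr rfl fun i _ => ?_
  rw [show A / C * (B i * x i) = A * B i * x i / C by ring,
    show A * (B i * x i) = A * B i * x i by ring,
    show B i * x i * (C / ∏ j, B j) = B i * C * x i / ∏ j, B j by ring]
  simp only [div_eq_mul_inv, mul_inv]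
  ring

/-- The interaction of z₀ with one variable z_i = b x. Reversal removes the powers q^{-N}, and the
difference z₀ q^r - b x q^l is the source of the very-well-poised factor 1 - A b x q^{n+l}/q. -/
theorem wellFactor_eq {q : ℂ} (hq0 : q ≠ 0) (hq1 : ‖q‖ < 1) {A b x : ℂ} (hA0 : A ≠ 0)
    (hx0 : x ≠ 0) (hb0 : b ≠ 0) (hAx : ‖A * x‖ < 1) (hAz : ‖A * (b * x)‖ < ‖q‖) (n r l : ℕ)
    {z₀ : ℂ} (hz₀ : z₀ = q / (A * q ^ (n + r))) :
    (z₀ * q ^ r - b * x * q ^ l) / (z₀ - b * x) *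
        (qPoch q (q * z₀ / (b * x)) r * qPoch q (q * (b * x) / z₀) l)⁻¹ * qPoch q (z₀ / x) r
      = b ^ r * (qPoch q (A * x) (n + r) / qPoch q (A * (b * x)) (n + r + l) *
        ((1 - A * (b * x) * q ^ (n + l) / q) / (1 - A * (b * x) / q) *
          (qPoch q (A * (b * x) / q) n / qPoch q (A * x) n))) := by
  set u := A * (b * x) with hu
  have hu0 : u ≠ 0 := mul_ne_zero hA0 (mul_ne_zero hb0 hx0)
  have huq : ‖u / q‖ < 1 := by
    rw [norm_div]; exact (div_lt_one (norm_pos_iff.2 hq0)).2 hAz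
  have hne : ∀ {c : ℂ}, ‖c‖ < 1 → ∀ m, c * q ^ m ≠ 1 := fun hc m h => by
    have := norm_mul_pow_lt_one hq1 hc m
    rw [h, norm_one] at this
    exact lt_irrefl _ this
  have hqN : q ^ (n + r) ≠ 0 := pow_ne_zero _ hq0
  have h1 := qPoch_reverse hq0 (inv_ne_zero (mul_ne_zero hA0 hx0)) n r
  rw [show q * (A * x)⁻¹ / q ^ (n + r) = z₀ / x by rw [hz₀]; field_simp, div_inv_eq_mul] at h1
  have h2 := qPoch_reverse hq0 (div_ne_zero hq0 hu0) n r
  rw [show q * (q / u) / q ^ (n + r) = q * z₀ / (b * x) by rw [hz₀, hu]; field_simp,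
    show q ^ n / (q / u) = u / q * q ^ n by field_simp] at h2
  have h3 : q * (b * x) / z₀ = u / q * q ^ (n + r + 1) := by rw [hz₀, hu, pow_succ]; field_simp
  -- Three factorials and the single factor 1 - (u/q) q^{n+r} between them join into one factorial
  -- based at u/q.
  have h4 : qPoch q (u / q) n * (qPoch q (u / q * q ^ n) r * ((1 - u / q * q ^ (n + r)) *
      qPoch q (u / q * q ^ (n + r + 1)) l)) = (1 - u / q) * qPoch q u (n + r + l) := by
    have e1 : qPoch q (u / q) (n + r + 1 + l) = (1 - u / q) * qPoch q u (n + r + l) := by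
      rw [show n + r + 1 + l = n + r + l + 1 by ring, qPoch_succ', div_mul_cancel₀ _ hq0]
    rw [← e1, qPoch_add q _ (n + r + 1), qPoch_succ, qPoch_add]
    ring
  have h5 : qPoch q (A * x) (n + r) = qPoch q (A * x) n * qPoch q (A * x * q ^ n) r :=
    qPoch_add _ _ _ _
  have h6 : (z₀ * q ^ r - b * x * q ^ l) / (z₀ - b * x)
      = q ^ r * (1 - u * q ^ (n + l) / q) / (1 - u / q * q ^ (n + r)) := by
    have e1 : z₀ * q ^ r - b * x * q ^ l = z₀ * (q ^ r * (1 - u * q ^ (n + l) / q)) := by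
      rw [hz₀, hu, pow_add, pow_add]; field_simp
    have e2 : z₀ - b * x = z₀ * (1 - u / q * q ^ (n + r)) := by
      rw [hz₀, hu]; field_simp
    have hz0 : z₀ ≠ 0 := by rw [hz₀]; exact div_ne_zero hq0 (mul_ne_zero hA0 hqN)
    rw [e1, e2, mul_div_mul_left _ _ hz0]
  have n1 : qPoch q (u / q) n ≠ 0 := qPoch_ne_zero fun m _ => hne huq m
  have n2 : qPoch q (u / q * q ^ n) r ≠ 0 := qPoch_ne_zero fun m _ =>
    hne (norm_mul_pow_lt_one hq1 huq n) m
  have n3 : 1 - u / q * q ^ (n + r) ≠ 0 := sub_ne_zero.2 (hne huq _).symm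
  have n4 : qPoch q (u / q * q ^ (n + r + 1)) l ≠ 0 := qPoch_ne_zero fun m _ =>
    hne (norm_mul_pow_lt_one hq1 huq _) m
  have n5 : 1 - u / q ≠ 0 := sub_ne_zero.2 (by simpa using (hne huq 0).symm)
  have n6 : qPoch q (A * x) n ≠ 0 := qPoch_ne_zero fun m _ => hne hAx m
  have n7 : qPoch q u (n + r + l) ≠ 0 := fun h => by
    rw [h, mul_zero] at h4
    exact mul_ne_zero n1 (mul_ne_zero n2 (mul_ne_zero n3 n4)) h4
  have hN : q ^ (n + r).choose 2 ≠ 0 := pow_ne_zero _ hq0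
  have hn : q ^ n.choose 2 ≠ 0 := pow_ne_zero _ hq0
  have n8 : (-(q / u)) ^ r ≠ 0 := pow_ne_zero _ (neg_ne_zero.2 (div_ne_zero hq0 hu0))
  have n9 : qPoch q (q * z₀ / (b * x)) r ≠ 0 := fun h => by
    rw [h, zero_mul] at h2
    exact mul_ne_zero (mul_ne_zero n8 hn) n2 h2.symm
  have h7 : qPoch q (z₀ / x) r / qPoch q (q * z₀ / (b * x)) r * q ^ r
      = b ^ r * qPoch q (A * x * q ^ n) r / qPoch q (u / q * q ^ n) r := by
    have e3 : (-(A * x)⁻¹) ^ r * q ^ r = b ^ r * (-(q / u)) ^ r := by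
      rw [← mul_pow, ← mul_pow]; congr 1; rw [hu]; field_simp
    rw [mul_comm (q ^ n) (A * x)] at h1
    rw [div_mul_eq_mul_div, div_eq_div_iff n9 n2]
    refine mul_right_cancel₀ hN ?_
    linear_combination q ^ r * qPoch q (u / q * q ^ n) r * h1
      - b ^ r * qPoch q (A * x * q ^ n) r * h2
      + q ^ n.choose 2 * qPoch q (A * x * q ^ n) r * qPoch q (u / q * q ^ n) r * e3
  have h8 : qPoch q (u / q) n / ((1 - u / q) * qPoch q u (n + r + l))
      = 1 / (qPoch q (u / q * q ^ n) r * ((1 - u / q * q ^ (n + r)) *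
      qPoch q (u / q * q ^ (n + r + 1)) l)) := by
    rw [← h4]; field_simp
  rw [h3, h6, h5]
  calc _ = (1 - u * q ^ (n + l) / q) / (1 - u / q * q ^ (n + r)) *
        (qPoch q (u / q * q ^ (n + r + 1)) l)⁻¹ *
        (qPoch q (z₀ / x) r / qPoch q (q * z₀ / (b * x)) r * q ^ r) := by
        rw [mul_inv]; ring
    _ = b ^ r * qPoch q (A * x * q ^ n) r * (1 - u * q ^ (n + l) / q) *
        (1 / (qPoch q (u / q * q ^ n) r * ((1 - u / q * q ^ (n + r)) *
      qPoch q (u / q * q ^ (n + r + 1)) l))) := by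
        rw [h7]
        simp only [div_eq_mul_inv, mul_inv, one_mul]
        ring
    _ = _ := by
        rw [← h8]
        generalize qPoch q (A * x) n = a at *
        simp only [div_eq_mul_inv, mul_inv]
        linear_combination (-(b ^ r * qPoch q (A * x * q ^ n) r * (1 - u * q ^ (n + l) * q⁻¹) *
          qPoch q (u * q⁻¹) n * (1 - u * q⁻¹)⁻¹ * (qPoch q u (n + r + l))⁻¹)) * mul_inv_cancel₀ n6

theorem wellTerm_eq {q : ℂ} (hq0 : q ≠ 0) (hq1 : ‖q‖ < 1) {A C : ℂ} (hA0 : A ≠ 0)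
    (hA : ‖A‖ < 1) (hC0 : C ≠ 0) (hC : ∀ n : ℕ, C * q ^ n ≠ 1) {B x : Fin M → ℂ}
    (hx0 : ∀ i, x i ≠ 0) (hB0 : ∀ i, B i ≠ 0) (hAx : ∀ i, ‖A * x i‖ < 1)
    (hAz : ∀ i, ‖A * (B i * x i)‖ < ‖q‖) (l : Fin M → ℕ) (r : ℕ) {z₀ : ℂ}
    (hz₀ : z₀ = q / (A * q ^ (len l + r))) :
    qPoch q A (len l + r) *
        (vandCoeff q (Fin.cons z₀ fun i => B i * x i : Fin (M + 1) → ℂ) (Fin.cons r l) *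
          ∏ i, ∏ m ∈ range ((Fin.cons r l : Fin (M + 1) → ℕ) i),
            ((wellPoly x (A / C)).eval
              ((Fin.cons z₀ fun i => B i * x i : Fin (M + 1) → ℂ) i * q ^ m) /
            (1 - (Fin.cons z₀ fun i => B i * x i : Fin (M + 1) → ℂ) i * q ^ m)))
      = (z₀ * (A / C) * ∏ i, B i) ^ (len l + r) * q ^ (len l + r).choose 2 *
        (qPoch q C (len l + r) * (∏ i, qPoch q (A * x i) (len l + r)) * term₁ q A B C x l *
          ((qPoch q q r)⁻¹ * ∏ i, (qPoch q (A * (B i * x i)) (len l + r + l i))⁻¹)) := by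
  set n := len l with hn
  have hB : ∏ j, B j ≠ 0 := prod_ne_zero_iff.2 fun j _ => hB0 j
  have hqN : q ^ (n + r) ≠ 0 := pow_ne_zero _ hq0
  have hz0 : z₀ ≠ 0 := by rw [hz₀]; exact div_ne_zero hq0 (mul_ne_zero hA0 hqN)
  have hRN : q ^ (n + r).choose 2 ≠ 0 := pow_ne_zero _ hq0
  have hRn : q ^ n.choose 2 ≠ 0 := pow_ne_zero _ hq0
  have hAn : qPoch q (A * q ^ n) r ≠ 0 := qPoch_ne_zero fun m _ h => by
    have := norm_mul_pow_lt_one hq1 (norm_mul_pow_lt_one hq1 hA n) m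
    rw [h, norm_one] at this
    exact lt_irrefl _ this
  have hCn : qPoch q C n ≠ 0 := qPoch_ne_zero fun m _ => hC m
  have h1 := qPoch_reverse hq0 (inv_ne_zero hC0) n r
  rw [show q * C⁻¹ / q ^ (n + r) = A / C * z₀ by rw [hz₀]; field_simp, div_inv_eq_mul,
    mul_comm (q ^ n) C] at h1
  have h2 := qPoch_reverse hq0 (inv_ne_zero hA0) n r
  rw [show q * A⁻¹ / q ^ (n + r) = z₀ by rw [hz₀]; field_simp, div_inv_eq_mul,
    mul_comm (q ^ n) A] at h2
  have hz0r : qPoch q z₀ r ≠ 0 := fun h => by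
    rw [h, zero_mul] at h2
    exact mul_ne_zero (mul_ne_zero (pow_ne_zero _ (neg_ne_zero.2 (inv_ne_zero hA0))) hRn) hAn
      h2.symm
  have h3 : qPoch q A (n + r) * (qPoch q (A / C * z₀) r / qPoch q z₀ r)
      = (A / C) ^ r * (qPoch q C (n + r) * (qPoch q A n / qPoch q C n)) := by
    have e : (-C⁻¹) ^ r = (A / C) ^ r * (-A⁻¹) ^ r := by
      rw [← mul_pow]; congr 1; field_simp
    have h4 : qPoch q (A / C * z₀) r * qPoch q (A * q ^ n) r
        = (A / C) ^ r * qPoch q (C * q ^ n) r * qPoch q z₀ r := by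
      refine mul_right_cancel₀ hRN ?_
      linear_combination qPoch q (A * q ^ n) r * h1 - (A / C) ^ r * qPoch q (C * q ^ n) r * h2 +
        q ^ n.choose 2 * qPoch q (C * q ^ n) r * qPoch q (A * q ^ n) r * e
    rw [qPoch_add q A, qPoch_add q C]
    generalize qPoch q (A / C * z₀) r = y at *
    generalize qPoch q (A * q ^ n) r = y₁ at *
    generalize qPoch q (C * q ^ n) r = y₂ at *
    generalize (A / C) ^ r = y₃ at *
    field_simp
    linear_combination qPoch q A n * h4
  have h5 : (∏ i, ((z₀ * q ^ r - B i * x i * q ^ l i) / (z₀ - B i * x i) *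
        (qPoch q (q * z₀ / (B i * x i)) r * qPoch q (q * (B i * x i) / z₀) (l i))⁻¹)) *
        ∏ i, qPoch q (z₀ / x i) r
      = (∏ i, B i) ^ r * ((∏ i, qPoch q (A * x i) (n + r)) *
        (∏ i, (qPoch q (A * (B i * x i)) (n + r + l i))⁻¹) *
        ∏ i, ((1 - A * (B i * x i) * q ^ (n + l i) / q) / (1 - A * (B i * x i) / q) *
          (qPoch q (A * (B i * x i) / q) n / qPoch q (A * x i) n))) := by
    rw [← prod_mul_distrib, ← prod_mul_distrib, ← prod_pow, ← prod_mul_distrib, ← prod_mul_distrib]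
    refine prod_congr rfl fun i _ => ?_
    rw [wellFactor_eq hq0 hq1 hA0 (hx0 i) (hB0 i) (hAx i) (hAz i) n r (l i) hz₀]
    ring
  have h6 : ∏ i, ((B i * x i * (C / ∏ j, B j)) ^ l i * q ^ (l i).choose 2)
      = (C / ∏ j, B j) ^ n * ∏ i, ((B i * x i) ^ l i * q ^ (l i).choose 2) := by
    rw [hn, len, ← prod_pow_eq_pow_sum, ← prod_mul_distrib]
    refine prod_congr rfl fun i _ => ?_
    rw [mul_pow]; ring
  -- Bookkeeping of powers: z₀ (A/C) B times C/B is q^{1-n-r}, and the remaining exponents of q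
  -- balance by `e3`.
  have h7 : (z₀ * (A / C) * ∏ i, B i) ^ (n + r) * q ^ (n + r).choose 2 *
      (q ^ n.choose 2 * (C / ∏ j, B j) ^ n)
      = (z₀ * (A / C) * ∏ i, B i) ^ r * q ^ r.choose 2 := by
    have e1 : (z₀ * (A / C) * ∏ i, B i) * (C / ∏ j, B j) * q ^ (n + r) = q := by
      rw [hz₀]; field_simp
    have e2 : (z₀ * (A / C) * ∏ i, B i) ^ n * (C / ∏ j, B j) ^ n * q ^ ((n + r) * n) = q ^ n := by
      rw [pow_mul, ← mul_pow, ← mul_pow, e1]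
    have e3 : (n + r).choose 2 + n.choose 2 + n = r.choose 2 + (n + r) * n := by
      have c1 : ∀ m : ℕ, m.choose 2 * 2 + m = m * m := fun m => by
        induction m with
        | zero => rfl
        | succ m ih =>
          rw [Nat.choose_succ_succ' m 1, Nat.choose_one_right]
          nlinarith
      have := c1 (n + r); have := c1 n; have := c1 r
      nlinarith
    refine mul_right_cancel₀ (pow_ne_zero ((n + r) * n) hq0) ?_
    have e4 : q ^ (n + r).choose 2 * q ^ n.choose 2 * q ^ n = q ^ r.choose 2 * q ^ ((n + r) * n) := by
      rw [← pow_add, ← pow_add, ← pow_add, e3]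
    rw [pow_add (z₀ * (A / C) * ∏ i, B i)]
    linear_combination (z₀ * (A / C) * ∏ i, B i) ^ r * q ^ (n + r).choose 2 * q ^ n.choose 2 * e2
      + (z₀ * (A / C) * ∏ i, B i) ^ r * e4
  have h8 : ∏ i, ∏ m ∈ range (l i), ((wellPoly x (A / C)).eval (B i * x i * q ^ m) /
      (1 - B i * x i * q ^ m))
      = (∏ i, ((∏ j, qPoch q (B i * x i / x j) (l i)) / qPoch q (B i * x i) (l i))) *
        ((∏ i, ((B i * x i) ^ l i * q ^ (l i).choose 2)) *
        ∏ i, qPoch q (A / C * (B i * x i)) (l i)) := by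
    rw [← prod_mul_distrib, ← prod_mul_distrib]
    refine prod_congr rfl fun i _ => ?_
    rw [prod_range_wellPoly]
    ring
  rw [vandCoeff_cons hz0, Fin.prod_univ_succ]
  simp only [Fin.cons_zero, Fin.cons_succ]
  rw [h8, prod_range_wellPoly, term₁_eq, baseCoeff_eq, ← hn, prod_mul_distrib (s := univ)
    (f := fun i => qPoch q (A / C * (B i * x i)) (l i)), h6]
  generalize vandCoeff q (fun i => B i * x i) l = V
  generalize ∏ i, ((∏ j, qPoch q (B i * x i / x j) (l i)) / qPoch q (B i * x i) (l i)) = W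
  generalize ∏ i, qPoch q (A / C * (B i * x i)) (l i) = W₂
  generalize ∏ i, ((B i * x i) ^ l i * q ^ (l i).choose 2) = W₃
  calc _ = V * W * W₂ * W₃ * (qPoch q q r)⁻¹ * z₀ ^ r * q ^ r.choose 2 *
        (qPoch q A (n + r) * (qPoch q (A / C * z₀) r / qPoch q z₀ r)) *
        ((∏ i, ((z₀ * q ^ r - B i * x i * q ^ l i) / (z₀ - B i * x i) *
          (qPoch q (q * z₀ / (B i * x i)) r * qPoch q (q * (B i * x i) / z₀) (l i))⁻¹)) *
          ∏ i, qPoch q (z₀ / x i) r) := by ring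
    _ = _ := by
      rw [h3, h5]
      generalize ∏ i, qPoch q (A * x i) (n + r) = X₁ at *
      generalize ∏ i, (qPoch q (A * (B i * x i)) (n + r + l i))⁻¹ = X₂ at *
      generalize ∏ i, ((1 - A * (B i * x i) * q ^ (n + l i) / q) / (1 - A * (B i * x i) / q) *
          (qPoch q (A * (B i * x i) / q) n / qPoch q (A * x i) n)) = X₃ at *
      rw [mul_pow, mul_pow (z₀)] at h7
      rw [mul_pow (z₀ * (A / C)), mul_pow z₀]
      linear_combination (-(V * W * W₂ * W₃ * (qPoch q q r)⁻¹ * X₁ * X₂ * X₃ *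
        qPoch q C (n + r) * (qPoch q A n / qPoch q C n))) * h7

/-- The zeroth coordinate is forced to be N - |l|. Writing the finite sum as a series over all l,
with an index set independent of N, prepares for dominated convergence. -/
theorem sum_antidiagonalTuple_succ (N : ℕ) (g : (Fin (M + 1) → ℕ) → ℂ) :
    ∑ μ ∈ Nat.antidiagonalTuple (M + 1) N, g μ
      = ∑' l : Fin M → ℕ, if len l ≤ N then g (Fin.cons (N - len l) l) else 0 := by
  have hμ : ∀ μ ∈ Nat.antidiagonalTuple (M + 1) N,
      len (Fin.tail μ) ≤ N ∧ Fin.cons (N - len (Fin.tail μ)) (Fin.tail μ) = μ := fun μ h => by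
    rw [Nat.mem_antidiagonalTuple, Fin.sum_univ_succ] at h
    have h' : μ 0 + len (Fin.tail μ) = N := h
    refine ⟨by omega, ?_⟩
    rw [show N - len (Fin.tail μ) = μ 0 by omega, Fin.cons_self_tail]
  rw [tsum_eq_sum (s := (Nat.antidiagonalTuple (M + 1) N).image Fin.tail), sum_image]
  · refine sum_congr rfl fun μ h => ?_
    rw [if_pos (hμ μ h).1, (hμ μ h).2]
  · intro μ h ν h' e
    rw [← (hμ μ h).2, ← (hμ ν h').2]
    rw [e]
  · intro l hl
    refine if_neg fun hle => hl (mem_image.2 ⟨Fin.cons (N - len l) l, ?_, Fin.tail_cons _ _⟩)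
    rw [Nat.mem_antidiagonalTuple, Fin.sum_univ_succ]
    simp only [Fin.cons_zero, Fin.cons_succ]
    exact Nat.sub_add_cancel hle

/-- The duality in the M + 1 variables z₀ = q/(A q^N), B_i x_i, multiplied by (A)_N. Both sides then
carry the same power of z₀ (A/C) B and of q, which cancels. -/
theorem tsum_term₁_truncated {q : ℂ} (hq0 : q ≠ 0) (hq1 : ‖q‖ < 1) {A C : ℂ} (hA0 : A ≠ 0)
    (hA : ‖A‖ < 1) (hC0 : C ≠ 0) (hC : ∀ n : ℕ, C * q ^ n ≠ 1) {B x : Fin M → ℂ}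
    (hx0 : ∀ i, x i ≠ 0) (hB0 : ∀ i, B i ≠ 0)
    (hBx : ∀ i, ∀ n : ℕ, B i * x i * q ^ n ≠ 1)
    (hsep : ∀ i j, i ≠ j → ∀ n : ℕ, B i * x i * q ^ n ≠ B j * x j)
    (hAx : ∀ i, ‖A * x i‖ < 1) (hAz : ∀ i, ‖A * (B i * x i)‖ < ‖q‖) (N : ℕ) :
    ∑' l : Fin M → ℕ, (if len l ≤ N then
        qPoch q C N * (∏ i, qPoch q (A * x i) N) * term₁ q A B C x l *
          ((qPoch q q (N - len l))⁻¹ * ∏ i, (qPoch q (A * (B i * x i)) (N + l i))⁻¹) else 0)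
      = ∑ p ∈ HasAntidiagonal.antidiagonal N,
          dualTerm q A B C x p.1 * (qPoch q A p.2 / qPoch q q p.2) := by
  set z₀ : ℂ := q / (A * q ^ N) with hz₀
  have hB : ∏ j, B j ≠ 0 := prod_ne_zero_iff.2 fun j _ => hB0 j
  have hz0 : z₀ ≠ 0 := div_ne_zero hq0 (mul_ne_zero hA0 (pow_ne_zero _ hq0))
  have hAz' : ∀ i (m : ℕ), A * (B i * x i) * q ^ m ≠ q := fun i m h => by
    have h1 := hAz i
    rw [← h, norm_mul (A * (B i * x i)), norm_pow] at h1
    exact absurd h1 (not_lt.2 (mul_le_of_le_one_right (norm_nonneg _)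
      (pow_le_one₀ (norm_nonneg _) hq1.le)))
  have hz₀A : z₀ * (A * q ^ N) = q := div_mul_cancel₀ _ (mul_ne_zero hA0 (pow_ne_zero _ hq0))
  have core := multiSum_eq hq0 (pow_succ_ne_one_of_norm_lt_one hq1)
    (natDegree_wellPoly_le x (A / C)) N (Fin.cons z₀ fun i => B i * x i : Fin (M + 1) → ℂ) ?_ ?_ ?_
  · rw [multiSum, sum_antidiagonalTuple_succ] at core
    refine mul_left_cancel₀ (mul_ne_zero (pow_ne_zero N (mul_ne_zero (mul_ne_zero hz0
      (div_ne_zero hA0 hC0)) hB)) (pow_ne_zero (N.choose 2) hq0)) ?_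
    rw [← tsum_mul_left, mul_sum]
    have core' := congrArg (fun t => qPoch q A N * t) core
    simp only [← tsum_mul_left, mul_sum] at core'
    refine Eq.trans (tsum_congr fun l => ?_) (core'.trans (sum_congr rfl ?_))
    · by_cases hl : len l ≤ N
      · rw [if_pos hl, if_pos hl]
        obtain ⟨r, rfl⟩ := Nat.exists_eq_add_of_le hl
        rw [Nat.add_sub_cancel_left]
        exact (wellTerm_eq hq0 hq1 hA0 hA hC0 hC hx0 hB0 hAx hAz l r hz₀).symm
      · rw [if_neg hl, if_neg hl, mul_zero, mul_zero]
    · rintro ⟨k, r⟩ hp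
      obtain rfl := HasAntidiagonal.mem_antidiagonal.1 hp
      have := dualWeight_wellPoly hq0 hq1 hA0 hA hC0 (B := B) hx0 k r hz₀
      rw [Fin.prod_univ_succ, Fin.prod_univ_succ]
      simpa only [Fin.cons_zero, Fin.cons_succ] using this
  · intro i
    refine Fin.cases ?_ (fun j => ?_) i
    · simpa using hz0
    · simpa using ⟨hB0 j, hx0 j⟩
  -- If z₀ q^m = 1 with m < N, then A q^{N-m-1} = 1, contradicting |A| < 1.
  · intro i m hm
    refine Fin.cases ?_ (fun j => ?_) i
    · intro h
      simp only [Fin.cons_zero] at h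
      obtain ⟨s, rfl⟩ := Nat.exists_eq_add_of_lt hm
      have h1 : A * q ^ s = 1 := by
        refine mul_left_cancel₀ (pow_ne_zero (m + 1) hq0) ?_
        have e : q ^ (m + s + 1) = q ^ (m + 1) * q ^ s := by rw [← pow_add]; congr 1; ring
        have e' : q ^ (m + 1) = q * q ^ m := pow_succ' q m
        rw [e] at hz₀A
        linear_combination q ^ m * hz₀A - (A * (q ^ (m + 1) * q ^ s)) * h - e'
      have := norm_mul_pow_lt_one hq1 hA s
      rw [h1, norm_one] at this
      exact lt_irrefl _ this
    · simpa using hBx j m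
  -- A coincidence between z₀ and some B_i x_i, up to the allowed power of q, would give A B_i x_i
  -- q^s = q for some s ≥ 0, against |A B_i x_i| < |q|.
  · intro i j hij m hm
    revert hij
    refine Fin.cases ?_ (fun a => ?_) i <;> refine Fin.cases ?_ (fun b => ?_) j
    · intro h; exact absurd rfl h
    · intro _ h
      simp only [Fin.cons_zero, Fin.cons_succ] at h
      obtain ⟨s, rfl⟩ := Nat.exists_eq_add_of_le hm
      refine hAz' b s ?_
      refine mul_left_cancel₀ (pow_ne_zero m hq0) ?_
      rw [pow_add] at hz₀A
      linear_combination q ^ m * hz₀A - A * q ^ m * q ^ s * h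
    · intro _ h
      simp only [Fin.cons_zero, Fin.cons_succ] at h
      refine hAz' a (m + N) ?_
      rw [pow_add]
      linear_combination A * q ^ N * h + hz₀A
    · intro hij
      simpa using hsep a b (fun e => hij (by rw [e])) m

/-! ### The first formula: the limit in N and continuation in A -/

/-- Tannery's theorem: for fixed k the factor e(N - k) tends to L, and a bound for e makes a
multiple of ‖f k‖ a majorant. -/
theorem tendsto_sum_antidiagonal {f e : ℕ → ℂ} (hf : Summable fun k => ‖f k‖) {L : ℂ}
    (he : Tendsto e atTop (𝓝 L)) :
    Tendsto (fun N => ∑ p ∈ HasAntidiagonal.antidiagonal N, f p.1 * e p.2) atTop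
      (𝓝 ((∑' k, f k) * L)) := by
  obtain ⟨K, hK⟩ := (Metric.isBounded_range_of_tendsto _ he).exists_norm_le
  have h1 : ∀ N, ∑ p ∈ HasAntidiagonal.antidiagonal N, f p.1 * e p.2
      = ∑' k, if k ≤ N then f k * e (N - k) else 0 := fun N => by
    rw [Nat.sum_antidiagonal_eq_sum_range_succ (fun k r => f k * e r), tsum_eq_sum
      (s := range (N + 1))]
    · exact sum_congr rfl fun k hk => (if_pos (by rw [mem_range] at hk; omega)).symm
    · exact fun k hk => if_neg (by rw [mem_range] at hk; omega)
  simp only [h1, ← tsum_mul_right]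
  refine tendsto_tsum_of_dominated_convergence (hf.mul_right K) (fun k => ?_)
    (Eventually.of_forall fun N k => ?_)
  · refine ((he.comp (tendsto_sub_atTop_nat k)).const_mul (f k)).congr' ?_
    filter_upwards [eventually_ge_atTop k] with N hN
    rw [if_pos hN]; rfl
  · split_ifs
    · rw [norm_mul]
      exact mul_le_mul_of_nonneg_left (hK _ ⟨_, rfl⟩) (norm_nonneg _)
    · rw [norm_zero]
      exact mul_nonneg (norm_nonneg _) ((norm_nonneg _).trans (hK _ ⟨0, rfl⟩))

/-- The summand of the first multiple series, multiplied by its denominators in `A`. -/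
def entireTerm₁ (q A : ℂ) (B : Fin M → ℂ) (C : ℂ) (x : Fin M → ℂ) (l : Fin M → ℕ) : ℂ :=
  q ^ (len l).choose 2 * (qPoch q A (len l) / qPoch q C (len l)) *
      (baseCoeff q B x l *
        ((∏ i, ((1 - A * (B i * x i) * q ^ (len l + l i) / q) *
          (qPoch q (A * (B i * x i) / q) (len l) * qInf q (A * (x i * q ^ len l))))) *
        ∏ i, (qPoch q (A / C * (B i * x i)) (l i) *
          ((B i * x i * (C / ∏ j, B j)) ^ l i * q ^ (l i).choose 2))))

theorem term₁_mul_eq {q : ℂ} (hq1 : ‖q‖ < 1) {A : ℂ} (B : Fin M → ℂ) (C : ℂ)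
    {x : Fin M → ℂ} (hAx : ∀ i, ∀ n : ℕ, A * x i * q ^ n ≠ 1)
    (hAz : ∀ i, 1 - A * (B i * x i) / q ≠ 0) (l : Fin M → ℕ) :
    term₁ q A B C x l * ∏ i, ((1 - A * (B i * x i) / q) * qInf q (A * x i))
      = entireTerm₁ q A B C x l := by
  have h : (∏ i, ((1 - A * (B i * x i) * q ^ (len l + l i) / q) / (1 - A * (B i * x i) / q) *
          (qPoch q (A * (B i * x i) / q) (len l) / qPoch q (A * x i) (len l)))) *
        ∏ i, ((1 - A * (B i * x i) / q) * qInf q (A * x i))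
      = ∏ i, ((1 - A * (B i * x i) * q ^ (len l + l i) / q) *
          (qPoch q (A * (B i * x i) / q) (len l) * qInf q (A * (x i * q ^ len l)))) := by
    rw [← prod_mul_distrib]
    refine prod_congr rfl fun i _ => ?_
    have h1 := hAz i
    have h2 : qPoch q (A * x i) (len l) ≠ 0 := qPoch_ne_zero fun m _ => hAx i m
    rw [qInf_eq_mul hq1 (A * x i) (len l), ← mul_assoc A (x i) (q ^ len l)]
    generalize qInf q (A * x i * q ^ len l) = y
    generalize qPoch q (A * x i) (len l) = y₁ at *
    generalize 1 - A * (B i * x i) / q = y₂ at *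
    field_simp
  rw [term₁_eq, entireTerm₁, ← h]
  ring

/-- The factors q^{l_i(l_i-1)/2} suffice for convergence; q^{|l|(|l|-1)/2} is merely bounded by 1.
All the rest is bounded uniformly for ‖A‖ ≤ R, including the infinite products. -/
theorem exists_summable_entireTerm₁ {q : ℂ} (hq1 : ‖q‖ < 1) {B x : Fin M → ℂ}
    (hx0 : ∀ i, x i ≠ 0) (hB0 : ∀ i, B i ≠ 0)
    (hBx : ∀ i, ∀ n : ℕ, B i * x i * q ^ n ≠ 1)
    (hsep : ∀ i j, i ≠ j → ∀ n : ℕ, B i * x i * q ^ n ≠ B j * x j) {C : ℂ}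
    (hC : ∀ n : ℕ, C * q ^ n ≠ 1) (R : ℝ) :
    ∃ u : (Fin M → ℕ) → ℝ, Summable u ∧
      ∀ A : ℂ, ‖A‖ ≤ R → ∀ l, ‖entireTerm₁ q A B C x l‖ ≤ u l := by
  obtain ⟨K, hK⟩ := exists_norm_baseCoeff_le hq1 hx0 hB0 hBx hsep
  obtain ⟨K', hK'⟩ := exists_norm_inv_qPoch_le hq1 hC
  have hK0 : 0 ≤ K := (norm_nonneg _).trans (hK 0)
  have hK'0 : 0 ≤ K' := (norm_nonneg _).trans (hK' 0)
  set E : ℝ → ℝ := fun t => Real.exp (t / (1 - ‖q‖)) with hE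
  have hE0 : ∀ t, 0 ≤ E t := fun t => Real.exp_nonneg _
  have hs := (summable_and_tsum_pi_prod M (fun i n => E (R / ‖C‖ * ‖B i * x i‖) *
    (‖B i * x i * (C / ∏ j, B j)‖ ^ n * ‖q‖ ^ n.choose 2)) fun i =>
      ((summable_pow_mul_pow_choose (norm_nonneg q) hq1 _).mul_left _).norm).1
  refine ⟨fun l => 1 * (E R * K') * (K * ((∏ i, ((1 + R * ‖B i * x i‖ / ‖q‖) *
    (E (R * ‖B i * x i‖ / ‖q‖) * E (R * ‖x i‖)))) *
      ‖∏ i, (E (R / ‖C‖ * ‖B i * x i‖) *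
        (‖B i * x i * (C / ∏ j, B j)‖ ^ l i * ‖q‖ ^ (l i).choose 2))‖)),
    ((hs.mul_left _).mul_left _).mul_left _, fun A hA l => ?_⟩
  have hR : 0 ≤ R := (norm_nonneg A).trans hA
  have hqn : ∀ (c : ℂ) (n : ℕ), ‖c * q ^ n‖ ≤ ‖c‖ := fun c n => by
    rw [norm_mul, norm_pow]
    exact mul_le_of_le_one_right (norm_nonneg _) (pow_le_one₀ (norm_nonneg _) hq1.le)
  have hAc : ∀ c : ℂ, ‖A * c‖ ≤ R * ‖c‖ := fun c => by rw [norm_mul]; gcongr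
  have b1 : ‖q ^ (len l).choose 2‖ ≤ 1 := by
    rw [norm_pow]; exact pow_le_one₀ (norm_nonneg _) hq1.le
  have b2 : ‖qPoch q A (len l) / qPoch q C (len l)‖ ≤ E R * K' := by
    rw [div_eq_mul_inv, norm_mul]
    exact mul_le_mul (norm_qPoch_le hq1 hA _) (hK' _) (norm_nonneg _) (hE0 _)
  have b3 : ‖∏ i, ((1 - A * (B i * x i) * q ^ (len l + l i) / q) *
          (qPoch q (A * (B i * x i) / q) (len l) * qInf q (A * (x i * q ^ len l))))‖ ≤
      ∏ i, ((1 + R * ‖B i * x i‖ / ‖q‖) * (E (R * ‖B i * x i‖ / ‖q‖) * E (R * ‖x i‖))) := by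
    rw [norm_prod]
    refine prod_le_prod (fun _ _ => norm_nonneg _) fun i _ => ?_
    rw [norm_mul, norm_mul]
    refine mul_le_mul ?_ (mul_le_mul (norm_qPoch_le hq1 ?_ _) (norm_qInf_le hq1 ?_)
      (norm_nonneg _) (hE0 _)) (by positivity) (by positivity)
    · refine (norm_sub_le _ _).trans ?_
      rw [norm_one, norm_div]
      gcongr
      exact (hqn _ _).trans (hAc _)
    · rw [norm_div]; gcongr; exact hAc _
    · exact (hAc _).trans (mul_le_mul_of_nonneg_left (hqn _ _) hR)
  have b4 : ‖∏ i, (qPoch q (A / C * (B i * x i)) (l i) *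
          ((B i * x i * (C / ∏ j, B j)) ^ l i * q ^ (l i).choose 2))‖ ≤
      ‖∏ i, (E (R / ‖C‖ * ‖B i * x i‖) *
        (‖B i * x i * (C / ∏ j, B j)‖ ^ l i * ‖q‖ ^ (l i).choose 2))‖ := by
    rw [norm_prod, norm_prod]
    refine prod_le_prod (fun _ _ => norm_nonneg _) fun i _ => ?_
    rw [Real.norm_of_nonneg (mul_nonneg (hE0 _) (by positivity)), norm_mul, norm_mul, norm_pow,
      norm_pow]
    refine mul_le_mul_of_nonneg_right (norm_qPoch_le hq1 ?_ _) (by positivity)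
    rw [norm_mul, norm_div]
    gcongr
  rw [entireTerm₁, norm_mul, norm_mul, norm_mul (baseCoeff q B x l), norm_mul (∏ i, _)]
  exact mul_le_mul (mul_le_mul b1 b2 (norm_nonneg _) zero_le_one)
    (mul_le_mul (hK l) (mul_le_mul b3 b4 (norm_nonneg _) ((norm_nonneg _).trans b3))
      (by positivity) hK0) (by positivity) (mul_nonneg zero_le_one (mul_nonneg (hE0 _) hK'0))

/-- Euler's expansion, the case a = 0 of the q-binomial theorem, writes (b)_∞ as a locally uniformly
convergent series of polynomials in b. -/
theorem differentiable_qInf {q : ℂ} (hq1 : ‖q‖ < 1) : Differentiable ℂ (qInf q) := by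
  have h : qInf q = fun b => ∑' k, homPoch q 0 b k / qPoch q q k := by
    funext b
    rw [tsum_homPoch_div hq1 (by simp) b]
    simp [qInf]
  rw [h]
  refine differentiable_tsum_of_locally_bounded (fun k => ?_) fun R => ?_
  · unfold homPoch; fun_prop
  · obtain ⟨K, hK⟩ := exists_norm_inv_qPoch_le hq1 (self_mul_pow_ne_one hq1)
    refine ⟨fun k => R ^ k * ‖q‖ ^ k.choose 2 * K,
      (summable_pow_mul_pow_choose (norm_nonneg q) hq1 R).mul_right K, fun b hb k => ?_⟩
    rw [homPoch_zero_left, div_eq_mul_inv, norm_mul, norm_mul, norm_pow, norm_pow, norm_neg]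
    have hR := (norm_nonneg b).trans hb
    exact mul_le_mul (by gcongr) (hK k) (norm_nonneg _) (by positivity)

/-- Let N → ∞ in `tsum_term₁_truncated`. The left side converges under a multiple of ‖`term₁`‖, the
right side by `tendsto_sum_antidiagonal`; the common factor 1/(q)_∞ cancels. -/
theorem tsum_term₁_of_norm_lt {q : ℂ} (hq0 : q ≠ 0) (hq1 : ‖q‖ < 1) {A C : ℂ} (hA0 : A ≠ 0)
    (hA : ‖A‖ < 1) (hC0 : C ≠ 0) (hC : ∀ n : ℕ, C * q ^ n ≠ 1) {B x : Fin M → ℂ}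
    (hx0 : ∀ i, x i ≠ 0) (hB0 : ∀ i, B i ≠ 0)
    (hBx : ∀ i, ∀ n : ℕ, B i * x i * q ^ n ≠ 1)
    (hsep : ∀ i j, i ≠ j → ∀ n : ℕ, B i * x i * q ^ n ≠ B j * x j)
    (hAx : ∀ i, ‖A * x i‖ < 1) (hAz : ∀ i, ‖A * (B i * x i)‖ < ‖q‖)
    (hs : Summable (term₁ q A B C x)) :
    qInf q C * (∏ i, qInf q (A * x i)) * (∏ i, (qInf q (A * (B i * x i)))⁻¹) *
        ∑' l, term₁ q A B C x l = qInf q A * ∑' k, dualTerm q A B C x k := by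
  have hqq : qInf q q ≠ 0 := qInf_ne_zero hq1 (self_mul_pow_ne_one hq1)
  have hAz1 : ∀ i, ∀ n : ℕ, A * (B i * x i) * q ^ n ≠ 1 := fun i n h => by
    have := norm_mul_pow_lt_one hq1 ((hAz i).trans hq1) n
    rw [h, norm_one] at this
    exact lt_irrefl _ this
  have hR := tendsto_sum_antidiagonal (summable_dualTerm hq1 hA hBx C)
    ((tendsto_qPoch hq1 A).div (tendsto_qPoch hq1 q) hqq)
  obtain ⟨K, hK⟩ := exists_norm_inv_qPoch_le hq1 (self_mul_pow_ne_one hq1)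
  choose K' hK' using fun i => exists_norm_inv_qPoch_le hq1 (hAz1 i)
  have hK0 : 0 ≤ K := (norm_nonneg _).trans (hK 0)
  have hK'0 : ∀ i, 0 ≤ K' i := fun i => (norm_nonneg _).trans (hK' i 0)
  set D : ℝ := Real.exp (‖C‖ / (1 - ‖q‖)) * ∏ i, Real.exp (‖A * x i‖ / (1 - ‖q‖)) with hD
  have hL : Tendsto (fun N => ∑' l : Fin M → ℕ, (if len l ≤ N then
        qPoch q C N * (∏ i, qPoch q (A * x i) N) * term₁ q A B C x l *
          ((qPoch q q (N - len l))⁻¹ * ∏ i, (qPoch q (A * (B i * x i)) (N + l i))⁻¹) else 0)) atTop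
      (𝓝 (∑' l, qInf q C * (∏ i, qInf q (A * x i)) * term₁ q A B C x l *
        ((qInf q q)⁻¹ * ∏ i, (qInf q (A * (B i * x i)))⁻¹))) := by
    refine tendsto_tsum_of_dominated_convergence
      (bound := fun l => D * ‖term₁ q A B C x l‖ * (K * ∏ i, K' i))
      ((hs.norm.mul_left _).mul_right _) (fun l => ?_) (Eventually.of_forall fun N l => ?_)
    · have h1 : Tendsto (fun N => (qPoch q q (N - len l))⁻¹) atTop (𝓝 (qInf q q)⁻¹) :=
        ((tendsto_qPoch hq1 q).comp (tendsto_sub_atTop_nat (len l))).inv₀ hqq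
      have h2 : Tendsto (fun N => ∏ i, (qPoch q (A * (B i * x i)) (N + l i))⁻¹) atTop
          (𝓝 (∏ i, (qInf q (A * (B i * x i)))⁻¹)) :=
        tendsto_finsetProd _ fun i _ => ((tendsto_qPoch hq1 _).comp
          (tendsto_add_atTop_nat (l i))).inv₀ (qInf_ne_zero hq1 (hAz1 i))
      have h3 : Tendsto (fun N => ∏ i, qPoch q (A * x i) N) atTop (𝓝 (∏ i, qInf q (A * x i))) :=
        tendsto_finsetProd _ fun i _ => tendsto_qPoch hq1 _
      refine ((((tendsto_qPoch hq1 C).mul h3).mul_const _).mul (h1.mul h2)).congr' ?_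
      filter_upwards [eventually_ge_atTop (len l)] with N hN
      rw [if_pos hN]
    · have hb0 : 0 ≤ D * ‖term₁ q A B C x l‖ * (K * ∏ i, K' i) :=
        mul_nonneg (by positivity) (mul_nonneg hK0 (prod_nonneg fun i _ => hK'0 i))
      split_ifs
      · rw [norm_mul, norm_mul, norm_mul, norm_mul, norm_prod, norm_prod]
        refine mul_le_mul (mul_le_mul_of_nonneg_right (mul_le_mul (norm_qPoch_le hq1 le_rfl N)
          (prod_le_prod (fun _ _ => norm_nonneg _) fun i _ => norm_qPoch_le hq1 le_rfl N)
          (by positivity) (Real.exp_nonneg _)) (norm_nonneg _))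
          (mul_le_mul (hK _) (prod_le_prod (fun _ _ => norm_nonneg _) fun i _ => hK' i _)
            (by positivity) hK0) (by positivity) (by positivity)
      · rwa [norm_zero]
  have hN := fun N => tsum_term₁_truncated hq0 hq1 hA0 hA hC0 hC hx0 hB0 hBx hsep hAx hAz N
  have h := tendsto_nhds_unique (hL.congr hN) hR
  rw [tsum_mul_right, tsum_mul_left] at h
  generalize ∑' l, term₁ q A B C x l = S at *
  generalize ∑' k, dualTerm q A B C x k = T at *
  generalize ∏ i, (qInf q (A * (B i * x i)))⁻¹ = Z at *
  generalize ∏ i, qInf q (A * x i) = X at *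
  field_simp at h
  linear_combination h

theorem first_transformation_entire {q : ℂ} (hq0 : q ≠ 0) (hq1 : ‖q‖ < 1) (A : ℂ) {C : ℂ}
    {B x : Fin M → ℂ} (hx : ∀ i, ‖x i‖ < 1) (hx0 : ∀ i, x i ≠ 0) (hB0 : ∀ i, B i ≠ 0)
    (hC : ∀ n : ℕ, C * q ^ n ≠ 1) (hBx : ∀ i, ∀ n : ℕ, B i * x i * q ^ n ≠ 1)
    (hsep : ∀ i j, i ≠ j → ∀ n : ℕ, B i * x i * q ^ n ≠ B j * x j) (hC0 : C ≠ 0) :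
    (∏ i, qInf q (B i * x i) / qInf q (x i)) * (∑' l, entireTerm₁ q A B C x l)
      = phiD q A B C x * ∏ i, ((1 - A * (B i * x i) / q) * qInf q (A * (B i * x i))) := by
  have hqI := differentiable_qInf hq1
  have hF : Differentiable ℂ fun A => ∑' l, entireTerm₁ q A B C x l := by
    refine differentiable_tsum_of_locally_bounded (fun l => ?_)
      (exists_summable_entireTerm₁ hq1 hx0 hB0 hBx hsep hC)
    have : ∀ c, Differentiable ℂ fun a => qInf q (a * c) := fun c =>
      hqI.comp (differentiable_id.mul_const c)
    simp only [entireTerm₁, qPoch]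
    fun_prop
  have hG : Differentiable ℂ fun A => phiD q A B C x *
      ∏ i, ((1 - A * (B i * x i) / q) * qInf q (A * (B i * x i))) := by
    have : ∀ c, Differentiable ℂ fun a => qInf q (a * c) := fun c =>
      hqI.comp (differentiable_id.mul_const c)
    have := differentiable_phiD hq1 B hx hC
    fun_prop
  set S : ℝ := ∑ i, ‖B i * x i‖ with hS
  have hS0 : 0 ≤ S := sum_nonneg fun _ _ => norm_nonneg _
  have hqp : 0 < ‖q‖ := norm_pos_iff.2 hq0
  -- The radius |q|/(1 + S), with S = ∑ |B_i x_i|, forces |A| < 1, |A x_i| < 1 and |A B_i x_i| < |q|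
  -- simultaneously.
  refine congrFun (eq_of_eq_near_zero (hF.const_mul _) hG (ε := ‖q‖ / (1 + S)) (by positivity)
    fun A hA0 hA => ?_) A
  have hA' : ‖A‖ * (1 + S) < ‖q‖ := (lt_div_iff₀ (by positivity)).1 hA
  have hA1 : ‖A‖ < 1 := by nlinarith [norm_nonneg A]
  have hAz : ∀ i, ‖A * (B i * x i)‖ < ‖q‖ := fun i => by
    rw [norm_mul]
    have : ‖B i * x i‖ ≤ S := single_le_sum (f := fun i => ‖B i * x i‖)
      (fun _ _ => norm_nonneg _) (mem_univ i)
    nlinarith [norm_nonneg A]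
  have hAx : ∀ i, ‖A * x i‖ < 1 := fun i => by
    rw [norm_mul]; nlinarith [norm_nonneg A, norm_nonneg (x i), hx i]
  have hne : ∀ {c : ℂ}, ‖c‖ < 1 → ∀ m, c * q ^ m ≠ 1 := fun hc m h => by
    have := norm_mul_pow_lt_one hq1 hc m
    rw [h, norm_one] at this
    exact lt_irrefl _ this
  have hAz1 : ∀ i, 1 - A * (B i * x i) / q ≠ 0 := fun i h => by
    have h1 := hAz i
    have h2 : A * (B i * x i) = q := by field_simp at h; linear_combination -h
    rw [h2] at h1
    exact lt_irrefl _ h1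
  have hmul := term₁_mul_eq hq1 B C (fun i => hne (hAx i)) hAz1
  set P₀ : ℂ := ∏ i, ((1 - A * (B i * x i) / q) * qInf q (A * x i)) with hP₀
  have hP₀0 : P₀ ≠ 0 := prod_ne_zero_iff.2 fun i _ =>
    mul_ne_zero (hAz1 i) (qInf_ne_zero_of_norm_lt_one hq1 (hAx i))
  obtain ⟨u, hu, hb⟩ := exists_summable_entireTerm₁ hq1 hx0 hB0 hBx hsep hC ‖A‖
  have hs : Summable (term₁ q A B C x) :=
    ((hu.of_norm_bounded fun l => hb A le_rfl l).mul_right P₀⁻¹).congr fun l => by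
      rw [← hmul l, mul_assoc, mul_inv_cancel₀ hP₀0, mul_one]
  have key := tsum_term₁_of_norm_lt hq0 hq1 hA0 hA1 hC0 hC hx0 hB0 hBx hsep hAx hAz hs
  have hCne := qInf_ne_zero hq1 hC
  rw [← tsum_congr hmul, tsum_mul_right, phiD_eq_tsum_dualTerm hq1 hA1 hx hBx hC, hP₀,
    prod_mul_distrib, prod_mul_distrib]
  have hz : (∏ i, (qInf q (A * (B i * x i)))⁻¹) * ∏ i, qInf q (A * (B i * x i)) = 1 := by
    rw [← prod_mul_distrib]
    exact prod_eq_one fun i _ => inv_mul_cancel₀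
      (qInf_ne_zero_of_norm_lt_one hq1 ((hAz i).trans hq1))
  generalize ∑' l, term₁ q A B C x l = S₁ at *
  generalize ∑' k, dualTerm q A B C x k = T at *
  generalize (∏ i, qInf q (B i * x i) / qInf q (x i)) = F
  generalize ∏ i, qInf q (A * (B i * x i)) = Z at *
  generalize ∏ i, (qInf q (A * (B i * x i)))⁻¹ = Z' at *
  generalize ∏ i, qInf q (A * x i) = X₁ at *
  generalize ∏ i, (1 - A * (B i * x i) / q) = Y at *
  field_simp
  linear_combination F * Y * Z * key - F * qInf q C * S₁ * X₁ * Y * hz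

end QAppell

end

/-! ### The three formulas together -/

theorem mainTheorem8 (M : ℕ) (q : ℂ) (hq0 : q ≠ 0) (hq1 : ‖q‖ < 1)
    (A C : ℂ) (B x : Fin M → ℂ) (hx : ∀ i, ‖x i‖ < 1)
    -- none of the denominators common to the formulas vanishes
    (hx0 : ∀ i, x i ≠ 0) (hB0 : ∀ i, B i ≠ 0)
    (hC : ∀ n : ℕ, C * q ^ n ≠ 1)
    (hBx : ∀ i, ∀ n : ℕ, B i * x i * q ^ n ≠ 1)
    (hsep : ∀ i j, i ≠ j → ∀ n : ℕ, B i * x i * q ^ n ≠ B j * x j) :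
    Summable (QAppell.phiDTerm q A B C x) ∧
    -- first formula
    (C ≠ 0 → (∀ i, ∀ n : ℕ, A * x i * q ^ n ≠ 1) →
      (∀ i, A * B i * x i ≠ q) → (∀ i, ∀ n : ℕ, A * B i * x i * q ^ n ≠ 1) →
      Summable (QAppell.term₁ q A B C x) ∧
      (∏ i, (QAppell.qInf q (A * x i) * QAppell.qInf q (B i * x i)) /
          (QAppell.qInf q (A * B i * x i) * QAppell.qInf q (x i))) *
        (∑' l : Fin M → ℕ, QAppell.term₁ q A B C x l) = QAppell.phiD q A B C x) ∧
    -- second formula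
    (C ≠ 0 → ‖C / ∏ j, B j‖ < 1 →
      Summable (QAppell.term₂ q A B C x) ∧
      QAppell.qInf q (C / ∏ j, B j) / QAppell.qInf q C *
        (∏ i, QAppell.qInf q (B i * x i) / QAppell.qInf q (x i)) *
        (∑' l : Fin M → ℕ, QAppell.term₂ q A B C x l) = QAppell.phiD q A B C x) ∧
    -- third formula
    (A ≠ 0 →
      Summable (QAppell.term₃ q A B C x) ∧
      (∏ i, QAppell.qInf q (B i * x i) / QAppell.qInf q (x i)) *
        (∑' l : Fin M → ℕ, QAppell.term₃ q A B C x l) = QAppell.phiD q A B C x) := by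
  have hne : ∀ {c : ℂ}, ‖c‖ < 1 → QAppell.qInf q c ≠ 0 :=
    fun hc => QAppell.qInf_ne_zero_of_norm_lt_one hq1 hc
  refine ⟨?_, fun hC0 hAx hABx hABxn => ?_, fun hC0 hCB => ?_, fun hA0 => ?_⟩
  · obtain ⟨u, hu, hb⟩ := QAppell.exists_summable_phiDTerm hq1 B hx hC ‖A‖
    exact hu.of_norm_bounded fun l => hb A le_rfl l
  · have hAz : ∀ i, 1 - A * (B i * x i) / q ≠ 0 := fun i h => hABx i (by
      field_simp at h; linear_combination -h)
    have hAxne : ∀ i, QAppell.qInf q (A * x i) ≠ 0 := fun i => QAppell.qInf_ne_zero hq1 (hAx i)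
    have hABne : ∀ i, QAppell.qInf q (A * B i * x i) ≠ 0 :=
      fun i => QAppell.qInf_ne_zero hq1 (hABxn i)
    have hmul := QAppell.term₁_mul_eq hq1 B C hAx hAz
    have hP : ∏ i, ((1 - A * (B i * x i) / q) * QAppell.qInf q (A * x i)) ≠ 0 :=
      Finset.prod_ne_zero_iff.2 fun i _ => mul_ne_zero (hAz i) (hAxne i)
    obtain ⟨u, hu, hb⟩ := QAppell.exists_summable_entireTerm₁ hq1 hx0 hB0 hBx hsep hC ‖A‖
    refine ⟨((hu.of_norm_bounded fun l => hb A le_rfl l).mul_right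
      (∏ i, ((1 - A * (B i * x i) / q) * QAppell.qInf q (A * x i)))⁻¹).congr fun l => by
        rw [← hmul l, mul_assoc, mul_inv_cancel₀ hP, mul_one], ?_⟩
    have h := QAppell.first_transformation_entire hq0 hq1 A hx hx0 hB0 hC hBx hsep hC0
    rw [← tsum_congr hmul, tsum_mul_right] at h
    have hQ : ∏ i, ((1 - A * (B i * x i) / q) * QAppell.qInf q (A * (B i * x i))) ≠ 0 :=
      Finset.prod_ne_zero_iff.2 fun i _ => mul_ne_zero (hAz i) (by
        rw [← mul_assoc]; exact hABne i)
    -- Undoing the clearing of denominators: 1 - A B_i x_i/q occurs on both sides, and (A B_i x_i)_∞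
    -- cancels against the prefactor.
    have e : (∏ i, (QAppell.qInf q (A * x i) * QAppell.qInf q (B i * x i)) /
          (QAppell.qInf q (A * B i * x i) * QAppell.qInf q (x i))) *
          ∏ i, ((1 - A * (B i * x i) / q) * QAppell.qInf q (A * (B i * x i)))
        = (∏ i, QAppell.qInf q (B i * x i) / QAppell.qInf q (x i)) *
          ∏ i, ((1 - A * (B i * x i) / q) * QAppell.qInf q (A * x i)) := by
      rw [← Finset.prod_mul_distrib, ← Finset.prod_mul_distrib]
      refine Finset.prod_congr rfl fun i _ => ?_
      have h1 := hABne i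
      have h2 := hne (hx i)
      rw [← mul_assoc A (B i) (x i)]
      generalize 1 - A * B i * x i / q = y
      generalize QAppell.qInf q (A * B i * x i) = a at *
      generalize QAppell.qInf q (x i) = b at *
      field_simp
    refine mul_right_cancel₀ hQ ?_
    rw [← h]
    linear_combination (∑' l, QAppell.term₁ q A B C x l) * e
  · obtain ⟨u, hu, hb⟩ := QAppell.exists_summable_term₂ hq1 hx0 hB0 hBx hsep hCB ‖A‖
    exact ⟨hu.of_norm_bounded fun l => hb A le_rfl l,
      QAppell.second_transformation hq0 hq1 A hx hx0 hB0 hC hBx hsep hC0 hCB⟩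
  · obtain ⟨u, hu, hb⟩ := QAppell.exists_summable_polyTerm₃ hq1 hx0 hB0 hBx hsep hC ‖A‖
    have e := QAppell.term₃_eq hA0 q B C x
    refine ⟨(hu.of_norm_bounded fun l => hb A le_rfl l).congr fun l => (e l).symm, ?_⟩
    rw [tsum_congr e]
    exact QAppell.third_transformation hq0 hq1 A hx hx0 hB0 hC hBx hsep
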